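/- **Notation.** Let $k$ be a field and let $\mathfrak E$ be the inverse monoid of partially defined injective maps $f:\mathbb N\supseteq \mathrm{dom}(f)\to\mathbb N$, with inverse $f\mapsto f^\dagger$. For a commutative ring $\ell$ let $\mathcal P(\ell)$ be the ring of sequences $\mathbb N\to \ell$ with finitely many values, $\mathcal P=\mathcal P(\mathbb Z)$. Let $\Gamma$ be Karoubi's cone of $\mathbb Z$: the ring of integral $\mathbb N\times\mathbb N$-matrices with finitely many different entries and with a bounded number of nonzero entries in each row and column. Let $U_f\in\Gamma$ be the matrix of $f\in\mathfrak E$, which has the entry $1$ at the places $(f(j),j)$, and embed $\mathcal P$ in $\Gamma$ as diagonal matrices. $\mathcal P$ is a left $\Gamma$-module through $f_*(\alpha)_n=\alpha_{f^\dagger(n)}$ if $n\in\mathrm{ran} f$ and $f_*(\alpha)_n=0$ otherwise; the $\Gamma$-linear map $\epsilon_l:\Gamma\to\mathcal P$, $U_f\mapsto \chi_{\mathrm{ran} f}$, splits the inclusion. Let $R$ be a unital (central) $\mathcal P(k)$-algebra on which $\mathfrak E$ acts by $k$-linear multiplicative maps $f_*$ such that $p_*(a)=pa$ for all idempotents $p=\chi_A$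 $(A\subseteq\mathbb N)$. Let $M$ be an $R$-bimodule, central over $\mathcal P(k)$, with an action of $\mathfrak E$ by additive maps $f_*$ that induces a $\Gamma$-module structure and satisfies $f_*(rms)=f_*(r)f_*(m)f_*(s)$. The crossed product $R\#_{\mathcal P}\Gamma=R\otimes_{\mathcal P}\Gamma$ is a ring, and $M\#_{\mathcal P}\Gamma=M\otimes_{\mathcal P}\Gamma$ is a bimodule over it, through $$(a\#U_f)(b\#U_g)=af_*(b)\#U_{fg},\quad (a\#U_f)(m\#U_g)=af_*(m)\#U_{fg},\quad (m\#U_g)(a\#U_f)=mg_*(a)\#U_{gf}.$$ For a ring homomorphism $A\to B$ and a $B$-bimodule $N$, $C(B/A,N)$ is the simplicial abelian group $C_n(B/A,N)=(N\otimes_AB^{\otimes_An})_A$ with the Hochschild faces (multiply $x_i$ and $x_{i+1}$ for $i<n$; the $n$-th face gives $x_nx_0\otimes x_1\otimes\dots\otimes x_{n-1}$) and with the degeneracies that insert $1$; $HH(B/A,N)$ is the associated chain complex. $C(R/\mathcal P(k),M)$ is a simplicial right $\Gamma$-module, where $U_f$ acts from the right by the diagonal action of $f^\dagger$. For a right $\Gamma$-module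 $N$, $\perp(\Gamma/\mathcal P,N)$ is the simplicial abelian group $\perp_n=N\otimes_{\mathcal P}\Gamma^{\otimes_{\mathcal P}n}$ whose $i$-th face multiplies $x_i$ and $x_{i+1}$ for $i<n$, whose $n$-th face is $x_0\otimes\dots\otimes x_{n-1}\epsilon_l(x_n)$, and whose degeneracies insert $1$. For a chain complex $D$ of right $\Gamma$-modules, $\mathbb H(\Gamma/\mathcal P,D)$ is the total complex of the double complex $\perp_p(\Gamma/\mathcal P,D_q)$. **Proposition.** There is one and only one morphism of simplicial abelian groups $$\phi:\mathrm{diag}\bigl(\perp(\Gamma/\mathcal P,C(R/\mathcal P(k),M))\bigr)\to C(R\#_{\mathcal P}\Gamma/\mathcal P(k),M\#_{\mathcal P}\Gamma)$$ such that, for all $n\ge 0$, $a_0\in M$, $a_1,\dots,a_n\in R$ and $f_1,\dots,f_n\in\mathfrak E$, $$\phi([a_0\otimes a_1\otimes\dots\otimes a_n\otimes U_{f_1}\otimes\dots\otimes U_{f_n}])=$$ $$\bigl[(f_1\cdots f_n)^\dagger_*(a_0)\#U_{(f_1\cdots f_n)^\dagger}\otimes a_1\#U_{f_1}\otimes (f_1)^\dagger_*(a_2)\#U_{f_2}\otimes\dots\otimes(f_1\cdots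 f_{n-1})^\dagger_*(a_n)\#U_{f_n}\bigr],$$ and $\phi$ is an isomorphism. Moreover there is a quasi-isomorphism $e$ from $\mathbb H(\Gamma/\mathcal P,HH(R/\mathcal P(k),M))$ to the chain complex of $\mathrm{diag}(\perp(\Gamma/\mathcal P,C(R/\mathcal P(k),M)))$, and $\phi e$ is a quasi-isomorphism $$\mathbb H(\Gamma/\mathcal P,HH(R/\mathcal P(k),M))\xrightarrow{\ \sim\ }HH(R\#_{\mathcal P}\Gamma/\mathcal P(k),M\#_{\mathcal P}\Gamma).$$ -/

import Mathlib

set_option linter.unusedSectionVars false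

open CategoryTheory Opposite

/-- The inverse monoid of partially defined injective maps of `ℕ` to itself. -/
def Emb : Type := ℕ ≃. ℕ

namespace Emb

/-- The partial map, with value `none` off its domain. -/
def app (f : Emb) (n : ℕ) : Option ℕ := (show ℕ ≃. ℕ from f) n

theorem ext' {f g : Emb} (h : ∀ n, f.app n = g.app n) : f = g := PEquiv.ext h

/-- The product is composition: `(f * g) n = f (g n)`. -/
instance : Monoid Emb where
  mul f g := PEquiv.trans g f
  one := PEquiv.refl ℕ
  mul_assoc f g h := (PEquiv.trans_assoc h g f).symm
  one_mul f := PEquiv.trans_refl f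
  mul_one f := PEquiv.refl_trans f

/-- The inverse of `f` in the inverse monoid. -/
def dag (f : Emb) : Emb := PEquiv.symm f

open Classical in
/-- The identity of the subset `A`. -/
noncomputable def idem (A : Set ℕ) : Emb := PEquiv.ofSet A

/-- The set `f(A ∩ dom f)`. -/
def image (f : Emb) (A : Set ℕ) : Set ℕ := {y | ∃ x ∈ A, f.app x = some y}

theorem mul_app (f g : Emb) (n : ℕ) : (f * g).app n = (g.app n).bind f.app := rfl

theorem one_app (n : ℕ) : (1 : Emb).app n = some n := rfl

theorem dag_app_eq {f : Emb} {x y : ℕ} : f.dag.app y = some x ↔ f.app x = some y :=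
  PEquiv.eq_some_iff f

theorem dag_mul (f g : Emb) : (f * g).dag = g.dag * f.dag := PEquiv.symm_trans_rev _ _

theorem dag_dag (f : Emb) : f.dag.dag = f := PEquiv.symm_symm f

theorem dag_one : (1 : Emb).dag = 1 := rfl

theorem app_inj {f : Emb} {x x' y : ℕ} (h : f.app x = some y) (h' : f.app x' = some y) :
    x = x' := by
  rw [← dag_app_eq] at h h'
  simpa [h] using h'

theorem idem_app_eq {A : Set ℕ} {x y : ℕ} : (idem A).app x = some y ↔ x = y ∧ x ∈ A := by
  classical
  simp only [app, idem]
  constructor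
  · intro h
    obtain ⟨h1, h2⟩ := PEquiv.mem_ofSet_iff.1 h
    subst h1; exact ⟨rfl, h2⟩
  · rintro ⟨rfl, h⟩
    exact PEquiv.mem_ofSet_iff.2 ⟨rfl, h⟩

theorem idem_app_of_mem {A : Set ℕ} {x : ℕ} (h : x ∈ A) : (idem A).app x = some x :=
  idem_app_eq.2 ⟨rfl, h⟩

theorem idem_app_of_not_mem {A : Set ℕ} {x : ℕ} (h : x ∉ A) : (idem A).app x = none := by
  rw [Option.eq_none_iff_forall_ne_some]
  intro y hy
  exact h (idem_app_eq.1 hy).2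

theorem dag_idem (A : Set ℕ) : (idem A).dag = idem A := by
  apply ext'
  intro n
  ext y
  rw [dag_app_eq, idem_app_eq, idem_app_eq]
  constructor <;> (rintro ⟨rfl, h⟩; exact ⟨rfl, h⟩)

theorem idem_univ : idem Set.univ = 1 := by
  apply ext'
  intro n
  rw [idem_app_of_mem (Set.mem_univ n), one_app]

theorem idem_mul_idem (A B : Set ℕ) : idem A * idem B = idem (A ∩ B) := by
  apply ext'
  intro n
  ext y
  simp only [mul_app, Option.bind_eq_some_iff, idem_app_eq]
  constructor
  · rintro ⟨a, ⟨rfl, h⟩, rfl, h'⟩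
    exact ⟨rfl, h', h⟩
  · rintro ⟨rfl, h, h'⟩
    exact ⟨n, ⟨rfl, h'⟩, rfl, h⟩

theorem mul_idem (f : Emb) (A : Set ℕ) : f * idem A = idem (f.image A) * f := by
  apply ext'
  intro n
  ext y
  simp only [mul_app, Option.bind_eq_some_iff, idem_app_eq, image,
    Set.mem_ofPred_eq]
  constructor
  · rintro ⟨a, ⟨rfl, h⟩, h'⟩
    exact ⟨y, h', rfl, n, h, h'⟩
  · rintro ⟨a, h, rfl, x, hx, hxa⟩
    obtain rfl := app_inj h hxa
    exact ⟨n, ⟨rfl, hx⟩, h⟩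

theorem mul_dag (f : Emb) : f * f.dag = idem (f.image Set.univ) := by
  apply ext'
  intro n
  ext y
  simp only [mul_app, Option.bind_eq_some_iff, idem_app_eq, image,
    Set.mem_ofPred_eq, dag_app_eq, Set.mem_univ, true_and]
  constructor
  · rintro ⟨a, h, h'⟩
    rw [h] at h'
    exact ⟨by simpa using h', a, h⟩
  · rintro ⟨rfl, x, hx⟩
    exact ⟨x, hx, hx⟩

theorem idem_image_mul (f : Emb) : idem (f.image Set.univ) * f = f := by
  rw [← mul_idem, idem_univ, mul_one]

theorem mul_idem_empty (f : Emb) : f * idem ∅ = idem ∅ := by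
  apply ext'
  intro n
  rw [mul_app, idem_app_of_not_mem (Set.notMem_empty n)]
  rfl

end Emb

/-- `𝒫(k)`: the algebra of sequences in `k` that take finitely many values. -/
def lcSubalgebra (k : Type*) [CommRing k] : Subalgebra k (ℕ → k) where
  carrier := {α | (Set.range α).Finite}
  mul_mem' {α β} hα hβ := (hα.image2 (· * ·) hβ).subset (by
    rintro _ ⟨n, rfl⟩; exact ⟨_, ⟨n, rfl⟩, _, ⟨n, rfl⟩, rfl⟩)
  add_mem' {α β} hα hβ := (hα.image2 (· + ·) hβ).subset (by
    rintro _ ⟨n, rfl⟩; exact ⟨_, ⟨n, rfl⟩, _, ⟨n, rfl⟩, rfl⟩)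
  algebraMap_mem' c := (Set.finite_singleton c).subset (by
    rintro _ ⟨n, rfl⟩; simp)

/-- `𝒫(k)` as a type; `LC ℤ` is `𝒫`. -/
def LC (k : Type*) [CommRing k] : Type _ := lcSubalgebra k

namespace LC

variable {k : Type*} [CommRing k]

instance : CommRing (LC k) := inferInstanceAs (CommRing (lcSubalgebra k))
instance : Algebra k (LC k) := inferInstanceAs (Algebra k (lcSubalgebra k))

/-- The `n`-th term of a sequence in `𝒫(k)`. -/
def val (α : LC k) (n : ℕ) : k := α.1 n

theorem ext' {α β : LC k} (h : ∀ n, α.val n = β.val n) : α = β := Subtype.ext (funext h)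

theorem finite_range (α : LC k) : (Set.range α.val).Finite := α.2

/-- A sequence with finitely many values, as an element of `𝒫(k)`. -/
def mk (α : ℕ → k) (h : (Set.range α).Finite) : LC k := ⟨α, h⟩

@[simp] theorem val_mk (α : ℕ → k) (h : (Set.range α).Finite) (n : ℕ) : (mk α h).val n = α n := rfl
@[simp] theorem val_add (α β : LC k) (n : ℕ) : (α + β).val n = α.val n + β.val n := rfl
@[simp] theorem val_mul (α β : LC k) (n : ℕ) : (α * β).val n = α.val n * β.val n := rfl
@[simp] theorem val_zero (n : ℕ) : (0 : LC k).val n = 0 := rfl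
@[simp] theorem val_one (n : ℕ) : (1 : LC k).val n = 1 := rfl
@[simp] theorem val_neg (α : LC k) (n : ℕ) : (-α).val n = -α.val n := rfl
@[simp] theorem val_smul (c : k) (α : LC k) (n : ℕ) : (c • α).val n = c * α.val n := rfl

open Classical in
/-- The characteristic function of `A`. -/
noncomputable def ind (k : Type*) [CommRing k] (A : Set ℕ) : LC k :=
  mk (fun n => if n ∈ A then 1 else 0)
    ((Set.toFinite {0, 1}).subset (by rintro _ ⟨n, rfl⟩; dsimp; split_ifs <;> simp))

open Classical in
@[simp] theorem val_ind (A : Set ℕ) (n : ℕ) : (ind k A).val n = if n ∈ A then 1 else 0 := rfl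

/-- The action of `f` on sequences: `(f_* α)_n = α_{f†(n)}` if `n ∈ ran f`, and `0` otherwise. -/
def push (f : Emb) (α : LC k) : LC k :=
  mk (fun n => (f.dag.app n).elim 0 α.val)
    ((α.finite_range.insert 0).subset (by
      rintro _ ⟨n, rfl⟩
      dsimp
      cases f.dag.app n with
      | none => simp
      | some m => exact Or.inr ⟨m, rfl⟩))

theorem val_push (f : Emb) (α : LC k) (n : ℕ) :
    (push f α).val n = (f.dag.app n).elim 0 α.val := rfl

instance : DistribMulAction Emb (LC k) where
  smul := push
  one_smul α := ext' fun n => rfl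
  mul_smul f g α := ext' fun n => by
    change (push (f * g) α).val n = (push f (push g α)).val n
    rw [val_push, val_push, Emb.dag_mul, Emb.mul_app]
    cases f.dag.app n with
    | none => rfl
    | some m => rfl
  smul_zero f := ext' fun n => by
    change (push f 0).val n = _
    rw [val_push]; cases f.dag.app n <;> rfl
  smul_add f α β := ext' fun n => by
    change (push f (α + β)).val n = (push f α + push f β).val n
    rw [val_add, val_push, val_push, val_push]
    cases f.dag.app n <;> simp

theorem val_emb_smul (f : Emb) (α : LC k) (n : ℕ) :
    (f • α).val n = (f.dag.app n).elim 0 α.val := rfl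

theorem emb_smul_mul (f : Emb) (α β : LC k) : f • (α * β) = (f • α) * (f • β) :=
  ext' fun n => by
    rw [val_mul, val_emb_smul, val_emb_smul, val_emb_smul]
    cases f.dag.app n <;> simp

theorem emb_smul_const (f : Emb) (c : k) (α : LC k) : f • (c • α) = c • (f • α) :=
  ext' fun n => by
    rw [val_smul, val_emb_smul, val_emb_smul]
    cases f.dag.app n <;> simp

theorem idem_smul (A : Set ℕ) (α : LC k) : Emb.idem A • α = ind k A * α :=
  ext' fun n => by
    rw [val_mul, val_emb_smul, Emb.dag_idem, val_ind]
    by_cases h : n ∈ A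
    · simp [Emb.idem_app_of_mem h, h]
    · simp [Emb.idem_app_of_not_mem h, h]

theorem smul_eq (c : k) (α : LC k) : c • α = algebraMap k (LC k) c * α := Algebra.smul_def c α

theorem ind_univ : ind k Set.univ = 1 := ext' fun n => by simp

theorem ind_mul_ind (A B : Set ℕ) : ind k A * ind k B = ind k (A ∩ B) := ext' fun n => by
  by_cases hA : n ∈ A <;> by_cases hB : n ∈ B <;> simp [hA, hB]

theorem ind_union {A B : Set ℕ} (h : Disjoint A B) : ind k (A ∪ B) = ind k A + ind k B :=
  ext' fun n => by
    have : ¬ (n ∈ A ∧ n ∈ B) := fun hn => Set.disjoint_left.1 h hn.1 hn.2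
    by_cases hA : n ∈ A <;> by_cases hB : n ∈ B <;> simp_all

theorem emb_smul_ind (f : Emb) (A : Set ℕ) : f • ind k A = ind k (f.image A) := ext' fun n => by
  rw [val_emb_smul, val_ind]
  cases h : f.dag.app n with
  | none =>
    have : n ∉ f.image A := by
      rintro ⟨x, _, hx⟩
      rw [← Emb.dag_app_eq, h] at hx
      cases hx
    simp [this]
  | some m =>
    rw [Emb.dag_app_eq] at h
    have : n ∈ f.image A ↔ m ∈ A := by
      constructor
      · rintro ⟨x, hx, hxn⟩
        rwa [Emb.app_inj h hxn]
      · exact fun hm => ⟨m, hm, h⟩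
    by_cases hm : m ∈ A
    · simp [hm, this.2 hm]
    · simp [hm, mt this.1 hm]

/-- `𝒫(k)` is spanned by characteristic functions. -/
theorem induction_on {p : LC k → Prop} (α : LC k) (hz : p 0)
    (hi : ∀ (c : k) (A : Set ℕ), p (c • ind k A)) (ha : ∀ α β, p α → p β → p (α + β)) : p α := by
  classical
  have key : α = ∑ c ∈ α.finite_range.toFinset, c • ind k {n | α.val n = c} := by
    apply ext'
    intro n
    let ev : LC k →+ k := { toFun := fun α => α.val n, map_zero' := rfl, map_add' := fun _ _ => rfl }
    change ev α = ev _
    rw [map_sum]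
    change α.val n = ∑ c ∈ α.finite_range.toFinset, (c • ind k {n | α.val n = c}).val n
    rw [Finset.sum_eq_single (α.val n)]
    · simp
    · intro c _ hc
      simp [hc.symm]
    · intro h
      exact absurd (α.finite_range.mem_toFinset.2 ⟨n, rfl⟩) h
  rw [key]
  exact Finset.sum_induction _ p ha hz fun c _ => hi c _

/-- The homomorphism `𝒫 → 𝒫(k)`. -/
def ofInt (k : Type*) [CommRing k] : LC ℤ →+* LC k where
  toFun α := mk (fun n => (α.val n : k)) ((α.finite_range.image (Int.cast : ℤ → k)).subset (by
    rintro _ ⟨n, rfl⟩; exact ⟨_, ⟨n, rfl⟩, rfl⟩))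
  map_one' := ext' fun n => by simp
  map_mul' α β := ext' fun n => by simp
  map_zero' := ext' fun n => by simp
  map_add' α β := ext' fun n => by simp

theorem val_ofInt (α : LC ℤ) (n : ℕ) : (ofInt k α).val n = (α.val n : k) := rfl

theorem ofInt_ind (A : Set ℕ) : ofInt k (ind ℤ A) = ind k A := ext' fun n => by
  by_cases h : n ∈ A <;> simp [val_ofInt, h]

theorem emb_smul_ofInt (f : Emb) (α : LC ℤ) : f • ofInt k α = ofInt k (f • α) := ext' fun n => by
  rw [val_ofInt, val_emb_smul, val_emb_smul]
  cases f.dag.app n <;> simp [val_ofInt]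

end LC

/-- The `(i, j)` entry of an endomorphism of `⊕_ℕ ℤ`, i.e. of an integral `ℕ × ℕ` matrix with
finite columns. -/
noncomputable def matEntry (T : Module.End ℤ (ℕ →₀ ℤ)) (i j : ℕ) : ℤ := T (Finsupp.single j 1) i

/-- The conditions of Karoubi's cone: the number of nonzero entries in a row or a column is bounded,
and there are only finitely many different entries. -/
def IsCone (T : Module.End ℤ (ℕ →₀ ℤ)) : Prop :=
  (∃ N : ℕ, (∀ i, {j | matEntry T i j ≠ 0}.encard ≤ N) ∧
    (∀ j, {i | matEntry T i j ≠ 0}.encard ≤ N)) ∧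
  (Set.range fun p : ℕ × ℕ => matEntry T p.1 p.2).Finite

/-- The matrix of `f`: the `(i, j)` entry is `1` if `f j = i` and `0` otherwise. -/
noncomputable def embEnd (f : Emb) : Module.End ℤ (ℕ →₀ ℤ) :=
  Finsupp.linearCombination ℤ fun j => (f.app j).elim 0 fun i => Finsupp.single i 1

theorem matEntry_ext {S T : Module.End ℤ (ℕ →₀ ℤ)} (h : ∀ i j, matEntry S i j = matEntry T i j) :
    S = T := by
  apply Finsupp.lhom_ext'
  intro j
  apply LinearMap.ext_ring
  ext i
  exact h i j

theorem matEntry_embEnd (f : Emb) (i j : ℕ) :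
    matEntry (embEnd f) i j = if f.app j = some i then 1 else 0 := by
  unfold matEntry embEnd
  rw [Finsupp.linearCombination_single, one_smul]
  cases f.app j with
  | none => simp
  | some m => simp [Finsupp.single_apply]

noncomputable def matEntryHom (i j : ℕ) : Module.End ℤ (ℕ →₀ ℤ) →+ ℤ where
  toFun T := matEntry T i j
  map_zero' := rfl
  map_add' _ _ := rfl

noncomputable def embEndHom : Emb →* Module.End ℤ (ℕ →₀ ℤ) where
  toFun := embEnd
  map_one' := by
    apply Finsupp.lhom_ext'
    intro j
    apply LinearMap.ext_ring
    simp [embEnd, Emb.one_app]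
  map_mul' f g := by
    apply Finsupp.lhom_ext'
    intro j
    apply LinearMap.ext_ring
    simp only [LinearMap.coe_comp, Function.comp_apply, Finsupp.lsingle_apply, Module.End.mul_apply]
    simp only [embEnd, Finsupp.linearCombination_single, one_smul, Emb.mul_app]
    cases g.app j with
    | none => simp
    | some m => simp

theorem isCone_embEnd (f : Emb) : IsCone (embEnd f) := by
  refine ⟨⟨1, fun i => ?_, fun j => ?_⟩, ?_⟩
  · rw [Nat.cast_one, Set.encard_le_one_iff]
    intro a b ha hb
    simp only [matEntry_embEnd, Set.mem_ofPred_eq, ne_eq, ite_eq_right_iff, one_ne_zero, imp_false,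
      not_not] at ha hb
    exact Emb.app_inj ha hb
  · rw [Nat.cast_one, Set.encard_le_one_iff]
    intro a b ha hb
    simp only [matEntry_embEnd, Set.mem_ofPred_eq, ne_eq, ite_eq_right_iff, one_ne_zero, imp_false,
      not_not] at ha hb
    simpa [ha] using hb
  · refine (Set.toFinite {0, 1}).subset ?_
    rintro _ ⟨p, rfl⟩
    dsimp
    rw [matEntry_embEnd]
    split_ifs <;> simp

theorem IsCone.zero : IsCone 0 := by
  have h : ∀ i j, matEntry 0 i j = 0 := fun i j => rfl
  refine ⟨⟨0, fun i => by simp [h], fun j => by simp [h]⟩, ?_⟩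
  refine (Set.finite_singleton 0).subset ?_
  rintro _ ⟨p, rfl⟩
  simp [h]

theorem IsCone.neg {T} (hT : IsCone T) : IsCone (-T) := by
  obtain ⟨⟨N, h1, h2⟩, h3⟩ := hT
  have h : ∀ i j, matEntry (-T) i j = -matEntry T i j := fun i j => rfl
  refine ⟨⟨N, fun i => by simpa [h] using h1 i, fun j => by simpa [h] using h2 j⟩, ?_⟩
  refine (h3.image (fun x => -x)).subset ?_
  rintro _ ⟨p, rfl⟩
  exact ⟨_, ⟨p, rfl⟩, (h _ _).symm⟩

theorem IsCone.add {S T} (hS : IsCone S) (hT : IsCone T) : IsCone (S + T) := by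
  obtain ⟨⟨N, h1, h2⟩, h3⟩ := hS
  obtain ⟨⟨N', h1', h2'⟩, h3'⟩ := hT
  have h : ∀ i j, matEntry (S + T) i j = matEntry S i j + matEntry T i j := fun i j => rfl
  refine ⟨⟨N + N', fun i => ?_, fun j => ?_⟩, ?_⟩
  · refine (Set.encard_le_encard ?_).trans ((Set.encard_union_le _ _).trans
      (by push_cast; exact add_le_add (h1 i) (h1' i)))
    intro j hj
    by_contra hc
    simp only [Set.mem_union, Set.mem_ofPred_eq, not_or, not_not, h] at hj hc
    simp [hc.1, hc.2] at hj
  · refine (Set.encard_le_encard ?_).trans ((Set.encard_union_le _ _).trans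
      (by push_cast; exact add_le_add (h2 j) (h2' j)))
    intro j hj
    by_contra hc
    simp only [Set.mem_union, Set.mem_ofPred_eq, not_or, not_not, h] at hj hc
    simp [hc.1, hc.2] at hj
  · refine (h3.image2 (· + ·) h3').subset ?_
    rintro _ ⟨p, rfl⟩
    exact ⟨_, ⟨p, rfl⟩, _, ⟨p, rfl⟩, rfl⟩

theorem Emb.exists_of_rel (r : ℕ → ℕ → Prop) (h1 : ∀ i i' j, r i j → r i' j → i = i')
    (h2 : ∀ i j j', r i j → r i j' → j = j') : ∃ f : Emb, ∀ i j, f.app j = some i ↔ r i j := by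
  classical
  let f : ℕ ≃. ℕ :=
    { toFun := fun j => if h : ∃ i, r i j then some h.choose else none
      invFun := fun i => if h : ∃ j, r i j then some h.choose else none
      inv := by
        intro j i
        have e1 : (if h : ∃ i, r i j then some h.choose else none) = some i ↔ r i j := by
          constructor
          · intro h
            split_ifs at h with h'
            rw [← Option.some_inj.1 h]
            exact h'.choose_spec
          · intro h
            have h' : ∃ i, r i j := ⟨i, h⟩
            rw [dif_pos h', h1 _ _ _ h h'.choose_spec]
        have e2 : (if h : ∃ j, r i j then some h.choose else none) = some j ↔ r i j := by
          constructor
          · intro h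
            split_ifs at h with h'
            rw [← Option.some_inj.1 h]
            exact h'.choose_spec
          · intro h
            have h' : ∃ j, r i j := ⟨j, h⟩
            rw [dif_pos h', h2 _ _ _ h h'.choose_spec]
        rw [e1, e2] }
  refine ⟨f, fun i j => ?_⟩
  change (if h : ∃ i, r i j then some h.choose else none) = some i ↔ r i j
  constructor
  · intro h
    split_ifs at h with h'
    rw [← Option.some_inj.1 h]
    exact h'.choose_spec
  · intro h
    have h' : ∃ i, r i j := ⟨i, h⟩
    rw [dif_pos h', h1 _ _ _ h h'.choose_spec]

theorem rank_inj {s : Set ℕ} {a b : ℕ} (ha : a ∈ s) (hb : b ∈ s)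
    (h : {x ∈ s | x < a}.ncard = {x ∈ s | x < b}.ncard) : a = b := by
  have key : ∀ {a b : ℕ}, a ∈ s → a < b → {x ∈ s | x < a}.ncard < {x ∈ s | x < b}.ncard := by
    intro a b ha hab
    apply Set.ncard_lt_ncard
    · refine ⟨fun x hx => ⟨hx.1, hx.2.trans hab⟩, fun hs => ?_⟩
      exact lt_irrefl a (hs ⟨ha, hab⟩ : a ∈ {x ∈ s | x < a}).2
    · exact (Set.finite_lt_nat b).subset fun x hx => hx.2
  rcases lt_trichotomy a b with hab | hab | hab
  · exact absurd h (key ha hab).ne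
  · exact hab
  · exact absurd h (key hb hab).ne'

theorem rank_lt {s : Set ℕ} {a N : ℕ} (ha : a ∈ s) (h : s.encard ≤ N) :
    {x ∈ s | x < a}.ncard < N := by
  have hs : s.Finite := Set.finite_of_encard_le_coe h
  have h1 : {x ∈ s | x < a}.ncard < s.ncard := Set.ncard_lt_ncard
    ⟨fun x hx => hx.1, fun hc => lt_irrefl a (hc ha).2⟩ hs
  have h2 : s.ncard ≤ N := by
    rw [← Nat.cast_le (α := ℕ∞), hs.cast_ncard_eq]
    exact h
  omega

/-- The matrices that satisfy the conditions of the cone are the integral linear combinations of the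
matrices of partially defined injections. -/
theorem isCone_iff (T : Module.End ℤ (ℕ →₀ ℤ)) :
    IsCone T ↔ T ∈ AddSubgroup.closure (Set.range embEndHom) := by
  classical
  constructor
  · rintro ⟨⟨N, h1, h2⟩, h3⟩
    let row (i : ℕ) : Set ℕ := {j | matEntry T i j ≠ 0}
    let col (j : ℕ) : Set ℕ := {i | matEntry T i j ≠ 0}
    let r (t : ℤ × ℕ × ℕ) (i j : ℕ) : Prop := matEntry T i j = t.1 ∧ matEntry T i j ≠ 0 ∧
      {x ∈ row i | x < j}.ncard = t.2.1 ∧ {x ∈ col j | x < i}.ncard = t.2.2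
    have hr : ∀ t, ∃ f : Emb, ∀ i j, f.app j = some i ↔ r t i j := by
      intro t
      apply Emb.exists_of_rel
      · rintro i i' j ⟨_, h, _, e⟩ ⟨_, h', _, e'⟩
        exact rank_inj (s := col j) h h' (e.trans e'.symm)
      · rintro i j j' ⟨_, h, e, _⟩ ⟨_, h', e', _⟩
        exact rank_inj (s := row i) h h' (e.trans e'.symm)
    choose f hf using hr
    have key : T = ∑ t ∈ h3.toFinset ×ˢ (Finset.range N ×ˢ Finset.range N),
        t.1 • embEndHom (f t) := by
      apply matEntry_ext
      intro i j
      change _ = matEntryHom i j _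
      rw [map_sum]
      have e : ∀ t : ℤ × ℕ × ℕ, matEntryHom i j (t.1 • embEndHom (f t)) =
          if r t i j then t.1 else 0 := by
        intro t
        rw [map_zsmul]
        change t.1 • matEntry (embEnd (f t)) i j = _
        rw [matEntry_embEnd]
        by_cases h : r t i j
        · rw [if_pos h, if_pos ((hf t i j).2 h), smul_eq_mul, mul_one]
        · rw [if_neg h, if_neg (mt (hf t i j).1 h), smul_zero]
      rw [Finset.sum_congr rfl fun t _ => e t]
      by_cases h0 : matEntry T i j = 0
      · refine h0.trans (Finset.sum_eq_zero ?_).symm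
        intro t _
        rw [if_neg]
        exact fun h => h.2.1 h0
      · rw [Finset.sum_eq_single (matEntry T i j, {x ∈ row i | x < j}.ncard,
          {x ∈ col j | x < i}.ncard)]
        · rw [if_pos ⟨rfl, h0, rfl, rfl⟩]
        · rintro ⟨c, a, b⟩ _ hne
          rw [if_neg]
          rintro ⟨rfl, _, rfl, rfl⟩
          exact hne rfl
        · intro hn
          refine absurd ?_ hn
          simp only [Finset.mem_product, Finset.mem_range]
          exact ⟨h3.mem_toFinset.2 ⟨(i, j), rfl⟩, rank_lt (s := row i) h0 (h1 i),
            rank_lt (s := col j) h0 (h2 j)⟩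
    rw [key]
    exact sum_mem fun t _ => zsmul_mem (AddSubgroup.subset_closure (Set.mem_range_self (f t))) _
  · intro h
    induction h using AddSubgroup.closure_induction with
    | mem x hx => obtain ⟨f, rfl⟩ := hx; exact isCone_embEnd f
    | zero => exact IsCone.zero
    | add x y _ _ hx hy => exact hx.add hy
    | neg x _ hx => exact hx.neg

theorem IsCone.mul {S T} (hS : IsCone S) (hT : IsCone T) : IsCone (S * T) := by
  rw [isCone_iff] at *
  induction hS using AddSubgroup.closure_induction with
  | mem x hx =>
    obtain ⟨f, rfl⟩ := hx
    induction hT using AddSubgroup.closure_induction with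
    | mem y hy =>
      obtain ⟨g, rfl⟩ := hy
      rw [← map_mul]
      exact AddSubgroup.subset_closure ⟨_, rfl⟩
    | zero => rw [mul_zero]; exact zero_mem _
    | add y z _ _ hy hz => rw [mul_add]; exact add_mem hy hz
    | neg y _ hy => rw [mul_neg]; exact neg_mem hy
  | zero => rw [zero_mul]; exact zero_mem _
  | add y z _ _ hy hz => rw [add_mul]; exact add_mem hy hz
  | neg y _ hy => rw [neg_mul]; exact neg_mem hy

/-- Karoubi's cone `Γ = Γ(ℤ)` as a ring of matrices. -/
def coneSubring : Subring (Module.End ℤ (ℕ →₀ ℤ)) where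
  carrier := {T | IsCone T}
  mul_mem' := IsCone.mul
  one_mem' := by
    have := isCone_embEnd 1
    have h : embEnd 1 = 1 := map_one embEndHom
    rwa [h] at this
  add_mem' := IsCone.add
  zero_mem' := IsCone.zero
  neg_mem' := IsCone.neg

/-- Karoubi's cone `Γ`. -/
def Gam : Type := coneSubring

namespace Gam

noncomputable instance : Ring Gam := inferInstanceAs (Ring coneSubring)

/-- The entries of an element of `Γ`. -/
noncomputable def entry (A : Gam) (i j : ℕ) : ℤ := matEntry A.1 i j

theorem entry_ext {A B : Gam} (h : ∀ i j, A.entry i j = B.entry i j) : A = B :=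
  Subtype.ext (matEntry_ext h)

noncomputable def entryHom (i j : ℕ) : Gam →+ ℤ where
  toFun A := A.entry i j
  map_zero' := rfl
  map_add' _ _ := rfl

/-- The homomorphism `U : Emb → Γ`. -/
noncomputable def U : Emb →* Gam where
  toFun f := ⟨embEnd f, isCone_embEnd f⟩
  map_one' := Subtype.ext (map_one embEndHom)
  map_mul' f g := Subtype.ext (map_mul embEndHom f g)

theorem entry_U (f : Emb) (i j : ℕ) : (U f).entry i j = if f.app j = some i then 1 else 0 :=
  matEntry_embEnd f i j

/-- `Γ` is spanned by the `U f`. -/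
theorem induction_on {p : Gam → Prop} (A : Gam) (hU : ∀ f, p (U f)) (hz : p 0)
    (ha : ∀ A B, p A → p B → p (A + B)) (hn : ∀ A, p A → p (-A)) : p A := by
  obtain ⟨T, hT⟩ := A
  have hT' := (isCone_iff T).1 hT
  have : ∀ hT : IsCone T, p ⟨T, hT⟩ := by
    clear hT
    induction hT' using AddSubgroup.closure_induction with
    | mem x hx => obtain ⟨f, rfl⟩ := hx; exact fun _ => hU f
    | zero => exact fun _ => hz
    | add x y hx hy ihx ihy =>
      exact fun _ => ha ⟨x, (isCone_iff x).2 hx⟩ ⟨y, (isCone_iff y).2 hy⟩ (ihx _) (ihy _)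
    | neg x hx ihx => exact fun _ => hn ⟨x, (isCone_iff x).2 hx⟩ (ihx _)
  exact this hT

open Classical in
theorem entry_U_idem (A : Set ℕ) (i j : ℕ) :
    (U (Emb.idem A)).entry i j = if j = i ∧ j ∈ A then 1 else 0 := by
  rw [entry_U]
  by_cases h : j = i ∧ j ∈ A
  · rw [if_pos h, if_pos (Emb.idem_app_eq.2 h)]
  · rw [if_neg h, if_neg (mt Emb.idem_app_eq.1 h)]

theorem U_idem_union {A B : Set ℕ} (h : Disjoint A B) :
    U (Emb.idem (A ∪ B)) = U (Emb.idem A) + U (Emb.idem B) := by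
  apply entry_ext
  intro i j
  change _ = (U (Emb.idem A)).entry i j + (U (Emb.idem B)).entry i j
  simp only [entry_U_idem]
  have : ¬ (j ∈ A ∧ j ∈ B) := fun hn => Set.disjoint_left.1 h hn.1 hn.2
  by_cases hij : j = i <;> by_cases hA : j ∈ A <;> by_cases hB : j ∈ B <;> simp_all

/-- A homomorphism from the monoid of partially defined injections to the multiplicative monoid of
a ring is tight if it is additive on disjoint unions of idempotents. -/
def Tight {S : Type*} [Ring S] (ρ : Emb →* S) : Prop :=
  ∀ A B : Set ℕ, Disjoint A B → ρ (Emb.idem (A ∪ B)) = ρ (Emb.idem A) + ρ (Emb.idem B)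

theorem Tight.empty {S : Type*} [Ring S] {ρ : Emb →* S} (hρ : Tight ρ) : ρ (Emb.idem ∅) = 0 := by
  have := hρ ∅ ∅ (Set.disjoint_empty _)
  rw [Set.union_empty] at this
  simpa using this

theorem Tight.sum {S : Type*} [Ring S] {ρ : Emb →* S} (hρ : Tight ρ) {ι : Type*}
    (s : Finset ι) (t : ℕ → ι) :
    ρ (Emb.idem {n | t n ∈ s}) = ∑ i ∈ s, ρ (Emb.idem {n | t n = i}) := by
  classical
  induction s using Finset.induction_on with
  | empty => simpa using hρ.empty
  | insert i s hi ih =>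
    rw [Finset.sum_insert hi, ← ih, ← hρ]
    · congr 2
      ext n
      simp
    · rw [Set.disjoint_left]
      rintro n h h'
      simp only [Set.mem_ofPred_eq] at h h'
      rw [h] at h'
      exact hi h'

/-- A relation between the `U f` holds in every tight representation. -/
theorem Tight.rel {S : Type*} [Ring S] {ρ : Emb →* S} (hρ : Tight ρ) (F : Finset Emb) (c : Emb → ℤ)
    (h : ∑ f ∈ F, c f • U f = 0) : ∑ f ∈ F, c f • ρ f = 0 := by
  classical
  let F' : Finset Emb := insert (Emb.idem ∅) F
  let t (n : ℕ) : Finset (Emb × Emb) := {p ∈ F' ×ˢ F' | p.1.app n = p.2.app n}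
  have h1 : (1 : S) = ∑ s ∈ (F' ×ˢ F').powerset, ρ (Emb.idem {n | t n = s}) := by
    rw [← hρ.sum]
    have : {n | t n ∈ (F' ×ˢ F').powerset} = Set.univ := by
      ext n
      simp [t]
    rw [this, Emb.idem_univ, map_one]
  have h2 : ∀ s, ∑ f ∈ F, c f • ρ (f * Emb.idem {n | t n = s}) = 0 := by
    intro s
    rcases Set.eq_empty_or_nonempty {n | t n = s} with he | ⟨j, hj⟩
    · rw [he]
      apply Finset.sum_eq_zero
      intro f _
      rw [Emb.mul_idem_empty, hρ.empty, smul_zero]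
    · have hfg : ∀ f ∈ F', ∀ g ∈ F', f.app j = g.app j →
          f * Emb.idem {n | t n = s} = g * Emb.idem {n | t n = s} := by
        intro f hf g hg hfg
        apply Emb.ext'
        intro n
        rw [Emb.mul_app, Emb.mul_app]
        by_cases hn : n ∈ {n | t n = s}
        · rw [Emb.idem_app_of_mem hn]
          have hm : (f, g) ∈ t j := by simp [t, hf, hg, hfg]
          rw [show t j = t n from hj.trans hn.symm] at hm
          exact (Finset.mem_filter.1 hm).2
        · rw [Emb.idem_app_of_not_mem hn, Option.bind_none, Option.bind_none]
      rw [← Finset.sum_fiberwise_of_maps_to (t := F.image fun f => f.app j) (g := fun f => f.app j)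
        (fun f hf => Finset.mem_image_of_mem _ hf)]
      apply Finset.sum_eq_zero
      intro v hv
      obtain ⟨g, hg, rfl⟩ := Finset.mem_image.1 hv
      have e : ∀ f ∈ F.filter (fun f => f.app j = g.app j),
          c f • ρ (f * Emb.idem {n | t n = s}) = c f • ρ (g * Emb.idem {n | t n = s}) := by
        intro f hf
        rw [hfg f (Finset.mem_insert_of_mem (Finset.mem_filter.1 hf).1) g
          (Finset.mem_insert_of_mem hg) (Finset.mem_filter.1 hf).2]
      rw [Finset.sum_congr rfl e, ← Finset.sum_smul]
      cases hgj : g.app j with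
      | none =>
        have : g * Emb.idem {n | t n = s} = Emb.idem ∅ * Emb.idem {n | t n = s} :=
          hfg g (Finset.mem_insert_of_mem hg) _ (Finset.mem_insert_self _ _)
            (hgj.trans (Emb.idem_app_of_not_mem (Set.notMem_empty j)).symm)
        rw [this, map_mul, hρ.empty, zero_mul, smul_zero]
      | some i =>
        have h3 := congrArg (entryHom i j) h
        rw [map_sum, map_zero] at h3
        have e' : ∀ f ∈ F, entryHom i j (c f • U f) = if f.app j = some i then c f else 0 := by
          intro f _
          rw [map_zsmul]
          change c f • (U f).entry i j = _
          rw [entry_U]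
          split_ifs <;> simp
        rw [Finset.sum_congr rfl e', ← Finset.sum_filter] at h3
        rw [h3, zero_smul]
  calc ∑ f ∈ F, c f • ρ f
      = ∑ f ∈ F, ∑ s ∈ (F' ×ˢ F').powerset, c f • ρ (f * Emb.idem {n | t n = s}) := by
        apply Finset.sum_congr rfl
        intro f _
        simp_rw [map_mul]
        rw [← Finset.smul_sum, ← Finset.mul_sum, ← h1, mul_one]
    _ = 0 := by
        rw [Finset.sum_comm]
        exact Finset.sum_eq_zero fun s _ => h2 s

theorem lift_surjective : Function.Surjective (MonoidAlgebra.lift ℤ Gam Emb U) := by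
  intro A
  induction A using induction_on with
  | hU f => exact ⟨MonoidAlgebra.of ℤ Emb f, MonoidAlgebra.lift_of _ _⟩
  | hz => exact ⟨0, map_zero _⟩
  | ha A B hA hB =>
    obtain ⟨a, rfl⟩ := hA
    obtain ⟨b, rfl⟩ := hB
    exact ⟨a + b, map_add _ _ _⟩
  | hn A hA =>
    obtain ⟨a, rfl⟩ := hA
    exact ⟨-a, map_neg _ _⟩

theorem Tight.ker_le {S : Type*} [Ring S] {ρ : Emb →* S} (hρ : Tight ρ) :
    RingHom.ker (MonoidAlgebra.lift ℤ Gam Emb U).toRingHom ≤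
      RingHom.ker (MonoidAlgebra.lift ℤ S Emb ρ).toRingHom := by
  intro z hz
  have hz' : MonoidAlgebra.lift ℤ Gam Emb U z = 0 := hz
  change MonoidAlgebra.lift ℤ S Emb ρ z = 0
  rw [MonoidAlgebra.lift_apply] at hz' ⊢
  exact hρ.rel _ _ hz'

/-- `Γ` is the quotient of the monoid ring of the monoid of partially defined injections that is
universal for tight representations. -/
noncomputable def lift {S : Type*} [Ring S] (ρ : Emb →* S) (hρ : Tight ρ) : Gam →+* S :=
  RingHom.liftOfRightInverse (MonoidAlgebra.lift ℤ Gam Emb U).toRingHom _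
    (Function.rightInverse_surjInv lift_surjective)
    ⟨(MonoidAlgebra.lift ℤ S Emb ρ).toRingHom, hρ.ker_le⟩

theorem lift_U {S : Type*} [Ring S] (ρ : Emb →* S) (hρ : Tight ρ) (f : Emb) :
    lift ρ hρ (U f) = ρ f := by
  have := RingHom.liftOfRightInverse_comp_apply (MonoidAlgebra.lift ℤ Gam Emb U).toRingHom _
    (Function.rightInverse_surjInv lift_surjective)
    ⟨(MonoidAlgebra.lift ℤ S Emb ρ).toRingHom, hρ.ker_le⟩ (MonoidAlgebra.of ℤ Emb f)
  change lift ρ hρ (MonoidAlgebra.lift ℤ Gam Emb U (MonoidAlgebra.of ℤ Emb f)) =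
    MonoidAlgebra.lift ℤ S Emb ρ (MonoidAlgebra.of ℤ Emb f) at this
  rwa [MonoidAlgebra.lift_of, MonoidAlgebra.lift_of] at this

theorem hom_ext {G : Type*} [AddCommGroup G] {φ ψ : Gam →+ G} (h : ∀ f, φ (U f) = ψ (U f)) :
    φ = ψ := by
  ext A
  induction A using induction_on with
  | hU f => exact h f
  | hz => rw [map_zero, map_zero]
  | ha A B hA hB => rw [map_add, map_add, hA, hB]
  | hn A hA => rw [map_neg, map_neg, hA]

end Gam

namespace Gam

/-- The embedding of `𝒫` into `Γ` as diagonal matrices. -/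
noncomputable def diag : LC ℤ →+* Gam where
  toFun α := ⟨Finsupp.linearCombination ℤ fun j => Finsupp.single j (α.val j), by
    have h : ∀ i j, matEntry (Finsupp.linearCombination ℤ fun j => Finsupp.single j (α.val j)) i j =
        if j = i then α.val j else 0 := by
      intro i j
      unfold matEntry
      rw [Finsupp.linearCombination_single, one_smul, Finsupp.single_apply]
    refine ⟨⟨1, fun i => ?_, fun j => ?_⟩, ?_⟩
    · rw [Nat.cast_one, Set.encard_le_one_iff]
      intro a b ha hb
      simp only [h, Set.mem_ofPred_eq, ne_eq, ite_eq_right_iff, Classical.not_imp] at ha hb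
      rw [ha.1, hb.1]
    · rw [Nat.cast_one, Set.encard_le_one_iff]
      intro a b ha hb
      simp only [h, Set.mem_ofPred_eq, ne_eq, ite_eq_right_iff, Classical.not_imp] at ha hb
      rw [← ha.1, ← hb.1]
    · refine (α.finite_range.insert 0).subset ?_
      rintro _ ⟨p, rfl⟩
      dsimp only
      rw [h]
      split_ifs
      · exact Or.inr ⟨_, rfl⟩
      · exact Or.inl rfl⟩
  map_one' := Subtype.ext (by
    apply Finsupp.lhom_ext'
    intro j
    apply LinearMap.ext_ring
    simp only [LinearMap.coe_comp, Function.comp_apply, Finsupp.lsingle_apply,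
      Finsupp.linearCombination_single, one_smul, LC.val_one]
    rfl)
  map_mul' α β := Subtype.ext (by
    apply Finsupp.lhom_ext'
    intro j
    apply LinearMap.ext_ring
    change (Finsupp.linearCombination ℤ fun j => Finsupp.single j ((α * β).val j))
      (Finsupp.single j 1) = (Finsupp.linearCombination ℤ fun j => Finsupp.single j (α.val j))
        ((Finsupp.linearCombination ℤ fun j => Finsupp.single j (β.val j)) (Finsupp.single j 1))
    simp [Finsupp.linearCombination_single, mul_comm])
  map_zero' := Subtype.ext (by
    apply Finsupp.lhom_ext'
    intro j
    apply LinearMap.ext_ring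
    simp only [LinearMap.coe_comp, Function.comp_apply, Finsupp.lsingle_apply,
      Finsupp.linearCombination_single, one_smul, LC.val_zero, Finsupp.single_zero]
    rfl)
  map_add' α β := Subtype.ext (by
    apply Finsupp.lhom_ext'
    intro j
    apply LinearMap.ext_ring
    change (Finsupp.linearCombination ℤ fun j => Finsupp.single j ((α + β).val j))
      (Finsupp.single j 1) = (Finsupp.linearCombination ℤ fun j => Finsupp.single j (α.val j))
        (Finsupp.single j 1) +
        (Finsupp.linearCombination ℤ fun j => Finsupp.single j (β.val j)) (Finsupp.single j 1)
    simp [Finsupp.linearCombination_single])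

theorem entry_diag (α : LC ℤ) (i j : ℕ) : (diag α).entry i j = if j = i then α.val j else 0 := by
  change matEntry (Finsupp.linearCombination ℤ fun j => Finsupp.single j (α.val j)) i j = _
  unfold matEntry
  rw [Finsupp.linearCombination_single, one_smul, Finsupp.single_apply]

theorem diag_ind (A : Set ℕ) : diag (LC.ind ℤ A) = U (Emb.idem A) := by
  classical
  apply entry_ext
  intro i j
  rw [entry_diag, entry_U_idem, LC.val_ind]
  by_cases h : j = i <;> by_cases h' : j ∈ A <;> simp [h, h']

theorem U_mul_diag (f : Emb) (p : LC ℤ) : U f * diag p = diag (f • p) * U f := by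
  induction p using LC.induction_on with
  | hz => simp
  | hi c A =>
    rw [LC.emb_smul_const, LC.emb_smul_ind, LC.smul_eq, LC.smul_eq, eq_intCast, map_mul, map_mul, map_intCast,
      diag_ind, diag_ind, mul_assoc, ← map_mul, ← Emb.mul_idem, map_mul, ← mul_assoc, ← mul_assoc,
      (Int.cast_commute c (U f)).eq]
  | ha α β hα hβ => rw [smul_add, map_add, map_add, mul_add, add_mul, hα, hβ]

/-- A tight action of the monoid of partially defined injections on an abelian group extends to
`Γ`. -/
noncomputable def extend {X : Type*} [AddCommGroup X] [DistribMulAction Emb X]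
    (h : Tight (DistribMulAction.toAddMonoidEnd Emb X)) : Gam →+* AddMonoid.End X :=
  lift (DistribMulAction.toAddMonoidEnd Emb X) h

theorem extend_U {X : Type*} [AddCommGroup X] [DistribMulAction Emb X]
    (h : Tight (DistribMulAction.toAddMonoidEnd Emb X)) (f : Emb) (x : X) :
    extend h (U f) x = f • x := by
  unfold extend
  rw [lift_U]
  rfl

theorem tight_LC : Tight (DistribMulAction.toAddMonoidEnd Emb (LC ℤ)) :=
  fun A B h => AddMonoidHom.ext fun x => by
    change Emb.idem (A ∪ B) • x = Emb.idem A • x + Emb.idem B • x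
    rw [LC.idem_smul, LC.idem_smul, LC.idem_smul, LC.ind_union h, add_mul]

/-- `𝒫` as a left module over `Γ`; `U f` acts by `f_*`. -/
noncomputable instance : Module Gam (LC ℤ) := Module.compHom (LC ℤ) (extend tight_LC)

theorem U_smul (f : Emb) (p : LC ℤ) : U f • p = f • p := extend_U tight_LC f p

theorem diag_smul (p q : LC ℤ) : diag p • q = p * q := by
  induction p using LC.induction_on with
  | hz => rw [map_zero, zero_smul, zero_mul]
  | hi c A =>
    rw [LC.smul_eq, eq_intCast, map_mul, map_intCast, mul_smul, Int.cast_smul_eq_zsmul, diag_ind, U_smul,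
      LC.idem_smul, zsmul_eq_mul, mul_assoc]
  | ha α β hα hβ => rw [map_add, add_smul, add_mul, hα, hβ]

end Gam

/-- An augmented algebra `(B, A, π)`: a ring homomorphism `A → B` and a structure of left `B`-module
on `A` together with a homomorphism `π : B → A` of left `B`-modules that splits it. -/
structure AugmentedAlgebra (A B : Type*) [Ring A] [Ring B] [Module B A] where
  incl : A →+* B
  aug : B →ₗ[B] A
  aug_incl : ∀ a, aug (incl a) = a

/-- The augmented algebra `(Γ, 𝒫, ε_l)`; `ε_l A = A • 1`, so that `ε_l (U f)` is the characteristic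
function of the range of `f`. -/
noncomputable def Gam.augmented : AugmentedAlgebra (LC ℤ) Gam where
  incl := Gam.diag
  aug := LinearMap.toSpanSingleton Gam (LC ℤ) 1
  aug_incl a := by rw [LinearMap.toSpanSingleton_apply, Gam.diag_smul, mul_one]

theorem Gam.augmented_aug_U (f : Emb) :
    Gam.augmented.aug (Gam.U f) = LC.ind ℤ (f.image Set.univ) := by
  change Gam.U f • (1 : LC ℤ) = _
  rw [Gam.U_smul, ← LC.ind_univ, LC.emb_smul_ind]

/-- `R` is an `Emb`-bundle over `k`: the action of `Emb` on the `𝒫(k)`-algebra `R` is by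
multiplicative `k`-linear maps and `p_*(a) = p a` for idempotent `p`. -/
class EmbBundle (k R : Type*) [CommRing k] [Ring R] [Algebra (LC k) R] [DistribMulAction Emb R] :
    Prop where
  emb_mul : ∀ (f : Emb) (a b : R), f • (a * b) = (f • a) * (f • b)
  emb_const : ∀ (f : Emb) (c : k) (a : R),
    f • (algebraMap k (LC k) c • a) = algebraMap k (LC k) c • (f • a)
  idem_smul : ∀ (A : Set ℕ) (a : R), Emb.idem A • a = LC.ind k A • a

/-- `M` is a covariant bimodule over the `Emb`-bundle `R`: an `R`-bimodule, central over `𝒫(k)`, with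
an action of `Emb` that induces a structure of `Γ`-module and is compatible with the bimodule
structure. -/
class CovariantBimodule (k R M : Type*) [CommRing k] [Ring R] [Algebra (LC k) R]
    [DistribMulAction Emb R] [AddCommGroup M] [Module R M] [Module Rᵐᵒᵖ M] [SMulCommClass R Rᵐᵒᵖ M]
    [Module (LC k) M] [IsScalarTower (LC k) R M] [IsScalarTower (LC k) Rᵐᵒᵖ M]
    [DistribMulAction Emb M] : Prop where
  exists_gam : ∃ ρ : Gam →+* AddMonoid.End M, ∀ (f : Emb) (m : M), ρ (Gam.U f) m = f • m
  covariant : ∀ (f : Emb) (r s : R) (m : M),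
    f • (r • MulOpposite.op s • m) = (f • r) • MulOpposite.op (f • s) • (f • m)

/-- The properties of an action of `Emb` on a `𝒫(k)`-module that are needed to form its crossed
product with `Γ`. -/
structure EmbModule (k X : Type*) [CommRing k] [AddCommGroup X] [Module (LC k) X]
    [DistribMulAction Emb X] : Prop where
  smul_smul : ∀ (f : Emb) (p : LC k) (x : X), f • (p • x) = (f • p) • (f • x)
  idem_smul : ∀ (A : Set ℕ) (x : X), Emb.idem A • x = LC.ind k A • x

theorem op_smul_one_smul (k R : Type*) {M : Type*} [CommRing k] [Ring R] [Algebra (LC k) R]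
    [AddCommGroup M] [Module Rᵐᵒᵖ M] [Module (LC k) M] [IsScalarTower (LC k) Rᵐᵒᵖ M] (p : LC k)
    (m : M) : MulOpposite.op (p • (1 : R)) • m = p • m := by
  rw [MulOpposite.op_smul, smul_assoc, MulOpposite.op_one, one_smul]

section EmbModule

variable {k : Type*} [CommRing k]

theorem EmbModule.ran {X : Type*} [AddCommGroup X] [Module (LC k) X] [DistribMulAction Emb X]
    (h : EmbModule k X) (f : Emb) (x : X) : LC.ind k (f.image Set.univ) • (f • x) = f • x := by
  rw [← h.idem_smul, ← mul_smul, Emb.idem_image_mul]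

theorem EmbModule.tight {X : Type*} [AddCommGroup X] [Module (LC k) X] [DistribMulAction Emb X]
    (h : EmbModule k X) : Gam.Tight (DistribMulAction.toAddMonoidEnd Emb X) := by
  refine fun A B hAB => AddMonoidHom.ext fun x => ?_
  change Emb.idem (A ∪ B) • x = Emb.idem A • x + Emb.idem B • x
  rw [h.idem_smul, h.idem_smul, h.idem_smul, LC.ind_union hAB, add_smul]

variable (k) {R : Type*} [Ring R] [Algebra (LC k) R] [DistribMulAction Emb R]

theorem EmbBundle.embModule [EmbBundle k R] : EmbModule k R where
  smul_smul f p x := by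
    induction p using LC.induction_on with
    | hz => simp
    | hi c A =>
      have e : ∀ q : LC k, c • q = algebraMap k (LC k) c * q := fun q => Algebra.smul_def c q
      rw [LC.emb_smul_const, e, e, mul_smul, mul_smul, EmbBundle.emb_const, LC.emb_smul_ind,
        ← EmbBundle.idem_smul, ← EmbBundle.idem_smul, ← mul_smul, ← mul_smul, Emb.mul_idem]
    | ha α β hα hβ => rw [add_smul, smul_add, smul_add, add_smul, hα, hβ]
  idem_smul A x := EmbBundle.idem_smul A x

theorem EmbBundle.emb_one [EmbBundle k R] (f : Emb) :
    f • (1 : R) = LC.ind k (f.image Set.univ) • 1 := by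
  have h := EmbBundle.embModule k (R := R)
  have h1 : (f • (1 : R)) * (f • f.dag • (1 : R)) = f • f.dag • (1 : R) := by
    rw [← EmbBundle.emb_mul k, one_mul]
  rw [← mul_smul, Emb.mul_dag, h.idem_smul, mul_smul_comm, mul_one, h.ran] at h1
  exact h1

variable (R) {M : Type*} [AddCommGroup M] [Module R M] [Module Rᵐᵒᵖ M] [SMulCommClass R Rᵐᵒᵖ M]
    [Module (LC k) M] [IsScalarTower (LC k) R M] [IsScalarTower (LC k) Rᵐᵒᵖ M]
    [DistribMulAction Emb M]

theorem CovariantBimodule.idem_smul [EmbBundle k R] [CovariantBimodule k R M] (A : Set ℕ) (m : M) :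
    Emb.idem A • m = LC.ind k A • m := by
  have h1 : ∀ (A : Set ℕ) (m : M), LC.ind k A • (Emb.idem A • m) = Emb.idem A • m := by
    intro A m
    have h := CovariantBimodule.covariant (k := k) (Emb.idem A) (1 : R) 1 m
    rw [EmbBundle.idem_smul (k := k), op_smul_one_smul k R, smul_assoc, one_smul, one_smul,
      MulOpposite.op_one, one_smul, ← mul_smul, LC.ind_mul_ind, Set.inter_self] at h
    exact h.symm
  obtain ⟨ρ, hρ⟩ := CovariantBimodule.exists_gam (k := k) (R := R) (M := M)
  have h2 : m = Emb.idem A • m + Emb.idem Aᶜ • m := by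
    have h3 := congrArg (fun φ : AddMonoid.End M => φ m)
      (congrArg ρ (Gam.U_idem_union (disjoint_compl_right (a := A))))
    simp only [map_add] at h3
    change _ = ρ _ m + ρ _ m at h3
    rw [hρ, hρ, hρ, Set.union_compl_self, Emb.idem_univ, one_smul] at h3
    exact h3
  have h4 : LC.ind k A • (Emb.idem Aᶜ • m) = 0 := by
    rw [← h1 Aᶜ m, ← mul_smul, LC.ind_mul_ind, Set.inter_compl_self]
    have : LC.ind k ∅ = 0 := LC.ext' fun n => by simp
    rw [this, zero_smul]
  conv_rhs => rw [h2]
  rw [smul_add, h1, h4, add_zero]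

theorem CovariantBimodule.emb_smul [EmbBundle k R] [CovariantBimodule k R M] (f : Emb) (r : R)
    (m : M) : f • (r • m) = (f • r) • (f • m) := by
  have h := CovariantBimodule.covariant (k := k) f r 1 m
  rw [MulOpposite.op_one, one_smul, EmbBundle.emb_one k, op_smul_one_smul k R,
    ← CovariantBimodule.idem_smul k R, ← mul_smul (Emb.idem _), Emb.idem_image_mul] at h
  exact h

theorem CovariantBimodule.emb_op_smul [EmbBundle k R] [CovariantBimodule k R M] (f : Emb) (r : R)
    (m : M) : f • (MulOpposite.op r • m) = MulOpposite.op (f • r) • (f • m) := by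
  have h := CovariantBimodule.covariant (k := k) f 1 r m
  rw [one_smul, EmbBundle.emb_one k, smul_assoc, one_smul,
    ← smul_comm (MulOpposite.op (f • r)), ← CovariantBimodule.idem_smul k R, ← mul_smul (Emb.idem _),
    Emb.idem_image_mul] at h
  exact h

theorem CovariantBimodule.embModule [EmbBundle k R] [CovariantBimodule k R M] : EmbModule k M where
  smul_smul f p m := by
    have h : p • m = (p • (1 : R)) • m := by rw [smul_assoc, one_smul]
    rw [h, CovariantBimodule.emb_smul k R, (EmbBundle.embModule k).smul_smul, EmbBundle.emb_one k,
      smul_assoc (f • p), smul_assoc (LC.ind k _), one_smul, ← CovariantBimodule.idem_smul k R,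
      ← mul_smul (Emb.idem _), Emb.idem_image_mul]
  idem_smul := CovariantBimodule.idem_smul k R

end EmbModule

/-- A `𝒫(k)`-module, regarded as a `𝒫`-module. -/
def ResLC (k X : Type*) [CommRing k] [AddCommGroup X] [Module (LC k) X] : Type _ := X

instance (k X : Type*) [CommRing k] [AddCommGroup X] [Module (LC k) X] :
    AddCommGroup (ResLC k X) := inferInstanceAs (AddCommGroup X)

noncomputable instance (k X : Type*) [CommRing k] [AddCommGroup X] [Module (LC k) X] :
    Module (LC ℤ) (ResLC k X) := Module.compHom X (LC.ofInt k)

/-- `Γ` as a `𝒫`-module by left multiplication. -/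
noncomputable instance : Module (LC ℤ) Gam := Module.compHom Gam Gam.diag

theorem Gam.LC_smul_def (p : LC ℤ) (A : Gam) : p • A = Gam.diag p * A := rfl

/-- The abelian group `X #_𝒫 Γ = X ⊗_𝒫 Γ`. -/
def Cross (k X : Type*) [CommRing k] [AddCommGroup X] [Module (LC k) X] : Type _ :=
  TensorProduct (LC ℤ) (ResLC k X) Gam

namespace Cross

section basic

variable (k : Type*) {X Y Z : Type*} [CommRing k] [AddCommGroup X] [Module (LC k) X]
  [AddCommGroup Y] [Module (LC k) Y] [AddCommGroup Z] [Module (LC k) Z]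

noncomputable instance : AddCommGroup (Cross k X) :=
  inferInstanceAs (AddCommGroup (TensorProduct (LC ℤ) (ResLC k X) Gam))

/-- The element `x # A`. -/
noncomputable def tmul (x : X) (A : Gam) : Cross k X :=
  TensorProduct.tmul (LC ℤ) (show ResLC k X from x) A

/-- The map `(x, A) ↦ x # A`. -/
noncomputable def tmulHom : X →+ Gam →+ Cross k X where
  toFun x :=
    { toFun := tmul k x
      map_zero' := TensorProduct.tmul_zero _ _
      map_add' := TensorProduct.tmul_add _ }
  map_zero' := AddMonoidHom.ext fun A => TensorProduct.zero_tmul _ A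
  map_add' _ _ := AddMonoidHom.ext fun A => TensorProduct.add_tmul _ _ A

variable {k}

theorem tmulHom_apply (x : X) (A : Gam) : tmulHom k x A = tmul k x A := rfl

theorem smul_tmul (p : LC ℤ) (x : X) (A : Gam) :
    tmul k (LC.ofInt k p • x) A = tmul k x (Gam.diag p * A) :=
  TensorProduct.smul_tmul (R := LC ℤ) p (show ResLC k X from x) A

theorem add_tmul (x y : X) (A : Gam) : tmul k (x + y) A = tmul k x A + tmul k y A :=
  TensorProduct.add_tmul _ _ A

theorem tmul_add (x : X) (A B : Gam) : tmul k x (A + B) = tmul k x A + tmul k x B :=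
  TensorProduct.tmul_add _ _ _

theorem zero_tmul (A : Gam) : tmul k (0 : X) A = 0 := TensorProduct.zero_tmul _ A

theorem tmul_zero (x : X) : tmul k x 0 = 0 := TensorProduct.tmul_zero _ _

theorem tmul_neg (x : X) (A : Gam) : tmul k x (-A) = -tmul k x A :=
  (tmulHom k x).map_neg A

theorem neg_tmul (x : X) (A : Gam) : tmul k (-x) A = -tmul k x A := by
  rw [← tmulHom_apply, map_neg]
  rfl

theorem ind_smul_tmul (A : Set ℕ) (x : X) (B : Gam) :
    tmul k (LC.ind k A • x) B = tmul k x (Gam.U (Emb.idem A) * B) := by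
  rw [← LC.ofInt_ind, smul_tmul, Gam.diag_ind]

/-- `X #_𝒫 Γ` is spanned by the elements `x # U f`. -/
theorem induction_on {p : Cross k X → Prop} (w : Cross k X) (h : ∀ x f, p (tmul k x (Gam.U f)))
    (hz : p 0) (ha : ∀ v w, p v → p w → p (v + w)) : p w := by
  have key : ∀ (A : Gam) (x : X), p (tmul k x A) := by
    intro A
    induction A using Gam.induction_on with
    | hU f => exact fun x => h x f
    | hz => intro x; rw [tmul_zero]; exact hz
    | ha A B hA hB => intro x; rw [tmul_add]; exact ha _ _ (hA x) (hB x)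
    | hn A hA => intro x; rw [tmul_neg, ← neg_tmul]; exact hA (-x)
  induction w using TensorProduct.induction_on with
  | zero => exact hz
  | tmul x A => exact key A x
  | add v w hv hw => exact ha v w hv hw

/-- The homomorphism out of `X #_𝒫 Γ` determined by a `𝒫`-balanced biadditive map. -/
noncomputable def liftHom {G : Type*} [AddCommGroup G] (φ : X →+ Gam →+ G)
    (h : ∀ (p : LC ℤ) (x : X) (A : Gam), φ (LC.ofInt k p • x) A = φ x (Gam.diag p * A)) :
    Cross k X →+ G :=
  TensorProduct.liftAddHom (M := ResLC k X) (N := Gam) φ h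

theorem liftHom_tmul {G : Type*} [AddCommGroup G] (φ : X →+ Gam →+ G)
    (h : ∀ (p : LC ℤ) (x : X) (A : Gam), φ (LC.ofInt k p • x) A = φ x (Gam.diag p * A))
    (x : X) (A : Gam) : liftHom φ h (tmul k x A) = φ x A := rfl

variable [DistribMulAction Emb X] [DistribMulAction Emb Y] [DistribMulAction Emb Z]

/-- The action of `f` on `X #_𝒫 Γ`: `x # A ↦ f_* x # U f A`. -/
noncomputable def embAct (hX : EmbModule k X) (f : Emb) : Cross k X →+ Cross k X :=
  liftHom
    (AddMonoidHom.mk' (fun x => (tmulHom k (f • x)).comp (AddMonoidHom.mulLeft (Gam.U f)))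
      fun x y => AddMonoidHom.ext fun A => by
        change tmul k (f • (x + y)) _ = tmul k (f • x) _ + tmul k (f • y) _
        rw [smul_add, add_tmul])
    fun p x A => by
      change tmul k (f • (LC.ofInt k p • x)) (Gam.U f * A) =
        tmul k (f • x) (Gam.U f * (Gam.diag p * A))
      rw [hX.smul_smul, LC.emb_smul_ofInt, smul_tmul, ← mul_assoc, ← mul_assoc, Gam.U_mul_diag]

theorem embAct_tmul (hX : EmbModule k X) (f : Emb) (x : X) (A : Gam) :
    embAct hX f (tmul k x A) = tmul k (f • x) (Gam.U f * A) := rfl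

noncomputable def embActHom (hX : EmbModule k X) : Emb →* AddMonoid.End (Cross k X) where
  toFun := embAct hX
  map_one' := by
    apply AddMonoidHom.ext
    intro w
    change embAct hX 1 w = w
    induction w using induction_on with
    | h x f => rw [embAct_tmul, one_smul, map_one, one_mul]
    | hz => rw [map_zero]
    | ha v w hv hw => rw [map_add, hv, hw]
  map_mul' f g := by
    apply AddMonoidHom.ext
    intro w
    change embAct hX (f * g) w = embAct hX f (embAct hX g w)
    induction w using induction_on with
    | h x f => rw [embAct_tmul, embAct_tmul, embAct_tmul, mul_smul, map_mul, mul_assoc]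
    | hz => rw [map_zero, map_zero, map_zero]
    | ha v w hv hw => rw [map_add, map_add, map_add, hv, hw]

theorem embAct_idem (hX : EmbModule k X) (A : Set ℕ) (x : X) (B : Gam) :
    embAct hX (Emb.idem A) (tmul k x B) = tmul k (LC.ind k A • x) B := by
  rw [embAct_tmul, hX.idem_smul, ind_smul_tmul, ← mul_assoc, ← map_mul, Emb.idem_mul_idem,
    Set.inter_self, ind_smul_tmul]

theorem tight_embActHom (hX : EmbModule k X) : Gam.Tight (embActHom hX) := by
  intro A B hAB
  apply AddMonoidHom.ext
  intro w
  change embAct hX (Emb.idem (A ∪ B)) w = embAct hX (Emb.idem A) w + embAct hX (Emb.idem B) w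
  induction w using induction_on with
  | h x f => rw [embAct_idem, embAct_idem, embAct_idem, LC.ind_union hAB, add_smul, add_tmul]
  | hz => rw [map_zero, map_zero, map_zero, add_zero]
  | ha v w hv hw => rw [map_add, map_add, map_add, hv, hw]; abel

/-- The action of `Γ` on `X #_𝒫 Γ`. -/
noncomputable def gamAct (hX : EmbModule k X) (A : Gam) : Cross k X →+ Cross k X :=
  Gam.lift (embActHom hX) (tight_embActHom hX) A

theorem gamAct_U (hX : EmbModule k X) (f : Emb) (x : X) (A : Gam) :
    gamAct hX (Gam.U f) (tmul k x A) = tmul k (f • x) (Gam.U f * A) := by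
  unfold gamAct
  rw [Gam.lift_U]
  rfl

theorem gamAct_add (hX : EmbModule k X) (A B : Gam) (w : Cross k X) :
    gamAct hX (A + B) w = gamAct hX A w + gamAct hX B w := by
  unfold gamAct
  rw [map_add]
  rfl

theorem gamAct_mul (hX : EmbModule k X) (A B : Gam) (w : Cross k X) :
    gamAct hX (A * B) w = gamAct hX A (gamAct hX B w) := by
  unfold gamAct
  rw [map_mul]
  rfl

theorem gamAct_zsmul (hX : EmbModule k X) (c : ℤ) (A : Gam) (w : Cross k X) :
    gamAct hX (c • A) w = c • gamAct hX A w := by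
  unfold gamAct
  rw [map_zsmul]
  rfl

theorem gamAct_zero (hX : EmbModule k X) (w : Cross k X) : gamAct hX 0 w = 0 := by
  unfold gamAct
  rw [map_zero]
  rfl

theorem gamAct_diag (hX : EmbModule k X) (p : LC ℤ) (x : X) (A : Gam) :
    gamAct hX (Gam.diag p) (tmul k x A) = tmul k (LC.ofInt k p • x) A := by
  induction p using LC.induction_on with
  | hz => rw [map_zero, map_zero, zero_smul, gamAct_zero, zero_tmul]
  | hi c B =>
    have h1 : ∀ (c : ℤ) (x : X), tmul k (c • x) A = c • tmul k x A := fun c x =>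
      congrArg (fun φ : Gam →+ Cross k X => φ A) (map_zsmul (tmulHom k) c x)
    rw [LC.smul_eq, eq_intCast, map_mul, map_intCast, map_mul, map_intCast, Gam.diag_ind, mul_smul,
      Int.cast_smul_eq_zsmul, h1, LC.ofInt_ind, ← zsmul_eq_mul, gamAct_zsmul, gamAct_U,
      hX.idem_smul, ind_smul_tmul, ← mul_assoc, ← map_mul, Emb.idem_mul_idem, Set.inter_self,
      ← ind_smul_tmul]
  | ha α β hα hβ =>
    rw [map_add, map_add, add_smul, add_tmul, ← hα, ← hβ, gamAct_add]

/-- A biadditive map that is `𝒫(k)`-bilinear and compatible with the actions of `Emb`. -/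
structure Pairing (β : X →+ Y →+ Z) : Prop where
  smul_left : ∀ (p : LC k) (x : X) (y : Y), β (p • x) y = p • β x y
  smul_right : ∀ (p : LC k) (x : X) (y : Y), β x (p • y) = p • β x y
  emb : ∀ (f : Emb) (x : X) (y : Y), f • β x y = β (f • x) (f • y)

/-- The map `y # A ↦ β(x, y) # A`. -/
noncomputable def coefMul {β : X →+ Y →+ Z} (hβ : Pairing (k := k) β) (x : X) :
    Cross k Y →+ Cross k Z :=
  liftHom ((tmulHom k).comp (β x)) fun p y A => by
    change tmul k (β x (LC.ofInt k p • y)) A = tmul k (β x y) (Gam.diag p * A)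
    rw [hβ.smul_right, smul_tmul]

theorem coefMul_tmul {β : X →+ Y →+ Z} (hβ : Pairing (k := k) β) (x : X) (y : Y) (A : Gam) :
    coefMul hβ x (tmul k y A) = tmul k (β x y) A := rfl

/-- The product `(x # U f) (y # B) = β(x, f_* y) # U f B` of crossed products. -/
noncomputable def cmul (hY : EmbModule k Y) {β : X →+ Y →+ Z} (hβ : Pairing (k := k) β) :
    Cross k X →+ Cross k Y →+ Cross k Z :=
  liftHom
    (AddMonoidHom.mk' (fun x => AddMonoidHom.mk' (fun A => (coefMul hβ x).comp (gamAct hY A))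
        fun A B => by
          apply AddMonoidHom.ext
          intro w
          change coefMul hβ x (gamAct hY (A + B) w) =
            coefMul hβ x (gamAct hY A w) + coefMul hβ x (gamAct hY B w)
          rw [gamAct_add, map_add])
      fun x x' => by
        apply AddMonoidHom.ext
        intro A
        apply AddMonoidHom.ext
        intro w
        change coefMul hβ (x + x') (gamAct hY A w) =
          coefMul hβ x (gamAct hY A w) + coefMul hβ x' (gamAct hY A w)
        induction (gamAct hY A w) using induction_on with
        | h y f => rw [coefMul_tmul, coefMul_tmul, coefMul_tmul, map_add, ← add_tmul]; rfl
        | hz => rw [map_zero, map_zero, map_zero, add_zero]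
        | ha v w hv hw => rw [map_add, map_add, map_add, hv, hw]; abel)
    fun p x A => by
      apply AddMonoidHom.ext
      intro w
      change coefMul hβ (LC.ofInt k p • x) (gamAct hY A w) =
        coefMul hβ x (gamAct hY (Gam.diag p * A) w)
      rw [gamAct_mul]
      induction (gamAct hY A w) using induction_on with
      | h y f => rw [coefMul_tmul, gamAct_diag, coefMul_tmul, hβ.smul_left, hβ.smul_right]
      | hz => rw [map_zero, map_zero, map_zero]
      | ha v w hv hw => rw [map_add, map_add, map_add, hv, hw]

theorem cmul_tmul (hY : EmbModule k Y) {β : X →+ Y →+ Z} (hβ : Pairing (k := k) β) (x : X)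
    (f : Emb) (y : Y) (B : Gam) :
    cmul hY hβ (tmul k x (Gam.U f)) (tmul k y B) = tmul k (β x (f • y)) (Gam.U f * B) := by
  change coefMul hβ x (gamAct hY (Gam.U f) (tmul k y B)) = _
  rw [gamAct_U, coefMul_tmul]

theorem cmul_assoc {V W T : Type*} [AddCommGroup V] [Module (LC k) V] [DistribMulAction Emb V]
    [AddCommGroup W] [Module (LC k) W] [DistribMulAction Emb W]
    [AddCommGroup T] [Module (LC k) T] [DistribMulAction Emb T]
    (hY : EmbModule k Y) (hW : EmbModule k W) (hT : EmbModule k T)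
    {β₁ : X →+ Y →+ Z} (h₁ : Pairing (k := k) β₁) {β₂ : Z →+ W →+ V} (h₂ : Pairing (k := k) β₂)
    {β₃ : Y →+ W →+ T} (h₃ : Pairing (k := k) β₃) {β₄ : X →+ T →+ V} (h₄ : Pairing (k := k) β₄)
    (h : ∀ x y w, β₂ (β₁ x y) w = β₄ x (β₃ y w)) (a : Cross k X) (b : Cross k Y) (c : Cross k W) :
    cmul hW h₂ (cmul hY h₁ a b) c = cmul hT h₄ a (cmul hW h₃ b c) := by
  induction a using induction_on with
  | hz => simp only [map_zero, AddMonoidHom.zero_apply]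
  | ha v w hv hw => simp only [map_add, AddMonoidHom.add_apply, hv, hw]
  | h x f =>
    induction b using induction_on with
    | hz => simp only [map_zero, AddMonoidHom.zero_apply]
    | ha v w hv hw => simp only [map_add, AddMonoidHom.add_apply, hv, hw]
    | h y g =>
      induction c using induction_on with
      | hz => simp only [map_zero]
      | ha v w hv hw => simp only [map_add, hv, hw]
      | h w l =>
        rw [cmul_tmul, ← map_mul, cmul_tmul, cmul_tmul, cmul_tmul, h, h₃.emb, mul_smul, map_mul,
          mul_assoc]

end basic

section ring

variable {k R : Type*} [CommRing k] [Ring R] [Algebra (LC k) R] [DistribMulAction Emb R]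
  [EmbBundle k R]

theorem pairing_mul : Pairing (k := k) (AddMonoidHom.mul : R →+ R →+ R) where
  smul_left p x y := smul_mul_assoc p x y
  smul_right p x y := mul_smul_comm p x y
  emb f x y := EmbBundle.emb_mul k f x y

/-- The ring structure of `R #_𝒫 Γ`. -/
noncomputable instance : Ring (Cross k R) :=
  { (inferInstance : AddCommGroup (Cross k R)) with
    mul := fun a b => cmul (EmbBundle.embModule k) pairing_mul a b
    one := tmul k 1 1
    mul_assoc := fun a b c => cmul_assoc (EmbBundle.embModule k) (EmbBundle.embModule k)
      (EmbBundle.embModule k) pairing_mul pairing_mul pairing_mul pairing_mul mul_assoc a b c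
    left_distrib := fun a b c => map_add (cmul (EmbBundle.embModule k) pairing_mul a) b c
    right_distrib := fun a b c => by
      change cmul (EmbBundle.embModule k) pairing_mul (a + b) c = _
      rw [map_add]
      rfl
    zero_mul := fun a => by
      change cmul (EmbBundle.embModule k) pairing_mul 0 a = 0
      rw [map_zero]
      rfl
    mul_zero := fun a => map_zero (cmul (EmbBundle.embModule k) pairing_mul a)
    one_mul := fun a => by
      change cmul (EmbBundle.embModule k) pairing_mul (tmul k 1 1) a = a
      rw [← map_one Gam.U]
      induction a using induction_on with
      | h x f => rw [cmul_tmul, map_one Gam.U, one_mul, one_smul, AddMonoidHom.mul_apply, one_mul]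
      | hz => rw [map_zero]
      | ha v w hv hw => rw [map_add, hv, hw]
    mul_one := fun a => by
      change cmul (EmbBundle.embModule k) pairing_mul a (tmul k 1 1) = a
      induction a using induction_on with
      | h x f =>
        rw [cmul_tmul, mul_one, AddMonoidHom.mul_apply, EmbBundle.emb_one k, mul_smul_comm, mul_one,
          ind_smul_tmul, ← map_mul, Emb.idem_image_mul]
      | hz => rw [map_zero]; rfl
      | ha v w hv hw =>
        rw [map_add, AddMonoidHom.add_apply, hv, hw] }

theorem mul_def (a b : Cross k R) : a * b = cmul (EmbBundle.embModule k) pairing_mul a b := rfl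

theorem one_def : (1 : Cross k R) = tmul k 1 1 := rfl

theorem tmul_mul_tmul (a b : R) (f g : Emb) :
    tmul k a (Gam.U f) * tmul k b (Gam.U g) = tmul k (a * (f • b)) (Gam.U (f * g)) := by
  rw [mul_def, cmul_tmul, map_mul]
  rfl

/-- The homomorphism `𝒫(k) → R #_𝒫 Γ`, `p ↦ p # 1`. -/
noncomputable def unit (k R : Type*) [CommRing k] [Ring R] [Algebra (LC k) R]
    [DistribMulAction Emb R] [EmbBundle k R] : LC k →+* Cross k R where
  toFun p := tmul k (algebraMap (LC k) R p) 1
  map_one' := by rw [map_one]; rfl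
  map_mul' p q := by
    rw [mul_def, ← map_one Gam.U, cmul_tmul, one_smul, map_mul, map_one, one_mul]
    rfl
  map_zero' := by
    rw [map_zero, ← tmulHom_apply, map_zero]
    rfl
  map_add' p q := by rw [map_add, add_tmul]

end ring

/-- The left action of `R` on `M`. -/
def leftHom (R M : Type*) [Ring R] [AddCommGroup M] [Module R M] : R →+ M →+ M :=
  AddMonoidHom.mk' (fun r => AddMonoidHom.mk' (fun m => r • m) (smul_add r)) fun r s =>
    AddMonoidHom.ext fun m => add_smul r s m

/-- The right action of `R` on `M`. -/
def rightHom (R M : Type*) [Ring R] [AddCommGroup M] [Module Rᵐᵒᵖ M] : M →+ R →+ M :=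
  AddMonoidHom.mk' (fun m => AddMonoidHom.mk' (fun r => MulOpposite.op r • m) fun r s => by
    rw [MulOpposite.op_add, add_smul]) fun m m' => AddMonoidHom.ext fun r => smul_add _ m m'

theorem leftHom_apply {R M : Type*} [Ring R] [AddCommGroup M] [Module R M] (r : R) (m : M) :
    leftHom R M r m = r • m := rfl

theorem rightHom_apply {R M : Type*} [Ring R] [AddCommGroup M] [Module Rᵐᵒᵖ M] (r : R) (m : M) :
    rightHom R M m r = MulOpposite.op r • m := rfl

section bimodule

variable {k R M : Type*} [CommRing k] [Ring R] [Algebra (LC k) R] [DistribMulAction Emb R]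
  [EmbBundle k R] [AddCommGroup M] [Module R M] [Module Rᵐᵒᵖ M] [SMulCommClass R Rᵐᵒᵖ M]
  [Module (LC k) M] [IsScalarTower (LC k) R M] [IsScalarTower (LC k) Rᵐᵒᵖ M]
  [DistribMulAction Emb M] [CovariantBimodule k R M]

variable (k R M) in
theorem pairing_left : Pairing (k := k) (leftHom R M) where
  smul_left p r m := smul_assoc p r m
  smul_right p r m := by
    rw [leftHom_apply, leftHom_apply, ← op_smul_one_smul k R p m, smul_comm, op_smul_one_smul]
  emb f r m := CovariantBimodule.emb_smul k R f r m

variable (k R M) in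
theorem pairing_right : Pairing (k := k) (rightHom R M) where
  smul_left p m r := by
    rw [rightHom_apply, rightHom_apply]
    have h : ∀ m : M, p • m = (p • (1 : R)) • m := fun m => by rw [smul_assoc, one_smul]
    rw [h, h, ← smul_comm]
  smul_right p m r := by
    rw [rightHom_apply, rightHom_apply, MulOpposite.op_smul, smul_assoc]
  emb f m r := CovariantBimodule.emb_op_smul k R f r m

/-- The left `R #_𝒫 Γ`-module `M #_𝒫 Γ`. -/
noncomputable instance : Module (Cross k R) (Cross k M) where
  smul a w := cmul (CovariantBimodule.embModule k R) (pairing_left k R M) a w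
  one_smul w := by
    change cmul (CovariantBimodule.embModule k R) (pairing_left k R M) (tmul k 1 1) w = w
    rw [← map_one Gam.U]
    induction w using induction_on with
    | h x f => rw [cmul_tmul, map_one Gam.U, one_mul, one_smul, leftHom_apply, one_smul]
    | hz => rw [map_zero]
    | ha v w hv hw => rw [map_add, hv, hw]
  mul_smul a b w := cmul_assoc (EmbBundle.embModule k) (CovariantBimodule.embModule k R)
    (CovariantBimodule.embModule k R) pairing_mul (pairing_left k R M) (pairing_left k R M)
    (pairing_left k R M) (fun x y w => mul_smul x y w) a b w
  smul_zero a := map_zero (cmul (CovariantBimodule.embModule k R) (pairing_left k R M) a)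
  smul_add a := map_add (cmul (CovariantBimodule.embModule k R) (pairing_left k R M) a)
  add_smul a b w := by
    change cmul (CovariantBimodule.embModule k R) (pairing_left k R M) (a + b) w = _
    rw [map_add]
    rfl
  zero_smul w := by
    change cmul (CovariantBimodule.embModule k R) (pairing_left k R M) 0 w = _
    rw [map_zero]
    rfl

theorem smul_def (a : Cross k R) (w : Cross k M) :
    a • w = cmul (CovariantBimodule.embModule k R) (pairing_left k R M) a w := rfl

theorem tmul_smul_tmul (a : R) (m : M) (f g : Emb) :
    tmul k a (Gam.U f) • tmul k m (Gam.U g) = tmul k (a • (f • m)) (Gam.U (f * g)) := by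
  rw [smul_def, cmul_tmul, map_mul]
  rfl

/-- The right `R #_𝒫 Γ`-module `M #_𝒫 Γ`. -/
noncomputable instance : Module (Cross k R)ᵐᵒᵖ (Cross k M) where
  smul a w := cmul (EmbBundle.embModule k) (pairing_right k R M) w a.unop
  one_smul w := by
    change cmul (EmbBundle.embModule k) (pairing_right k R M) w (tmul k 1 1) = w
    induction w using induction_on with
    | h x f =>
      rw [cmul_tmul, mul_one, rightHom_apply, EmbBundle.emb_one k, op_smul_one_smul, ind_smul_tmul,
        ← map_mul, Emb.idem_image_mul]
    | hz => rw [map_zero]; rfl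
    | ha v w hv hw => rw [map_add, AddMonoidHom.add_apply, hv, hw]
  mul_smul a b w := (cmul_assoc (EmbBundle.embModule k) (EmbBundle.embModule k)
    (EmbBundle.embModule k) (pairing_right k R M) (pairing_right k R M) pairing_mul
    (pairing_right k R M) (fun x y z => by
      rw [rightHom_apply, rightHom_apply, rightHom_apply, AddMonoidHom.mul_apply,
        MulOpposite.op_mul, mul_smul]) w b.unop a.unop).symm
  smul_zero a := by
    change cmul (EmbBundle.embModule k) (pairing_right k R M) 0 a.unop = _
    rw [map_zero]
    rfl
  smul_add a v w := by
    change cmul (EmbBundle.embModule k) (pairing_right k R M) (v + w) a.unop = _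
    rw [map_add]
    rfl
  add_smul a b w := map_add (cmul (EmbBundle.embModule k) (pairing_right k R M) w) a.unop b.unop
  zero_smul w := map_zero (cmul (EmbBundle.embModule k) (pairing_right k R M) w)

theorem op_smul_def (a : Cross k R) (w : Cross k M) :
    MulOpposite.op a • w = cmul (EmbBundle.embModule k) (pairing_right k R M) w a := rfl

theorem op_tmul_smul_tmul (a : R) (m : M) (f g : Emb) :
    MulOpposite.op (tmul k a (Gam.U f)) • tmul k m (Gam.U g) =
      tmul k (MulOpposite.op (g • a) • m) (Gam.U (g * f)) := by
  rw [op_smul_def, cmul_tmul, map_mul]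
  rfl

instance : SMulCommClass (Cross k R) (Cross k R)ᵐᵒᵖ (Cross k M) where
  smul_comm a b w := (cmul_assoc (CovariantBimodule.embModule k R) (EmbBundle.embModule k)
    (CovariantBimodule.embModule k R) (pairing_left k R M) (pairing_right k R M)
    (pairing_right k R M) (pairing_left k R M) (fun x y z => by
      rw [rightHom_apply, rightHom_apply, leftHom_apply, leftHom_apply, ← smul_comm]) a w b.unop).symm

end bimodule

end Cross

/-- The product `b_{s+1} ⋯ b_t` of the factors of `b = (b_1, …, b_n)` (that is, of the entries of `b`
with indices in `[s, t)`). -/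
def seg {B : Type*} [Monoid B] {n : ℕ} (b : Fin n → B) (s t : ℕ) : B :=
  ((List.range' s (t - s)).map fun l => if h : l < n then b ⟨l, h⟩ else 1).prod

section seg

variable {B : Type*} [Monoid B] {n : ℕ} (b : Fin n → B)

theorem seg_self (s : ℕ) : seg b s s = 1 := by simp [seg]

theorem seg_mul_seg {s t u : ℕ} (h : s ≤ t) (h' : t ≤ u) : seg b s t * seg b t u = seg b s u := by
  unfold seg
  rw [← List.prod_append, ← List.map_append]
  congr 2
  obtain ⟨x, rfl⟩ := Nat.exists_eq_add_of_le h
  obtain ⟨y, rfl⟩ := Nat.exists_eq_add_of_le h'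
  have e1 : s + x - s = x := by omega
  have e2 : s + x + y - (s + x) = y := by omega
  have e3 : s + x + y - s = x + y := by omega
  rw [e1, e2, e3, List.range'_append_1]

theorem seg_succ (j : Fin n) : seg b j (j + 1) = b j := by
  simp [seg]

theorem seg_congr {b b' : Fin n → B} {s t : ℕ} (h : ∀ j : Fin n, s ≤ j → (j : ℕ) < t → b j = b' j) :
    seg b s t = seg b' s t := by
  unfold seg
  congr 1
  apply List.map_congr_left
  intro l hl
  rw [List.mem_range'_1] at hl
  split_ifs with hn
  · exact h _ hl.1 (by dsimp; omega)
  · rfl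

theorem seg_split (j : Fin n) {s t : ℕ} (h : s ≤ j) (h' : (j : ℕ) < t) :
    seg b s t = seg b s j * b j * seg b (j + 1) t := by
  rw [← seg_succ b j, seg_mul_seg b h (Nat.le_succ _), seg_mul_seg b (by omega) h']

theorem seg_update_of_not (j : Fin n) (v : B) {s t : ℕ} (h : ¬(s ≤ j ∧ (j : ℕ) < t)) :
    seg (Function.update b j v) s t = seg b s t := by
  apply seg_congr
  intro i hi hi'
  rw [Function.update_of_ne]
  rintro rfl
  exact h ⟨hi, hi'⟩

theorem seg_update (j : Fin n) (v : B) {s t : ℕ} (h : s ≤ j) (h' : (j : ℕ) < t) :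
    seg (Function.update b j v) s t = seg b s j * v * seg b (j + 1) t := by
  rw [seg_split _ j h h', Function.update_self, seg_update_of_not _ _ _ (by omega),
    seg_update_of_not _ _ _ (by omega)]

/-- The tuple of the products of `b` over the intervals cut out by a monotone map. -/
def pull {p q : ℕ} (θ : Fin (p + 1) →o Fin (q + 1)) (b : Fin q → B) : Fin p → B := fun l =>
  seg b (θ l.castSucc) (θ l.succ)

theorem seg_pull {p q : ℕ} (θ : Fin (p + 1) →o Fin (q + 1)) (b : Fin q → B) (i j : Fin (p + 1))
    (h : i ≤ j) : seg (pull θ b) i j = seg b (θ i) (θ j) := by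
  induction j using Fin.induction with
  | zero =>
    obtain rfl : i = 0 := le_antisymm h (Fin.zero_le _)
    rw [seg_self, seg_self]
  | succ j ih =>
    rcases h.eq_or_lt with rfl | h
    · rw [seg_self, seg_self]
    · have h1 : i ≤ j.castSucc := by
        rw [Fin.le_def]
        rw [Fin.lt_def] at h
        simp at h ⊢
        omega
      have h2 := ih h1
      rw [Fin.val_succ, ← seg_mul_seg _ (Fin.le_def.1 h1) (by simp), h2, Fin.val_castSucc, seg_succ]
      exact seg_mul_seg _ (Fin.le_def.1 (θ.monotone h1))
        (Fin.le_def.1 (θ.monotone (Fin.castSucc_lt_succ).le))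

end seg

/-- The elements `(x_0, …, x_n)` of `N × B × ⋯ × B`. -/
abbrev Tup (N B : Type*) (n : ℕ) : Type _ := N × (Fin n → B)

namespace Tup

variable {A B N : Type*} [Ring A] [Ring B] [AddCommGroup N] [Module Bᵐᵒᵖ N] {n : ℕ}

/-- Multiplication of the factor `x_i` by `c` on the right, `0 ≤ i ≤ n`. -/
def rmul (i : Fin (n + 1)) (c : B) (x : Tup N B n) : Tup N B n :=
  Fin.cases (MulOpposite.op c • x.1, x.2)
    (fun j => (x.1, Function.update x.2 j (x.2 j * c))) i

/-- Multiplication of the factor `x_{j+1}` by `c` on the left, `0 ≤ j < n`. -/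
def lmul (j : Fin n) (c : B) (x : Tup N B n) : Tup N B n :=
  (x.1, Function.update x.2 j (c * x.2 j))

/-- Multiplication of the factor `x_0` by `c` on the left. -/
def lmulZero [Module B N] (c : B) (x : Tup N B n) : Tup N B n := (c • x.1, x.2)

theorem rmul_zero (c : B) (x : Tup N B n) : rmul 0 c x = (MulOpposite.op c • x.1, x.2) := rfl

theorem rmul_succ (j : Fin n) (c : B) (x : Tup N B n) :
    rmul j.succ c x = (x.1, Function.update x.2 j (x.2 j * c)) := rfl

theorem rmul_one (i : Fin (n + 1)) (x : Tup N B n) : rmul i 1 x = x := by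
  cases i using Fin.cases with
  | zero => rw [rmul_zero, MulOpposite.op_one, one_smul]
  | succ j => rw [rmul_succ, mul_one, Function.update_eq_self]

theorem rmul_rmul (i : Fin (n + 1)) (c d : B) (x : Tup N B n) :
    rmul i d (rmul i c x) = rmul i (c * d) x := by
  cases i using Fin.cases with
  | zero => rw [rmul_zero, rmul_zero, rmul_zero, MulOpposite.op_mul, mul_smul]
  | succ j => simp only [rmul_succ, Function.update_self, Function.update_idem, mul_assoc]

/-- The multiadditive `A`-balanced maps on tuples. -/
structure Balanced (ι : A →+* B) {G : Type*} [AddCommGroup G] (φ : Tup N B n → G) : Prop where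
  add_zero : ∀ (m m' : N) (b : Fin n → B), φ (m + m', b) = φ (m, b) + φ (m', b)
  add_succ : ∀ (m : N) (b : Fin n → B) (j : Fin n) (v w : B),
    φ (m, Function.update b j (v + w)) =
      φ (m, Function.update b j v) + φ (m, Function.update b j w)
  bal : ∀ (x : Tup N B n) (j : Fin n) (a : A), φ (rmul j.castSucc (ι a) x) = φ (lmul j (ι a) x)

/-- The relations of `N ⊗_A B ⊗_A ⋯ ⊗_A B` (`n` factors `B`): additivity in each factor, and
`x_j a ⊗ x_{j+1} = x_j ⊗ a x_{j+1}` for `0 ≤ j < n`. -/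
inductive TensorRel (ι : A →+* B) (n : ℕ) : FreeAbelianGroup (Tup N B n) → Prop
  | add_zero (m m' : N) (b : Fin n → B) : TensorRel ι n
      (FreeAbelianGroup.of (m + m', b) - (FreeAbelianGroup.of (m, b) + FreeAbelianGroup.of (m', b)))
  | add_succ (m : N) (b : Fin n → B) (j : Fin n) (v w : B) : TensorRel ι n
      (FreeAbelianGroup.of (m, Function.update b j (v + w)) -
        (FreeAbelianGroup.of (m, Function.update b j v) +
          FreeAbelianGroup.of (m, Function.update b j w)))
  | bal (x : Tup N B n) (j : Fin n) (a : A) : TensorRel ι n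
      (FreeAbelianGroup.of (rmul j.castSucc (ι a) x) - FreeAbelianGroup.of (lmul j (ι a) x))

theorem Balanced.rel {ι : A →+* B} {G : Type*} [AddCommGroup G] {φ : Tup N B n → G}
    (h : Balanced ι φ) {z : FreeAbelianGroup (Tup N B n)} (hz : TensorRel ι n z) :
    FreeAbelianGroup.lift φ z = 0 := by
  cases hz with
  | add_zero m m' b =>
    rw [map_sub, map_add, FreeAbelianGroup.lift_apply_of, FreeAbelianGroup.lift_apply_of,
      FreeAbelianGroup.lift_apply_of, h.add_zero, sub_self]
  | add_succ m b j v w =>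
    rw [map_sub, map_add, FreeAbelianGroup.lift_apply_of, FreeAbelianGroup.lift_apply_of,
      FreeAbelianGroup.lift_apply_of, h.add_succ, sub_self]
  | bal x j a =>
    rw [map_sub, FreeAbelianGroup.lift_apply_of, FreeAbelianGroup.lift_apply_of, h.bal, sub_self]

/-- `(x_0, …, x_q) ↦ (y_0, …, y_p)`, where `y_0 = x_0 ⋯ x_{θ(0)}` and
`y_l = x_{θ(l-1)+1} ⋯ x_{θ(l)}` for `l > 0`. -/
def plain {p q : ℕ} (θ : Fin (p + 1) →o Fin (q + 1)) (x : Tup N B q) : Tup N B p :=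
  (MulOpposite.op (seg x.2 0 (θ 0)) • x.1, pull θ x.2)

/-- The product `x_{θ(p)+1} ⋯ x_q`. -/
def tail {p q : ℕ} (θ : Fin (p + 1) →o Fin (q + 1)) (x : Tup N B q) : B :=
  seg x.2 (θ (Fin.last p)) q

section balanced

variable {ι : A →+* B} {G : Type*} [AddCommGroup G] {φ : Tup N B n → G}

theorem Balanced.rmul_add (h : Balanced ι φ) (i : Fin (n + 1)) (c d : B) (x : Tup N B n) :
    φ (rmul i (c + d) x) = φ (rmul i c x) + φ (rmul i d x) := by
  cases i using Fin.cases with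
  | zero => rw [rmul_zero, rmul_zero, rmul_zero, MulOpposite.op_add, add_smul, h.add_zero]
  | succ j => rw [rmul_succ, rmul_succ, rmul_succ, mul_add, h.add_succ]

theorem Balanced.comp_rmul_last (h : Balanced ι φ) (c : B) :
    Balanced ι fun x => φ (rmul (Fin.last n) c x) := by
  cases n with
  | zero =>
    refine ⟨fun m m' b => ?_, fun m b j => j.elim0, fun x j => j.elim0⟩
    change φ (rmul 0 c _) = φ (rmul 0 c _) + φ (rmul 0 c _)
    rw [rmul_zero, rmul_zero, rmul_zero, smul_add, h.add_zero]
  | succ n =>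
    have e : ∀ x : Tup N B (n + 1), rmul (Fin.last (n + 1)) c x =
        (x.1, Function.update x.2 (Fin.last n) (x.2 (Fin.last n) * c)) := fun x => by
      rw [← Fin.succ_last, rmul_succ]
    refine ⟨fun m m' b => ?_, fun m b j v w => ?_, fun x j a => ?_⟩
    · rw [e, e, e, h.add_zero]
    · rw [e, e, e]
      by_cases hj : j = Fin.last n
      · subst hj
        simp only [Function.update_self, Function.update_idem, add_mul, h.add_succ]
      · simp only [Function.update_of_ne (Ne.symm hj)]
        rw [Function.update_comm hj, Function.update_comm hj, Function.update_comm hj, h.add_succ]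
    · have e1 : rmul (Fin.last (n + 1)) c (rmul j.castSucc (ι a) x) =
          rmul j.castSucc (ι a) (rmul (Fin.last (n + 1)) c x) := by
        rw [e, e]
        cases j using Fin.cases with
        | zero => rw [Fin.castSucc_zero, rmul_zero, rmul_zero]
        | succ j =>
          have hj : j.castSucc ≠ Fin.last n := Fin.castSucc_ne_last j
          rw [← Fin.succ_castSucc, rmul_succ, rmul_succ]
          simp only [Function.update_of_ne hj, Function.update_of_ne hj.symm]
          rw [Function.update_comm hj]
      have e2 : rmul (Fin.last (n + 1)) c (lmul j (ι a) x) =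
          lmul j (ι a) (rmul (Fin.last (n + 1)) c x) := by
        rw [e, e]
        unfold lmul
        by_cases hj : j = Fin.last n
        · subst hj
          simp only [Function.update_self, Function.update_idem, mul_assoc]
        · simp only [Function.update_of_ne hj, Function.update_of_ne (Ne.symm hj)]
          rw [Function.update_comm hj]
      rw [e1, e2, h.bal]

theorem Balanced.comp_lmulZero [Module B N] [SMulCommClass B Bᵐᵒᵖ N] (h : Balanced ι φ) (c : B) :
    Balanced ι fun x => φ (lmulZero c x) := by
  refine ⟨fun m m' b => ?_, fun m b j v w => h.add_succ _ b j v w, fun x j a => ?_⟩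
  · change φ (c • (m + m'), b) = φ (c • m, b) + φ (c • m', b)
    rw [smul_add, h.add_zero]
  · have e1 : lmulZero c (rmul j.castSucc (ι a) x) = rmul j.castSucc (ι a) (lmulZero c x) := by
      cases hj : j.castSucc using Fin.cases with
      | zero => simp only [rmul_zero, lmulZero, smul_comm c]
      | succ j => simp only [rmul_succ, lmulZero]
    rw [e1, h.bal]
    rfl

variable {p q : ℕ} (θ : Fin (p + 1) →o Fin (q + 1)) {φ : Tup N B p → G}

theorem le_map_iff (l : Fin p) : (θ l.castSucc : ℕ) ≤ θ l.succ :=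
  Fin.le_def.1 (θ.monotone (Fin.castSucc_lt_succ).le)

theorem exists_block (j : ℕ) (h : (θ 0 : ℕ) ≤ j) (h' : j < θ (Fin.last p)) :
    ∃ l : Fin p, (θ l.castSucc : ℕ) ≤ j ∧ j < θ l.succ := by
  have key : ∀ l : Fin (p + 1), j < θ l → ∃ l : Fin p, (θ l.castSucc : ℕ) ≤ j ∧ j < θ l.succ := by
    intro l
    induction l using Fin.induction with
    | zero => intro hl; omega
    | succ l ih =>
      intro hl
      by_cases hj : (θ l.castSucc : ℕ) ≤ j
      · exact ⟨l, hj, hl⟩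
      · exact ih (by omega)
  exact key _ h'

theorem not_block {l l' : Fin p} (hl : l' ≠ l) {j : ℕ} (h : (θ l.castSucc : ℕ) ≤ j)
    (h' : j < θ l.succ) : ¬((θ l'.castSucc : ℕ) ≤ j ∧ j < θ l'.succ) := by
  rintro ⟨h1, h2⟩
  rcases lt_or_gt_of_ne hl with hlt | hlt
  · have : (θ l'.succ : ℕ) ≤ θ l.castSucc := Fin.le_def.1 (θ.monotone (by
      rw [Fin.le_def]; rw [Fin.lt_def] at hlt; simp; omega))
    omega
  · have : (θ l.succ : ℕ) ≤ θ l'.castSucc := Fin.le_def.1 (θ.monotone (by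
      rw [Fin.le_def]; rw [Fin.lt_def] at hlt; simp; omega))
    omega

theorem zero_le_map (l : Fin (p + 1)) : (θ 0 : ℕ) ≤ θ l := Fin.le_def.1 (θ.monotone (Fin.zero_le l))

theorem map_le_last (l : Fin (p + 1)) : (θ l : ℕ) ≤ θ (Fin.last p) :=
  Fin.le_def.1 (θ.monotone (Fin.le_last l))

/-- A factor in the first block. -/
theorem plain_update_first (m : N) (b : Fin q → B) (j : Fin q) (v : B) (h : (j : ℕ) < θ 0) :
    plain θ (m, Function.update b j v) =
      (MulOpposite.op (seg b 0 j * v * seg b (j + 1) (θ 0)) • m, pull θ b) := by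
  unfold plain
  rw [seg_update _ _ _ (Nat.zero_le _) h]
  congr 1
  funext l
  apply seg_update_of_not
  have := zero_le_map θ l.castSucc
  omega

/-- A factor in a later block. -/
theorem plain_update_block (m : N) (b : Fin q → B) (j : Fin q) (v : B) (l : Fin p)
    (h : (θ l.castSucc : ℕ) ≤ j) (h' : (j : ℕ) < θ l.succ) :
    plain θ (m, Function.update b j v) = (MulOpposite.op (seg b 0 (θ 0)) • m,
      Function.update (pull θ b) l (seg b (θ l.castSucc) j * v * seg b (j + 1) (θ l.succ))) := by
  unfold plain
  have := zero_le_map θ l.castSucc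
  rw [seg_update_of_not _ _ _ (by omega)]
  congr 1
  funext l'
  by_cases hl : l' = l
  · subst hl
    rw [Function.update_self]
    exact seg_update _ _ _ h h'
  · rw [Function.update_of_ne hl]
    exact seg_update_of_not _ _ _ (not_block θ hl h h')

/-- A factor in the tail. -/
theorem plain_update_tail (m : N) (b : Fin q → B) (j : Fin q) (v : B)
    (h : (θ (Fin.last p) : ℕ) ≤ j) : plain θ (m, Function.update b j v) = plain θ (m, b) := by
  unfold plain
  have := zero_le_map θ (Fin.last p)
  rw [seg_update_of_not _ _ _ (by omega)]
  congr 1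
  funext l
  have := map_le_last θ l.succ
  exact seg_update_of_not _ _ _ (by omega)

theorem Balanced.plain_add_zero (h : Balanced ι φ) (m m' : N) (b : Fin q → B) :
    φ (plain θ (m + m', b)) = φ (plain θ (m, b)) + φ (plain θ (m', b)) := by
  unfold plain
  rw [smul_add, h.add_zero]

theorem Balanced.plain_add_succ (h : Balanced ι φ) (m : N) (b : Fin q → B) (j : Fin q) (v w : B)
    (hj : (j : ℕ) < θ (Fin.last p)) :
    φ (plain θ (m, Function.update b j (v + w))) =
      φ (plain θ (m, Function.update b j v)) + φ (plain θ (m, Function.update b j w)) := by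
  by_cases h0 : (j : ℕ) < θ 0
  · rw [plain_update_first θ _ _ _ _ h0, plain_update_first θ _ _ _ _ h0,
      plain_update_first θ _ _ _ _ h0, mul_add, add_mul, MulOpposite.op_add, add_smul, h.add_zero]
  · obtain ⟨l, h1, h2⟩ := exists_block θ j (by omega) hj
    rw [plain_update_block θ _ _ _ _ l h1 h2, plain_update_block θ _ _ _ _ l h1 h2,
      plain_update_block θ _ _ _ _ l h1 h2, mul_add, add_mul, h.add_succ]

/-- A scalar at the end of the block that ends at position `θ l` may be moved to the position `l` of
the result. -/
theorem Balanced.plain_rmul (h : Balanced ι φ) (x : Tup N B q) (a : A) (i : Fin (q + 1))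
    (l : Fin (p + 1)) (hl : θ l = i) :
    φ (plain θ (rmul i (ι a) x)) = φ (rmul l (ι a) (plain θ x)) := by
  induction l using Fin.induction with
  | zero =>
    cases i using Fin.cases with
    | zero =>
      rw [rmul_zero, rmul_zero]
      unfold plain
      rw [hl, Fin.val_zero, seg_self, MulOpposite.op_one, one_smul, one_smul]
    | succ j =>
      have hl' : (θ 0 : ℕ) = j + 1 := by rw [hl, Fin.val_succ]
      rw [rmul_zero, rmul_succ, plain_update_first θ _ _ _ _ (by omega)]
      unfold plain
      rw [hl', seg_self, mul_one, ← mul_smul, ← MulOpposite.op_mul,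
        seg_split _ j (Nat.zero_le _) (Nat.lt_succ_self _), seg_self, mul_one, mul_assoc]
  | succ l ih =>
    have hle := le_map_iff θ l
    rcases hle.eq_or_lt with heq | hlt
    · have hl2 : θ l.castSucc = i := by rw [← hl]; exact Fin.ext heq
      rw [ih hl2, h.bal, rmul_succ]
      unfold lmul
      have : (plain θ x).2 l = 1 := by
        change seg x.2 _ _ = 1
        rw [heq, seg_self]
      rw [this, one_mul, mul_one]
    · cases i using Fin.cases with
      | zero => rw [hl] at hlt; simp at hlt
      | succ j =>
        have hl' : (θ l.succ : ℕ) = j + 1 := by rw [hl, Fin.val_succ]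
        rw [rmul_succ, rmul_succ, plain_update_block θ _ _ _ _ l (by omega) (by omega)]
        have e : (plain θ x).2 l = seg x.2 (θ l.castSucc) j * x.2 j := by
          change seg x.2 (θ l.castSucc) (θ l.succ) = _
          rw [hl', seg_split x.2 j (by omega) (Nat.lt_succ_self _), seg_self, mul_one]
        rw [e, hl', seg_self, mul_one, mul_assoc]
        rfl

theorem plain_rmul_of_lt (x : Tup N B q) (c : B) (i : Fin (q + 1)) (h : θ (Fin.last p) < i) :
    plain θ (rmul i c x) = plain θ x := by
  cases i using Fin.cases with
  | zero => simp at h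
  | succ j =>
    rw [rmul_succ, plain_update_tail]
    rw [Fin.lt_def, Fin.val_succ] at h
    omega

theorem tail_rmul (x : Tup N B q) (c : B) (i : Fin (q + 1)) (h : i ≤ θ (Fin.last p)) :
    tail θ (rmul i c x) = tail θ x := by
  cases i using Fin.cases with
  | zero => rfl
  | succ j =>
    rw [rmul_succ]
    apply seg_update_of_not
    rw [Fin.le_def, Fin.val_succ] at h
    omega

theorem plain_lmul_tail (x : Tup N B q) (c : B) (j : Fin q) (h : (θ (Fin.last p) : ℕ) ≤ j) :
    plain θ (lmul j c x) = plain θ x := plain_update_tail θ _ _ _ _ h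

theorem tail_lmul (x : Tup N B q) (c : B) (j : Fin q) (h : (j : ℕ) < θ (Fin.last p)) :
    tail θ (lmul j c x) = tail θ x := by
  apply seg_update_of_not
  omega

theorem tail_update (m : N) (b : Fin q → B) (j : Fin q) (v : B)
    (h : (θ (Fin.last p) : ℕ) ≤ j) : tail θ (m, Function.update b j v) =
      seg b (θ (Fin.last p)) j * v * seg b (j + 1) q :=
  seg_update _ _ _ h j.2

theorem tail_update_of_lt (m : N) (b : Fin q → B) (j : Fin q) (v : B)
    (h : (j : ℕ) < θ (Fin.last p)) : tail θ (m, Function.update b j v) = tail θ (m, b) := by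
  apply seg_update_of_not
  omega

theorem tail_lmul_eq (x : Tup N B q) (c : B) (j : Fin q) (h : (θ (Fin.last p) : ℕ) = j) :
    tail θ (lmul j c x) = c * tail θ x := by
  unfold lmul
  rw [tail_update θ _ _ _ _ h.le, h, seg_self, one_mul]
  unfold tail
  rw [h, seg_split x.2 j le_rfl j.2, seg_self, one_mul, mul_assoc]

theorem tail_rmul_lmul (x : Tup N B q) (c : B) (j : Fin q) (h : (θ (Fin.last p) : ℕ) < j) :
    tail θ (rmul j.castSucc c x) = tail θ (lmul j c x) := by
  unfold lmul
  rw [tail_update θ _ _ _ _ h.le]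
  have hj : (j : ℕ) - 1 < q := by omega
  have e : j.castSucc = Fin.succ ⟨(j : ℕ) - 1, hj⟩ := by
    apply Fin.ext
    simp
    omega
  rw [e, rmul_succ, tail_update θ _ _ _ _ (by dsimp; omega)]
  have e' : ((⟨(j : ℕ) - 1, hj⟩ : Fin q) : ℕ) + 1 = j := by dsimp; omega
  rw [e', seg_split x.2 j le_rfl j.2, seg_self, one_mul,
    seg_split x.2 ⟨(j : ℕ) - 1, hj⟩ (s := θ (Fin.last p)) (t := j) (by dsimp; omega)
      (by dsimp; omega), e', seg_self, mul_one]
  simp only [mul_assoc]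

theorem Balanced.plain_bal (h : Balanced ι φ) (x : Tup N B q) (j : Fin q) (a : A)
    (hj : (j : ℕ) < θ (Fin.last p)) :
    φ (plain θ (rmul j.castSucc (ι a) x)) = φ (plain θ (lmul j (ι a) x)) := by
  by_cases hex : ∃ l : Fin p, (θ l.castSucc : ℕ) = j ∧ (j : ℕ) < θ l.succ
  · obtain ⟨l, h1, h2⟩ := hex
    rw [h.plain_rmul θ x a j.castSucc l.castSucc (Fin.ext h1), h.bal]
    unfold lmul
    rw [plain_update_block θ _ _ _ _ l h1.le h2, h1, seg_self, one_mul]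
    have e : (plain θ x).2 l = x.2 j * seg x.2 (j + 1) (θ l.succ) := by
      change seg x.2 (θ l.castSucc) (θ l.succ) = _
      rw [h1, seg_split x.2 j le_rfl h2, seg_self, one_mul]
    rw [e, mul_assoc]
    rfl
  · congr 1
    unfold lmul
    rcases Nat.eq_zero_or_pos (j : ℕ) with hj0 | hj0
    · have e : j.castSucc = 0 := Fin.ext hj0
      rw [e, rmul_zero]
      by_cases h0 : (j : ℕ) < θ 0
      · rw [plain_update_first θ _ _ _ _ h0]
        unfold plain
        rw [← mul_smul, ← MulOpposite.op_mul, hj0, seg_self, one_mul,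
          seg_split x.2 j (s := 0) (t := θ 0) (by omega) h0, hj0, seg_self, one_mul, mul_assoc]
      · obtain ⟨l, h1, h2⟩ := exists_block θ j (by omega) hj
        exact absurd ⟨l, by omega, h2⟩ hex
    · have hj' : (j : ℕ) - 1 < q := by omega
      obtain ⟨i, hi⟩ : ∃ i : Fin q, (i : ℕ) + 1 = j := ⟨⟨(j : ℕ) - 1, hj'⟩, by dsimp; omega⟩
      have e : j.castSucc = i.succ := by
        apply Fin.ext
        simp [hi]
      rw [e, rmul_succ]
      by_cases h0 : (j : ℕ) < θ 0
      · rw [plain_update_first θ _ _ _ _ h0, plain_update_first θ _ _ _ _ (by omega), hi,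
          seg_split x.2 j (s := j) (t := θ 0) le_rfl h0, seg_self, one_mul,
          seg_split x.2 i (s := 0) (t := j) (by omega) (by omega), hi, seg_self, mul_one]
        simp only [mul_assoc]
      · obtain ⟨l, h1, h2⟩ := exists_block θ j (by omega) hj
        have h3 : (θ l.castSucc : ℕ) ≠ j := fun h3 => hex ⟨l, h3, h2⟩
        rw [plain_update_block θ _ _ _ _ l h1 h2, plain_update_block θ _ _ _ _ l (by omega) (by omega),
          hi, seg_split x.2 j (s := j) (t := θ l.succ) le_rfl h2, seg_self, one_mul,
          seg_split x.2 i (s := θ l.castSucc) (t := j) (by omega) (by omega), hi, seg_self, mul_one]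
        simp only [mul_assoc]

end balanced

end Tup

namespace Tup

section more

variable {B N : Type*} [Ring B] [AddCommGroup N] [Module Bᵐᵒᵖ N] {p q r : ℕ}

theorem plain_plain (θ : Fin (p + 1) →o Fin (q + 1)) (η : Fin (r + 1) →o Fin (p + 1))
    (x : Tup N B q) : plain η (plain θ x) = plain (θ.comp η) x := by
  unfold plain
  have h := seg_pull θ x.2 0 (η 0) (Fin.zero_le _)
  rw [Fin.val_zero] at h
  rw [h, ← mul_smul, ← MulOpposite.op_mul, seg_mul_seg _ (Nat.zero_le _) (zero_le_map θ (η 0))]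
  congr 1
  funext l
  exact seg_pull θ x.2 _ _ (η.monotone (Fin.castSucc_lt_succ).le)

theorem plain_id (x : Tup N B q) : plain OrderHom.id x = x := by
  unfold plain
  have h0 : ((OrderHom.id (0 : Fin (q + 1)) : Fin (q + 1)) : ℕ) = 0 := rfl
  rw [h0, seg_self, MulOpposite.op_one, one_smul]
  refine Prod.ext rfl (funext fun l => ?_)
  exact seg_succ x.2 l

theorem tail_id (x : Tup N B q) : tail OrderHom.id x = 1 := seg_self _ _

theorem tail_of_eq_last (θ : Fin (p + 1) →o Fin (q + 1)) (x : Tup N B q)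
    (h : θ (Fin.last p) = Fin.last q) : tail θ x = 1 := by
  unfold tail
  rw [h]
  exact seg_self _ _

theorem tail_comp (θ : Fin (p + 1) →o Fin (q + 1)) (η : Fin (r + 1) →o Fin (p + 1))
    (x : Tup N B q) : tail (θ.comp η) x = tail η (plain θ x) * tail θ x := by
  have h := seg_pull θ x.2 (η (Fin.last r)) (Fin.last p) (Fin.le_last _)
  change seg x.2 (θ (η (Fin.last r))) q = seg (pull θ x.2) _ p * seg x.2 (θ (Fin.last p)) q
  rw [Fin.val_last] at h
  rw [h, seg_mul_seg _ (map_le_last θ _) (by omega)]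

theorem tail_rmul_last (θ : Fin (p + 1) →o Fin (q + 1)) (c : B) (x : Tup N B q)
    (h : θ (Fin.last p) < Fin.last q) : tail θ (rmul (Fin.last q) c x) = tail θ x * c := by
  cases q with
  | zero =>
    rw [Fin.lt_def, Fin.val_last] at h
    omega
  | succ q =>
    have h' : (θ (Fin.last p) : ℕ) ≤ Fin.last q := by
      rw [Fin.lt_def, Fin.val_last] at h
      rw [Fin.val_last]
      omega
    rw [← Fin.succ_last, rmul_succ, tail_update θ _ _ _ _ h']
    unfold tail
    rw [seg_split x.2 (Fin.last q) h' (Fin.last q).2, Fin.val_last, seg_self, mul_one, mul_one,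
      mul_assoc]

end more

section groups

variable {A B : Type*} [Ring A] [Ring B] (ι : A →+* B) (N : Type*) [AddCommGroup N]
  [Module Bᵐᵒᵖ N] (n : ℕ)

/-- The abelian group `N ⊗_A B ⊗_A ⋯ ⊗_A B` (`n` factors `B`). -/
def TensorGroup : Type _ :=
  FreeAbelianGroup (Tup N B n) ⧸ AddSubgroup.closure {z : FreeAbelianGroup (Tup N B n) |
    TensorRel ι n z}

instance : AddCommGroup (TensorGroup ι N n) :=
  inferInstanceAs (AddCommGroup (FreeAbelianGroup (Tup N B n) ⧸
    AddSubgroup.closure {z : FreeAbelianGroup (Tup N B n) | TensorRel ι n z}))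

variable {N n}

/-- The element `x_0 ⊗ ⋯ ⊗ x_n`. -/
def TensorGroup.mk (x : Tup N B n) : TensorGroup ι N n :=
  QuotientAddGroup.mk (FreeAbelianGroup.of x)

variable {ι}

/-- The homomorphism out of the tensor product determined by a balanced map. -/
def TensorGroup.lift {G : Type*} [AddCommGroup G] {φ : Tup N B n → G} (h : Balanced ι φ) :
    TensorGroup ι N n →+ G :=
  QuotientAddGroup.lift _ (FreeAbelianGroup.lift φ)
    ((AddSubgroup.closure_le (K := (FreeAbelianGroup.lift φ).ker)).2 fun _ hz => h.rel hz)

theorem TensorGroup.lift_mk {G : Type*} [AddCommGroup G] {φ : Tup N B n → G} (h : Balanced ι φ)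
    (x : Tup N B n) : TensorGroup.lift h (TensorGroup.mk ι x) = φ x :=
  FreeAbelianGroup.lift_apply_of φ x

theorem TensorGroup.hom_ext {G : Type*} [AddCommGroup G] {f g : TensorGroup ι N n →+ G}
    (h : ∀ x, f (TensorGroup.mk ι x) = g (TensorGroup.mk ι x)) : f = g := by
  apply QuotientAddGroup.addMonoidHom_ext
  apply FreeAbelianGroup.lift_ext
  exact h

theorem TensorGroup.rel {z : FreeAbelianGroup (Tup N B n)} (h : TensorRel ι n z) :
    (QuotientAddGroup.mk z : TensorGroup ι N n) = 0 :=
  (QuotientAddGroup.eq_zero_iff z).2 (AddSubgroup.subset_closure h)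

theorem TensorGroup.balanced_mk :
    Balanced ι (TensorGroup.mk ι : Tup N B n → TensorGroup ι N n) where
  add_zero m m' b := sub_eq_zero.1 (TensorGroup.rel (TensorRel.add_zero m m' b))
  add_succ m b j v w := sub_eq_zero.1 (TensorGroup.rel (TensorRel.add_succ m b j v w))
  bal x j a := sub_eq_zero.1 (TensorGroup.rel (TensorRel.bal x j a))

end groups

end Tup

open Tup

namespace AugmentedAlgebra

variable {A B : Type*} [Ring A] [Ring B] [Module B A] (E : AugmentedAlgebra A B)

theorem aug_one : E.aug 1 = 1 := by rw [← map_one E.incl, E.aug_incl]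

theorem incl_smul (a a' : A) : E.incl a • a' = a * a' := by
  rw [← E.aug_incl a', ← map_smul, smul_eq_mul, ← map_mul, E.aug_incl, E.aug_incl]

theorem aug_incl_mul (a : A) (b : B) : E.aug (E.incl a * b) = a * E.aug b := by
  rw [← smul_eq_mul, map_smul, E.incl_smul]

theorem aug_mul_incl (b c : B) : E.aug (b * E.incl (E.aug c)) = E.aug (b * c) := by
  rw [← smul_eq_mul, map_smul, E.aug_incl, ← smul_eq_mul b c, map_smul]

variable {N : Type*} [AddCommGroup N] [Module Bᵐᵒᵖ N] {p q r : ℕ}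

/-- The operator of `⊥(B/A, N)` on elementary tensors: the factors of `x_0 ⊗ ⋯ ⊗ x_q` are multiplied
over the blocks determined by `θ`, and the last factor is multiplied by `π` of the product of those
after the last block. -/
def barOp (θ : Fin (p + 1) →o Fin (q + 1)) (x : Tup N B q) : Tup N B p :=
  rmul (Fin.last p) (E.incl (E.aug (tail θ x))) (plain θ x)

theorem balanced_barOp (θ : Fin (p + 1) →o Fin (q + 1)) :
    Balanced E.incl fun x : Tup N B q => TensorGroup.mk E.incl (E.barOp θ x) := by
  have hb : Balanced E.incl (TensorGroup.mk E.incl : Tup N B p → TensorGroup E.incl N p) :=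
    TensorGroup.balanced_mk
  refine ⟨fun m m' b => ?_, fun m b j v w => ?_, fun x j a => ?_⟩
  · exact (hb.comp_rmul_last (E.incl (E.aug (seg b (θ (Fin.last p)) q)))).plain_add_zero θ m m' b
  · by_cases hj : (j : ℕ) < θ (Fin.last p)
    · unfold barOp
      rw [tail_update_of_lt θ _ _ _ _ hj, tail_update_of_lt θ _ _ _ _ hj,
        tail_update_of_lt θ _ _ _ _ hj]
      exact (hb.comp_rmul_last _).plain_add_succ θ m b j v w hj
    · rw [not_lt] at hj
      unfold barOp
      rw [tail_update θ _ _ _ _ hj, tail_update θ _ _ _ _ hj, tail_update θ _ _ _ _ hj,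
        plain_update_tail θ _ _ _ _ hj, plain_update_tail θ _ _ _ _ hj,
        plain_update_tail θ _ _ _ _ hj, mul_add, add_mul, map_add, map_add, hb.rmul_add]
  · unfold barOp
    rcases lt_trichotomy (j : ℕ) (θ (Fin.last p)) with hj | hj | hj
    · rw [tail_rmul θ _ _ _ (Fin.le_def.2 hj.le), tail_lmul θ _ _ _ hj]
      exact (hb.comp_rmul_last _).plain_bal θ x j a hj
    · rw [tail_rmul θ _ _ _ (Fin.le_def.2 hj.le), tail_lmul_eq θ _ _ _ hj.symm,
        plain_lmul_tail θ _ _ _ hj.symm.le, E.aug_incl_mul, map_mul]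
      have := (hb.comp_rmul_last (E.incl (E.aug (tail θ x)))).plain_rmul θ x a j.castSucc
        (Fin.last p) (Fin.ext hj.symm)
      rw [this, rmul_rmul]
    · rw [plain_rmul_of_lt θ _ _ _ (Fin.lt_def.2 hj), plain_lmul_tail θ _ _ _ hj.le,
        tail_rmul_lmul θ _ _ _ hj]

/-- The operator of `⊥(B/A, N)` determined by a monotone map. -/
def barMap (θ : Fin (p + 1) →o Fin (q + 1)) : TensorGroup E.incl N q →+ TensorGroup E.incl N p :=
  TensorGroup.lift (E.balanced_barOp θ)

theorem barMap_mk (θ : Fin (p + 1) →o Fin (q + 1)) (x : Tup N B q) :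
    E.barMap θ (TensorGroup.mk E.incl x) = TensorGroup.mk E.incl (E.barOp θ x) :=
  TensorGroup.lift_mk _ x

theorem barMap_id : E.barMap (N := N) (OrderHom.id : Fin (p + 1) →o Fin (p + 1)) =
    AddMonoidHom.id _ := by
  apply TensorGroup.hom_ext
  intro x
  rw [barMap_mk]
  unfold barOp
  rw [tail_id, plain_id, aug_one, map_one, rmul_one]
  rfl

theorem barMap_comp (θ : Fin (p + 1) →o Fin (q + 1)) (η : Fin (r + 1) →o Fin (p + 1)) :
    E.barMap (N := N) (θ.comp η) = (E.barMap η).comp (E.barMap θ) := by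
  apply TensorGroup.hom_ext
  intro x
  rw [AddMonoidHom.comp_apply, barMap_mk, barMap_mk, barMap_mk]
  unfold barOp
  rcases (Fin.le_last (η (Fin.last r))).eq_or_lt with h | h
  · rw [tail_comp, tail_rmul η _ _ _ (by rw [h]), tail_of_eq_last η _ h, one_mul, aug_one, map_one,
      rmul_one, (TensorGroup.balanced_mk (ι := E.incl)).plain_rmul η _ _ _ _ h, plain_plain]
  · rw [plain_rmul_of_lt η _ _ _ h, tail_rmul_last η _ _ h, aug_mul_incl, plain_plain, tail_comp]

/-- The map `⊥_n(B/A, N) → ⊥_n(B/A, N')` induced by a homomorphism of right `B`-modules. -/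
def barCoeff {N' : Type*} [AddCommGroup N'] [Module Bᵐᵒᵖ N'] (f : N →ₗ[Bᵐᵒᵖ] N') (n : ℕ) :
    TensorGroup E.incl N n →+ TensorGroup E.incl N' n :=
  TensorGroup.lift (φ := fun x => TensorGroup.mk E.incl (f x.1, x.2)) <| by
    have hb := TensorGroup.balanced_mk (ι := E.incl) (N := N') (n := n)
    refine ⟨fun m m' b => ?_, fun m b j v w => hb.add_succ _ _ _ _ _, fun x j a => ?_⟩
    · rw [map_add, hb.add_zero]
    · have e : ∀ (i : Fin (n + 1)) (c : B) (x : Tup N B n),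
          (f (rmul i c x).1, (rmul i c x).2) = rmul i c (f x.1, x.2) := by
        intro i c x
        cases i using Fin.cases with
        | zero => rw [rmul_zero, rmul_zero, map_smul]
        | succ j => rw [rmul_succ, rmul_succ]
      rw [e, hb.bal]
      rfl

theorem barCoeff_mk {N' : Type*} [AddCommGroup N'] [Module Bᵐᵒᵖ N'] (f : N →ₗ[Bᵐᵒᵖ] N') (n : ℕ)
    (x : Tup N B n) :
    E.barCoeff f n (TensorGroup.mk E.incl x) = TensorGroup.mk E.incl (f x.1, x.2) :=
  TensorGroup.lift_mk _ x

theorem barCoeff_barMap {N' : Type*} [AddCommGroup N'] [Module Bᵐᵒᵖ N'] (f : N →ₗ[Bᵐᵒᵖ] N')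
    (θ : Fin (p + 1) →o Fin (q + 1)) :
    (E.barCoeff f p).comp (E.barMap θ) = (E.barMap θ).comp (E.barCoeff f q) := by
  apply TensorGroup.hom_ext
  intro x
  rw [AddMonoidHom.comp_apply, AddMonoidHom.comp_apply, barMap_mk, barCoeff_mk, barCoeff_mk,
    barMap_mk]
  have e : ∀ (i : Fin (p + 1)) (c : B) (x : Tup N B p),
      (f (rmul i c x).1, (rmul i c x).2) = rmul i c (f x.1, x.2) := by
    intro i c x
    cases i using Fin.cases with
    | zero => rw [rmul_zero, rmul_zero, map_smul]
    | succ j => rw [rmul_succ, rmul_succ]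
  unfold barOp
  rw [e]
  unfold plain
  rw [map_smul]
  rfl

end AugmentedAlgebra

section bar

universe w u v

variable {A : Type v} {B : Type u} [Ring A] [Ring B] [Module B A] (E : AugmentedAlgebra A B)

/-- The simplicial abelian group `⊥(B/A, N)` of a right `B`-module `N`. -/
noncomputable def AugmentedAlgebra.bar (N : ModuleCat.{w} Bᵐᵒᵖ) :
    SimplicialObject AddCommGrpCat.{max w u} where
  obj Δ := AddCommGrpCat.of (TensorGroup E.incl N Δ.unop.len)
  map θ := AddCommGrpCat.ofHom (E.barMap θ.unop.toOrderHom)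
  map_id Δ := by
    change AddCommGrpCat.ofHom (E.barMap OrderHom.id) = _
    rw [E.barMap_id]
    rfl
  map_comp θ η := by
    change AddCommGrpCat.ofHom (E.barMap (θ.unop.toOrderHom.comp η.unop.toOrderHom)) = _
    rw [E.barMap_comp]
    rfl

/-- The functor `⊥(B/A, -)` from right `B`-modules to simplicial abelian groups. -/
noncomputable def AugmentedAlgebra.barFunctor :
    ModuleCat.{w} Bᵐᵒᵖ ⥤ SimplicialObject AddCommGrpCat.{max w u} where
  obj N := E.bar N
  map {N N'} f :=
    { app := fun Δ => AddCommGrpCat.ofHom (E.barCoeff f.hom Δ.unop.len)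
      naturality := fun Δ Δ' θ => by
        change AddCommGrpCat.ofHom ((E.barCoeff f.hom _).comp (E.barMap θ.unop.toOrderHom)) = _
        rw [E.barCoeff_barMap]
        rfl }
  map_id N := by
    apply NatTrans.ext
    funext Δ
    apply AddCommGrpCat.hom_ext
    apply TensorGroup.hom_ext
    intro x
    exact E.barCoeff_mk _ _ x
  map_comp f g := by
    apply NatTrans.ext
    funext Δ
    apply AddCommGrpCat.hom_ext
    apply TensorGroup.hom_ext
    intro x
    exact (E.barCoeff_mk _ _ x).trans (((congrArg (E.barCoeff g.hom _)
      (E.barCoeff_mk f.hom _ x)).trans (E.barCoeff_mk _ _ _)).symm)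

instance : (E.barFunctor ⋙ AlgebraicTopology.alternatingFaceMapComplex
    AddCommGrpCat.{max w u}).PreservesZeroMorphisms where
  map_zero N N' := by
    apply HomologicalComplex.hom_ext
    intro i
    apply AddCommGrpCat.hom_ext
    refine TensorGroup.hom_ext (ι := E.incl) (N := N) (n := i) fun x => ?_
    refine (E.barCoeff_mk (0 : N →ₗ[Bᵐᵒᵖ] N') i x).trans ?_
    have h := (TensorGroup.balanced_mk (ι := E.incl) (N := N') (n := i)).add_zero 0 0 x.2
    rw [add_zero] at h
    exact left_eq_add.1 h

/-- The hyperhomology `ℍ(B/A, D)` of a chain complex `D` of right `B`-modules: the total complex of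
the double complex `⊥_p(B/A, D_q)`. -/
noncomputable def AugmentedAlgebra.hyperhomology (D : ChainComplex (ModuleCat.{w} Bᵐᵒᵖ) ℕ) :
    ChainComplex AddCommGrpCat.{max w u} ℕ :=
  HomologicalComplex₂.total (((E.barFunctor ⋙ AlgebraicTopology.alternatingFaceMapComplex
    AddCommGrpCat.{max w u}).mapHomologicalComplex (ComplexShape.down ℕ)).obj D)
    (ComplexShape.down ℕ)

end bar

namespace Tup

section hochschild

variable {A B : Type*} [Ring A] [Ring B] {ι : A →+* B} {N : Type*} [AddCommGroup N]
  [Module B N] [Module Bᵐᵒᵖ N] {n p q r : ℕ}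

/-- The multiadditive maps on tuples that are `A`-balanced in the cyclic sense. -/
structure CycBalanced (ι : A →+* B) {G : Type*} [AddCommGroup G] (φ : Tup N B n → G) : Prop
    extends Balanced ι φ where
  cyc : ∀ (x : Tup N B n) (a : A), φ (lmulZero (ι a) x) = φ (rmul (Fin.last n) (ι a) x)

/-- The relations of `(N ⊗_A B ⊗_A ⋯ ⊗_A B)_A`: those of the tensor product, and
`a x_0 ⊗ ⋯ ⊗ x_n = x_0 ⊗ ⋯ ⊗ x_n a`. -/
inductive HochRel (ι : A →+* B) (n : ℕ) : FreeAbelianGroup (Tup N B n) → Prop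
  | tensor (z : FreeAbelianGroup (Tup N B n)) : TensorRel ι n z → HochRel ι n z
  | cyc (x : Tup N B n) (a : A) : HochRel ι n
      (FreeAbelianGroup.of (lmulZero (ι a) x) - FreeAbelianGroup.of (rmul (Fin.last n) (ι a) x))

theorem CycBalanced.rel {ι : A →+* B} {G : Type*} [AddCommGroup G] {φ : Tup N B n → G}
    (h : CycBalanced ι φ) {z : FreeAbelianGroup (Tup N B n)} (hz : HochRel ι n z) :
    FreeAbelianGroup.lift φ z = 0 := by
  cases hz with
  | tensor z hz => exact h.toBalanced.rel hz
  | cyc x a =>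
    rw [map_sub, FreeAbelianGroup.lift_apply_of, FreeAbelianGroup.lift_apply_of, h.cyc, sub_self]

variable (ι N n)

/-- The abelian group `C_n(B/A, N) = (N ⊗_A B ⊗_A ⋯ ⊗_A B)_A` (`n` factors `B`). -/
def HochGroup : Type _ :=
  FreeAbelianGroup (Tup N B n) ⧸ AddSubgroup.closure {z : FreeAbelianGroup (Tup N B n) |
    HochRel ι n z}

instance : AddCommGroup (HochGroup ι N n) :=
  inferInstanceAs (AddCommGroup (FreeAbelianGroup (Tup N B n) ⧸
    AddSubgroup.closure {z : FreeAbelianGroup (Tup N B n) | HochRel ι n z}))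

variable {N n}

/-- The class of `x_0 ⊗ ⋯ ⊗ x_n`. -/
def HochGroup.mk (x : Tup N B n) : HochGroup ι N n :=
  QuotientAddGroup.mk (FreeAbelianGroup.of x)

variable {ι}

/-- The homomorphism out of `C_n(B/A, N)` determined by a balanced map. -/
def HochGroup.lift {G : Type*} [AddCommGroup G] {φ : Tup N B n → G} (h : CycBalanced ι φ) :
    HochGroup ι N n →+ G :=
  QuotientAddGroup.lift _ (FreeAbelianGroup.lift φ)
    ((AddSubgroup.closure_le (K := (FreeAbelianGroup.lift φ).ker)).2 fun _ hz => h.rel hz)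

theorem HochGroup.lift_mk {G : Type*} [AddCommGroup G] {φ : Tup N B n → G} (h : CycBalanced ι φ)
    (x : Tup N B n) : HochGroup.lift h (HochGroup.mk ι x) = φ x :=
  FreeAbelianGroup.lift_apply_of φ x

theorem HochGroup.hom_ext {G : Type*} [AddCommGroup G] {f g : HochGroup ι N n →+ G}
    (h : ∀ x, f (HochGroup.mk ι x) = g (HochGroup.mk ι x)) : f = g := by
  apply QuotientAddGroup.addMonoidHom_ext
  apply FreeAbelianGroup.lift_ext
  exact h

theorem HochGroup.rel {z : FreeAbelianGroup (Tup N B n)} (h : HochRel ι n z) :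
    (QuotientAddGroup.mk z : HochGroup ι N n) = 0 :=
  (QuotientAddGroup.eq_zero_iff z).2 (AddSubgroup.subset_closure h)

theorem HochGroup.cycBalanced_mk :
    CycBalanced ι (HochGroup.mk ι : Tup N B n → HochGroup ι N n) where
  add_zero m m' b := sub_eq_zero.1 (HochGroup.rel (.tensor _ (.add_zero m m' b)))
  add_succ m b j v w := sub_eq_zero.1 (HochGroup.rel (.tensor _ (.add_succ m b j v w)))
  bal x j a := sub_eq_zero.1 (HochGroup.rel (.tensor _ (.bal x j a)))
  cyc x a := sub_eq_zero.1 (HochGroup.rel (.cyc x a))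

variable [SMulCommClass B Bᵐᵒᵖ N]

theorem lmulZero_rmul (i : Fin (n + 1)) (c d : B) (x : Tup N B n) :
    lmulZero c (rmul i d x) = rmul i d (lmulZero c x) := by
  cases i using Fin.cases with
  | zero => simp only [rmul_zero, lmulZero, smul_comm c]
  | succ j => simp only [rmul_succ, lmulZero]

theorem lmulZero_lmulZero (c d : B) (x : Tup N B n) :
    lmulZero c (lmulZero d x) = lmulZero (c * d) x := by
  unfold lmulZero
  rw [mul_smul]

theorem plain_lmulZero (θ : Fin (p + 1) →o Fin (q + 1)) (c : B) (x : Tup N B q) :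
    plain θ (lmulZero c x) = lmulZero c (plain θ x) := by
  unfold plain lmulZero
  rw [smul_comm c]

variable (B N) in
/-- The operator of `C(B/A, N)` on elementary tensors: the factors of `x_0 ⊗ ⋯ ⊗ x_q` are multiplied
over the blocks determined by `θ`, and the product of those after the last block is brought to the
front. -/
def hochOp (θ : Fin (p + 1) →o Fin (q + 1)) (x : Tup N B q) : Tup N B p :=
  lmulZero (tail θ x) (plain θ x)

variable (ι) in
theorem cycBalanced_hochOp (θ : Fin (p + 1) →o Fin (q + 1)) :
    CycBalanced ι fun x : Tup N B q => HochGroup.mk ι (hochOp B N θ x) := by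
  have hc : CycBalanced ι (HochGroup.mk ι : Tup N B p → HochGroup ι N p) :=
    HochGroup.cycBalanced_mk
  have hb := hc.toBalanced
  refine ⟨⟨fun m m' b => ?_, fun m b j v w => ?_, fun x j a => ?_⟩, fun x a => ?_⟩
  · exact (hb.comp_lmulZero (seg b (θ (Fin.last p)) q)).plain_add_zero θ m m' b
  · by_cases hj : (j : ℕ) < θ (Fin.last p)
    · unfold hochOp
      rw [tail_update_of_lt θ _ _ _ _ hj, tail_update_of_lt θ _ _ _ _ hj,
        tail_update_of_lt θ _ _ _ _ hj]
      exact (hb.comp_lmulZero _).plain_add_succ θ m b j v w hj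
    · rw [not_lt] at hj
      unfold hochOp
      rw [tail_update θ _ _ _ _ hj, tail_update θ _ _ _ _ hj, tail_update θ _ _ _ _ hj,
        plain_update_tail θ _ _ _ _ hj, plain_update_tail θ _ _ _ _ hj,
        plain_update_tail θ _ _ _ _ hj, mul_add, add_mul]
      unfold lmulZero
      rw [add_smul, hb.add_zero]
  · unfold hochOp
    rcases lt_trichotomy (j : ℕ) (θ (Fin.last p)) with hj | hj | hj
    · rw [tail_rmul θ _ _ _ (Fin.le_def.2 hj.le), tail_lmul θ _ _ _ hj]
      exact (hb.comp_lmulZero _).plain_bal θ x j a hj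
    · rw [tail_rmul θ _ _ _ (Fin.le_def.2 hj.le), tail_lmul_eq θ _ _ _ hj.symm,
        plain_lmul_tail θ _ _ _ hj.symm.le]
      have := (hb.comp_lmulZero (tail θ x)).plain_rmul θ x a j.castSucc
        (Fin.last p) (Fin.ext hj.symm)
      rw [this, lmulZero_rmul, ← hc.cyc, lmulZero_lmulZero]
    · rw [plain_rmul_of_lt θ _ _ _ (Fin.lt_def.2 hj), plain_lmul_tail θ _ _ _ hj.le,
        tail_rmul_lmul θ _ _ _ hj]
  · unfold hochOp
    rw [plain_lmulZero, lmulZero_lmulZero]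
    rcases (Fin.le_last (θ (Fin.last p))).eq_or_lt with h | h
    · rw [tail_of_eq_last θ _ h, tail_of_eq_last θ _ h, one_mul, hc.cyc]
      have h1 : ∀ y : Tup N B p, lmulZero 1 y = y := fun y => Prod.ext (one_smul B y.1) rfl
      rw [h1, hb.plain_rmul θ _ _ _ _ h]
    · rw [plain_rmul_of_lt θ _ _ _ h, tail_rmul_last θ _ _ h]
      rfl

variable (ι N)

/-- The operator of `C(B/A, N)` determined by a monotone map. -/
def hochMap (θ : Fin (p + 1) →o Fin (q + 1)) : HochGroup ι N q →+ HochGroup ι N p :=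
  HochGroup.lift (cycBalanced_hochOp ι θ)

variable {N}

theorem hochMap_mk (θ : Fin (p + 1) →o Fin (q + 1)) (x : Tup N B q) :
    hochMap ι N θ (HochGroup.mk ι x) = HochGroup.mk ι (hochOp B N θ x) :=
  HochGroup.lift_mk _ x

variable (N)

theorem hochMap_id : hochMap ι N (OrderHom.id : Fin (p + 1) →o Fin (p + 1)) =
    AddMonoidHom.id _ := by
  apply HochGroup.hom_ext
  intro x
  rw [hochMap_mk]
  unfold hochOp
  rw [tail_id, plain_id]
  unfold lmulZero
  rw [one_smul]
  rfl

theorem hochMap_comp (θ : Fin (p + 1) →o Fin (q + 1)) (η : Fin (r + 1) →o Fin (p + 1)) :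
    hochMap ι N (θ.comp η) = (hochMap ι N η).comp (hochMap ι N θ) := by
  apply HochGroup.hom_ext
  intro x
  rw [AddMonoidHom.comp_apply, hochMap_mk, hochMap_mk, hochMap_mk]
  unfold hochOp
  rw [plain_lmulZero, lmulZero_lmulZero, plain_plain, tail_comp]
  rfl

end hochschild

end Tup

section

open Tup

universe w u v

/-- The simplicial abelian group `C(B/A, N)` of a `B`-bimodule `N`. -/
noncomputable def hochschild {A : Type v} {B : Type u} [Ring A] [Ring B] (ι : A →+* B) (N : Type w)
    [AddCommGroup N] [Module B N] [Module Bᵐᵒᵖ N] [SMulCommClass B Bᵐᵒᵖ N] :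
    SimplicialObject AddCommGrpCat.{max w u} where
  obj Δ := AddCommGrpCat.of (HochGroup ι N Δ.unop.len)
  map θ := AddCommGrpCat.ofHom (hochMap ι N θ.unop.toOrderHom)
  map_id Δ := by
    change AddCommGrpCat.ofHom (hochMap ι N OrderHom.id) = _
    rw [hochMap_id]
    rfl
  map_comp θ η := by
    change AddCommGrpCat.ofHom (hochMap ι N (θ.unop.toOrderHom.comp η.unop.toOrderHom)) = _
    rw [hochMap_comp]
    rfl

end

namespace Tup

section action

variable {R M : Type*} [Ring R] [DistribMulAction Emb R] [AddCommGroup M] [DistribMulAction Emb M]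
  {n : ℕ}

/-- The diagonal action of `f` on tuples. -/
def embTup (f : Emb) (x : Tup M R n) : Tup M R n := (f • x.1, fun i => f • x.2 i)

theorem embTup_mul (f g : Emb) (x : Tup M R n) : embTup (f * g) x = embTup f (embTup g x) := by
  unfold embTup
  simp only [mul_smul]

theorem embTup_one (x : Tup M R n) : embTup 1 x = x := by
  unfold embTup
  simp only [one_smul]

theorem embTup_update (f : Emb) (m : M) (b : Fin n → R) (j : Fin n) (v : R) :
    embTup f (m, Function.update b j v) =
      (f • m, Function.update (fun i => f • b i) j (f • v)) := by
  unfold embTup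
  refine Prod.ext rfl (funext fun i => ?_)
  exact Function.apply_update (fun _ (v : R) => f • v) b j v i

end action

section central

variable {k R M : Type*} [CommRing k] [Ring R] [Algebra (LC k) R] [AddCommGroup M] [Module R M]
  [Module Rᵐᵒᵖ M] [Module (LC k) M] [IsScalarTower (LC k) R M] [IsScalarTower (LC k) Rᵐᵒᵖ M]
  {n : ℕ}

theorem algebraMap_smul_coeff (p : LC k) (m : M) : algebraMap (LC k) R p • m = p • m := by
  rw [Algebra.algebraMap_eq_smul_one, smul_assoc, one_smul]

theorem op_algebraMap_smul_coeff (p : LC k) (m : M) :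
    MulOpposite.op (algebraMap (LC k) R p) • m = p • m := by
  rw [Algebra.algebraMap_eq_smul_one, op_smul_one_smul]

theorem HochGroup.mk_lmul (p : LC k) (x : Tup M R n) (j : Fin n) :
    HochGroup.mk (algebraMap (LC k) R) (lmul j (algebraMap (LC k) R p) x) =
      HochGroup.mk (algebraMap (LC k) R) (p • x.1, x.2) := by
  have hc : CycBalanced (algebraMap (LC k) R) (HochGroup.mk (algebraMap (LC k) R) : Tup M R n → _) :=
    HochGroup.cycBalanced_mk
  cases n with
  | zero => exact j.elim0
  | succ n =>
    induction j using Fin.induction with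
    | zero =>
      rw [← hc.bal, Fin.castSucc_zero, rmul_zero, op_algebraMap_smul_coeff]
    | succ j ih =>
      rw [← hc.bal, ← Fin.succ_castSucc, rmul_succ, ← Algebra.commutes]
      exact ih

theorem HochGroup.mk_smul_coeff (p : LC k) (x : Tup M R n) (S : Finset (Fin n)) :
    p * p = p → HochGroup.mk (algebraMap (LC k) R) (p • x.1, fun i => if i ∈ S then p • x.2 i else x.2 i) =
      HochGroup.mk (algebraMap (LC k) R) (p • x.1, x.2) := by
  intro hp
  induction S using Finset.induction_on with
  | empty => simp
  | insert j S hj ih =>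
    have e : ((p • x.1, fun i => if i ∈ insert j S then p • x.2 i else x.2 i) : Tup M R n) =
        lmul j (algebraMap (LC k) R p) (p • x.1, fun i => if i ∈ S then p • x.2 i else x.2 i) := by
      refine Prod.ext rfl (funext fun i => ?_)
      change (if i ∈ insert j S then p • x.2 i else x.2 i) = Function.update
        (fun i => if i ∈ S then p • x.2 i else x.2 i) j
          (algebraMap (LC k) R p * (if j ∈ S then p • x.2 j else x.2 j)) i
      by_cases hi : i = j
      · subst hi
        simp [hj, Algebra.smul_def]
      · rw [Function.update_of_ne hi]
        simp [hi]
    rw [e, HochGroup.mk_lmul, ← ih, ← mul_smul, hp]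

theorem HochGroup.mk_idem (p : LC k) (hp : p * p = p) (x : Tup M R n) :
    HochGroup.mk (algebraMap (LC k) R) ((p • x.1, fun i => p • x.2 i) : Tup M R n) =
      HochGroup.mk (algebraMap (LC k) R) (p • x.1, x.2) := by
  rw [← HochGroup.mk_smul_coeff p x Finset.univ hp]
  simp

end central

section covariant

variable {k R M : Type*} [CommRing k] [Ring R] [Algebra (LC k) R] [DistribMulAction Emb R]
  [EmbBundle k R] [AddCommGroup M] [Module R M] [Module Rᵐᵒᵖ M] [SMulCommClass R Rᵐᵒᵖ M]
  [Module (LC k) M] [IsScalarTower (LC k) R M] [IsScalarTower (LC k) Rᵐᵒᵖ M]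
  [DistribMulAction Emb M] [CovariantBimodule k R M] {n p q : ℕ}

theorem ind_mul_self (A : Set ℕ) : LC.ind k A * LC.ind k A = LC.ind k A := by
  rw [LC.ind_mul_ind, Set.inter_self]

theorem emb_smul_algebraMap (f : Emb) (c : LC k) :
    f • algebraMap (LC k) R c = algebraMap (LC k) R (f • c) := by
  rw [Algebra.algebraMap_eq_smul_one, Algebra.algebraMap_eq_smul_one,
    (EmbBundle.embModule k).smul_smul, EmbBundle.emb_one k, ← mul_smul, ← LC.emb_smul_ind,
    ← LC.emb_smul_mul, LC.ind_univ, mul_one]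

theorem embTup_rmul (f : Emb) (i : Fin (n + 1)) (c : LC k) (x : Tup M R n) :
    embTup f (rmul i (algebraMap (LC k) R c) x) =
      rmul i (algebraMap (LC k) R (f • c)) (embTup f x) := by
  cases i using Fin.cases with
  | zero =>
    rw [rmul_zero, rmul_zero, ← emb_smul_algebraMap]
    unfold embTup
    rw [CovariantBimodule.emb_op_smul k R]
  | succ j =>
    rw [rmul_succ, rmul_succ, embTup_update, EmbBundle.emb_mul k, emb_smul_algebraMap]
    rfl

theorem embTup_lmul (f : Emb) (j : Fin n) (c : LC k) (x : Tup M R n) :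
    embTup f (lmul j (algebraMap (LC k) R c) x) =
      lmul j (algebraMap (LC k) R (f • c)) (embTup f x) := by
  unfold lmul
  rw [embTup_update, EmbBundle.emb_mul k, emb_smul_algebraMap]
  rfl

theorem embTup_lmulZero (f : Emb) (c : LC k) (x : Tup M R n) :
    embTup f (lmulZero (algebraMap (LC k) R c) x) =
      lmulZero (algebraMap (LC k) R (f • c)) (embTup f x) := by
  unfold lmulZero embTup
  rw [CovariantBimodule.emb_smul k R, emb_smul_algebraMap]

variable (k R M n) in
theorem cycBalanced_embTup (f : Emb) : CycBalanced (algebraMap (LC k) R)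
    fun x : Tup M R n => HochGroup.mk (algebraMap (LC k) R) (embTup f x) := by
  have hc : CycBalanced (algebraMap (LC k) R) (HochGroup.mk (algebraMap (LC k) R) : Tup M R n → _) :=
    HochGroup.cycBalanced_mk
  refine ⟨⟨fun m m' b => ?_, fun m b j v w => ?_, fun x j a => ?_⟩, fun x a => ?_⟩
  · unfold embTup
    rw [smul_add, hc.add_zero]
  · rw [embTup_update, embTup_update, embTup_update, smul_add, hc.add_succ]
  · rw [embTup_rmul, embTup_lmul, hc.bal]
  · rw [embTup_rmul, embTup_lmulZero, hc.cyc]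

variable (k R M n) in
/-- The diagonal action of `f` on `C_n(R/𝒫(k), M)`. -/
def embHoch (f : Emb) :
    HochGroup (algebraMap (LC k) R) M n →+ HochGroup (algebraMap (LC k) R) M n :=
  HochGroup.lift (cycBalanced_embTup k R M n f)

theorem embHoch_mk (f : Emb) (x : Tup M R n) :
    embHoch k R M n f (HochGroup.mk _ x) = HochGroup.mk _ (embTup f x) :=
  HochGroup.lift_mk _ x

variable (k R M n) in
/-- The right action of `Emb` on `C_n(R/𝒫(k), M)`: `x · f = f†_* x`. -/
def embHochOp : Emb →* (AddMonoid.End (HochGroup (algebraMap (LC k) R) M n))ᵐᵒᵖ where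
  toFun f := MulOpposite.op (embHoch k R M n f.dag)
  map_one' := by
    apply MulOpposite.unop_injective
    apply HochGroup.hom_ext
    intro x
    refine (embHoch_mk _ x).trans ?_
    rw [Emb.dag_one, embTup_one]
    rfl
  map_mul' f g := by
    apply MulOpposite.unop_injective
    apply HochGroup.hom_ext
    intro x
    refine (embHoch_mk _ x).trans ?_
    rw [Emb.dag_mul, embTup_mul, ← embHoch_mk, ← embHoch_mk]
    rfl

theorem embHoch_idem (A : Set ℕ) (x : Tup M R n) :
    embHoch k R M n (Emb.idem A) (HochGroup.mk _ x) =
      HochGroup.mk (algebraMap (LC k) R) (LC.ind k A • x.1, x.2) := by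
  rw [embHoch_mk, ← HochGroup.mk_idem _ (ind_mul_self A)]
  unfold embTup
  rw [CovariantBimodule.idem_smul k R]
  simp only [EmbBundle.idem_smul (k := k)]

variable (k R M n) in
theorem tight_embHochOp : Gam.Tight (embHochOp k R M n) := by
  intro A B hAB
  have hc : CycBalanced (algebraMap (LC k) R) (HochGroup.mk (algebraMap (LC k) R) : Tup M R n → _) :=
    HochGroup.cycBalanced_mk
  apply MulOpposite.unop_injective
  apply HochGroup.hom_ext
  intro x
  change embHoch k R M n (Emb.idem (A ∪ B)).dag _ =
    embHoch k R M n (Emb.idem A).dag _ + embHoch k R M n (Emb.idem B).dag _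
  rw [Emb.dag_idem, Emb.dag_idem, Emb.dag_idem, embHoch_idem, embHoch_idem, embHoch_idem,
    LC.ind_union hAB, add_smul, hc.add_zero]

/-- `C_n(R/𝒫(k), M)` as a right module over `Γ`. -/
noncomputable instance : Module Gamᵐᵒᵖ (HochGroup (algebraMap (LC k) R) M n) :=
  Module.compHom _
    ({ toFun := fun A => (Gam.lift (embHochOp k R M n) (tight_embHochOp k R M n) A.unop).unop
       map_one' := by rw [MulOpposite.unop_one, map_one, MulOpposite.unop_one]
       map_mul' := fun A B => by rw [MulOpposite.unop_mul, map_mul, MulOpposite.unop_mul]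
       map_zero' := by rw [MulOpposite.unop_zero, map_zero, MulOpposite.unop_zero]
       map_add' := fun A B => by rw [MulOpposite.unop_add, map_add, MulOpposite.unop_add] } :
      Gamᵐᵒᵖ →+* AddMonoid.End (HochGroup (algebraMap (LC k) R) M n))

theorem op_U_smul (f : Emb) (c : HochGroup (algebraMap (LC k) R) M n) :
    MulOpposite.op (Gam.U f) • c = embHoch k R M n f.dag c := by
  change (Gam.lift (embHochOp k R M n) (tight_embHochOp k R M n) (Gam.U f)).unop c = _
  rw [Gam.lift_U]
  rfl

theorem op_U_smul_mk (f : Emb) (x : Tup M R n) :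
    MulOpposite.op (Gam.U f) • HochGroup.mk (algebraMap (LC k) R) x =
      HochGroup.mk (algebraMap (LC k) R) (f.dag • x.1, fun i => f.dag • x.2 i) := by
  rw [op_U_smul, embHoch_mk]
  rfl

variable (k) in
theorem emb_smul_seg (f : Emb) (b : Fin n → R) (s t : ℕ) :
    f • seg b s t = LC.ind k (f.image Set.univ) • seg (fun i => f • b i) s t := by
  unfold seg
  induction List.range' s (t - s) with
  | nil => simp [EmbBundle.emb_one k]
  | cons i l ih =>
    rw [List.map_cons, List.map_cons, List.prod_cons, List.prod_cons, EmbBundle.emb_mul k, ih]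
    split_ifs with h
    · rw [mul_smul_comm]
    · rw [EmbBundle.emb_one k, smul_mul_smul_comm, ind_mul_self]

theorem hochMap_embHoch (θ : Fin (p + 1) →o Fin (q + 1)) (f : Emb)
    (c : HochGroup (algebraMap (LC k) R) M q) :
    hochMap (algebraMap (LC k) R) M θ (embHoch k R M q f c) =
      embHoch k R M p f (hochMap (algebraMap (LC k) R) M θ c) := by
  have key : (hochMap (algebraMap (LC k) R) M θ).comp (embHoch k R M q f) =
      (embHoch k R M p f).comp (hochMap (algebraMap (LC k) R) M θ) := by
    apply HochGroup.hom_ext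
    intro x
    rw [AddMonoidHom.comp_apply, AddMonoidHom.comp_apply, embHoch_mk, hochMap_mk, hochMap_mk,
      embHoch_mk]
    have hl : ∀ (c : LC k) (a : R) (m : M), a • c • m = c • a • m := fun c a m => by
      rw [← op_algebraMap_smul_coeff (R := R) c, smul_comm, op_algebraMap_smul_coeff]
    have hr : ∀ (c : LC k) (a : R) (m : M),
        MulOpposite.op a • c • m = c • MulOpposite.op a • m := fun c a m => by
      rw [← algebraMap_smul_coeff (R := R) c, ← smul_comm, algebraMap_smul_coeff]
    set e : LC k := LC.ind k (f.image Set.univ) with he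
    set w : Tup M R p := hochOp R M θ (embTup f x) with hw
    have hm : e • (f • x.1) = f • x.1 := by
      rw [he]
      exact (CovariantBimodule.embModule k R).ran f x.1
    have h1 : e • w.1 = w.1 := by
      change e • (seg (fun i => f • x.2 i) _ q •
        MulOpposite.op (seg (fun i => f • x.2 i) 0 (θ 0)) • (f • x.1)) =
          seg (fun i => f • x.2 i) _ q •
        MulOpposite.op (seg (fun i => f • x.2 i) 0 (θ 0)) • (f • x.1)
      rw [← hl, ← hr, hm]
    have h2 : embTup f (hochOp R M θ x) = (e • w.1, fun i => e • w.2 i) := by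
      refine Prod.ext ?_ (funext fun i => emb_smul_seg k f x.2 _ _)
      change f • (seg x.2 _ q • MulOpposite.op (seg x.2 0 (θ 0)) • x.1) = e • w.1
      rw [CovariantBimodule.emb_smul k R, CovariantBimodule.emb_op_smul k R, emb_smul_seg k,
        emb_smul_seg k, MulOpposite.op_smul, smul_assoc, smul_assoc, hl, ← mul_smul, ind_mul_self]
      rfl
    rw [h2, HochGroup.mk_idem _ (ind_mul_self _), h1]
  exact congrArg (fun g : _ →+ _ => g c) key

variable (k R M) in
/-- The operators of `C(R/𝒫(k), M)` are homomorphisms of right `Γ`-modules. -/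
noncomputable def hochLinear (θ : Fin (p + 1) →o Fin (q + 1)) :
    HochGroup (algebraMap (LC k) R) M q →ₗ[Gamᵐᵒᵖ] HochGroup (algebraMap (LC k) R) M p where
  toFun := hochMap (algebraMap (LC k) R) M θ
  map_add' := map_add _
  map_smul' A c := by
    let F : Gam →+ HochGroup (algebraMap (LC k) R) M p := AddMonoidHom.mk'
      (fun B => hochMap (algebraMap (LC k) R) M θ (MulOpposite.op B • c)) fun B C => by
        rw [MulOpposite.op_add, add_smul, map_add]
    let G : Gam →+ HochGroup (algebraMap (LC k) R) M p := AddMonoidHom.mk'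
      (fun B => MulOpposite.op B • hochMap (algebraMap (LC k) R) M θ c) fun B C => by
        rw [MulOpposite.op_add, add_smul]
    have h : F = G := by
      apply Gam.hom_ext
      intro f
      change hochMap (algebraMap (LC k) R) M θ (MulOpposite.op (Gam.U f) • c) =
        MulOpposite.op (Gam.U f) • hochMap (algebraMap (LC k) R) M θ c
      rw [op_U_smul, op_U_smul, hochMap_embHoch]
    exact congrArg (fun g : _ →+ _ => g A.unop) h

end covariant

end Tup

section

open Tup

universe w u v

variable (k : Type v) (R : Type u) (M : Type w) [CommRing k] [Ring R] [Algebra (LC k) R]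
  [DistribMulAction Emb R] [EmbBundle k R] [AddCommGroup M] [Module R M] [Module Rᵐᵒᵖ M]
  [SMulCommClass R Rᵐᵒᵖ M] [Module (LC k) M] [IsScalarTower (LC k) R M]
  [IsScalarTower (LC k) Rᵐᵒᵖ M] [DistribMulAction Emb M] [CovariantBimodule k R M]

/-- `C(R/𝒫(k), M)` as a simplicial right `Γ`-module. -/
noncomputable def hochschildGam : SimplicialObject (ModuleCat.{max w u} Gamᵐᵒᵖ) where
  obj Δ := ModuleCat.of Gamᵐᵒᵖ (HochGroup (algebraMap (LC k) R) M Δ.unop.len)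
  map θ := ModuleCat.ofHom (hochLinear k R M θ.unop.toOrderHom)
  map_id Δ := by
    apply ModuleCat.hom_ext
    apply LinearMap.toAddMonoidHom_injective
    exact hochMap_id (algebraMap (LC k) R) M
  map_comp θ η := by
    apply ModuleCat.hom_ext
    apply LinearMap.toAddMonoidHom_injective
    exact hochMap_comp (algebraMap (LC k) R) M θ.unop.toOrderHom η.unop.toOrderHom

end

section

universe v u

/-- The diagonal of a bisimplicial object. -/
def bisimplicialDiag {C : Type u} [Category.{v} C]
    (Y : SimplicialObject (SimplicialObject C)) : SimplicialObject C where
  obj Δ := (Y.obj Δ).obj Δ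
  map {Δ Δ'} θ := (Y.map θ).app Δ ≫ (Y.obj Δ').map θ
  map_id Δ := by simp
  map_comp {Δ Δ' Δ''} θ η := by simp

end

namespace Tup

section faces

variable {B N : Type*} [Ring B] [AddCommGroup N] [Module Bᵐᵒᵖ N] {n : ℕ}

theorem seg_succ' {n : ℕ} (b : Fin n → B) {s t : ℕ} (j : Fin n) (hs : s = j) (ht : t = j + 1) :
    seg b s t = b j := by
  subst hs ht
  exact seg_succ b j

theorem val_succAbove (i : Fin (n + 1)) (l : Fin (n + 1)) :
    (i.castSucc.succAbove l : ℕ) = if (l : ℕ) < i then (l : ℕ) else l + 1 := by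
  simp only [Fin.succAbove, Fin.lt_def, Fin.val_castSucc]
  split_ifs <;> simp

/-- The operator of the `i`-th coface map, `i ≤ n`, replaces `x_i ⊗ x_{i+1}` by `x_i x_{i+1}`. -/
theorem plain_face (i : Fin (n + 1)) (x : Tup N B (n + 1)) :
    plain (Fin.succAboveOrderEmb i.castSucc).toOrderHom x =
      ((rmul i.castSucc (x.2 i) x).1, fun l => (rmul i.castSucc (x.2 i) x).2 (i.succAbove l)) := by
  refine Prod.ext ?_ (funext fun l => ?_)
  · change MulOpposite.op (seg x.2 0 (i.castSucc.succAbove 0 : Fin (n + 2))) • x.1 = _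
    rw [val_succAbove]
    cases i using Fin.cases with
    | zero =>
      rw [if_neg (by simp)]
      have h : seg x.2 0 (((0 : Fin (n + 1)) : ℕ) + 1) = x.2 0 := seg_succ' x.2 0 rfl rfl
      exact congrArg (fun c => MulOpposite.op c • x.1) h
    | succ j =>
      rw [if_pos (by simp), Fin.val_zero, seg_self, MulOpposite.op_one, one_smul]
      rfl
  · change seg x.2 (i.castSucc.succAbove l.castSucc : Fin (n + 2))
      (i.castSucc.succAbove l.succ : Fin (n + 2)) = _
    rw [val_succAbove, val_succAbove]
    cases i using Fin.cases with
    | zero =>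
      rw [if_neg (by simp), if_neg (by simp)]
      exact seg_succ' x.2 l.succ (by simp) (by simp)
    | succ j =>
      change _ = Function.update x.2 j.castSucc (x.2 j.castSucc * x.2 j.succ) _
      simp only [Fin.val_succ, Fin.val_castSucc]
      rcases lt_trichotomy (l : ℕ) j with h | h | h
      · rw [if_pos (by omega), if_pos (by omega), Fin.succAbove_of_castSucc_lt _ _ (by simp [Fin.lt_def]; omega),
          Function.update_of_ne (by simp [Fin.ext_iff]; omega)]
        exact seg_succ' x.2 l.castSucc (by simp) (by simp)
      · obtain rfl : l = j := Fin.ext h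
        rw [if_pos (by omega), if_neg (by omega), Fin.succAbove_of_castSucc_lt _ _ (by simp [Fin.lt_def]),
          Function.update_self, seg_split x.2 l.castSucc (by simp) (by simp)]
        simp only [Fin.val_castSucc]
        rw [seg_self, one_mul, seg_succ' x.2 l.succ (by simp) (by simp)]
      · rw [if_neg (by omega), if_neg (by omega), Fin.succAbove_of_le_castSucc _ _ (by simp [Fin.le_def]; omega),
          Function.update_of_ne (by simp [Fin.ext_iff]; omega)]
        exact seg_succ' x.2 l.succ (by simp) (by simp)

theorem tail_face (i : Fin (n + 1)) (x : Tup N B (n + 1)) :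
    tail (Fin.succAboveOrderEmb i.castSucc).toOrderHom x = 1 := by
  apply tail_of_eq_last
  apply Fin.ext
  change ((i.castSucc.succAbove (Fin.last n) : Fin (n + 2)) : ℕ) = _
  rw [val_succAbove, if_neg (by simp; omega)]
  simp

theorem val_succAbove_last (l : Fin (n + 1)) :
    ((Fin.last (n + 1)).succAbove l : ℕ) = l := by
  rw [Fin.succAbove_last, Fin.val_castSucc]

theorem plain_face_last (x : Tup N B (n + 1)) :
    plain (Fin.succAboveOrderEmb (Fin.last (n + 1))).toOrderHom x =
      (x.1, fun l => x.2 l.castSucc) := by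
  refine Prod.ext ?_ (funext fun l => ?_)
  · change MulOpposite.op (seg x.2 0 ((Fin.last (n + 1)).succAbove 0 : Fin (n + 2))) • x.1 = _
    rw [val_succAbove_last, Fin.val_zero, seg_self, MulOpposite.op_one, one_smul]
  · exact seg_succ' x.2 l.castSucc (val_succAbove_last _) (by
      change ((Fin.last (n + 1)).succAbove l.succ : ℕ) = _
      rw [val_succAbove_last]
      simp)

theorem tail_face_last (x : Tup N B (n + 1)) :
    tail (Fin.succAboveOrderEmb (Fin.last (n + 1))).toOrderHom x = x.2 (Fin.last n) :=
  seg_succ' x.2 (Fin.last n) (val_succAbove_last _) rfl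

theorem val_predAbove (i : Fin (n + 1)) (l : Fin (n + 2)) :
    (i.predAbove l : ℕ) = if (l : ℕ) ≤ i then (l : ℕ) else l - 1 := by
  by_cases h : l ≤ i.castSucc
  · rw [Fin.predAbove_of_le_castSucc _ _ h, if_pos (by simpa [Fin.le_def] using h)]
    simp
  · rw [Fin.predAbove_of_castSucc_lt _ _ (by simpa using h), if_neg (by simpa [Fin.le_def] using h)]
    simp

/-- The operator of the `i`-th codegeneracy inserts a factor `1` behind `x_i`. -/
theorem plain_degeneracy (i : Fin (n + 1)) (x : Tup N B n) :
    plain (Fin.predAboveOrderHom i) x = (x.1, Fin.insertNth i 1 x.2) := by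
  refine Prod.ext ?_ (funext fun l => ?_)
  · change MulOpposite.op (seg x.2 0 (i.predAbove 0 : Fin (n + 1))) • x.1 = _
    rw [val_predAbove, if_pos (by simp), Fin.val_zero, seg_self, MulOpposite.op_one, one_smul]
  · change seg x.2 (i.predAbove l.castSucc : Fin (n + 1)) (i.predAbove l.succ : Fin (n + 1)) = _
    rw [val_predAbove, val_predAbove]
    simp only [Fin.val_castSucc, Fin.val_succ]
    cases l using Fin.succAboveCases i with
    | x => 
      rw [Fin.insertNth_apply_same, if_pos le_rfl, if_neg (by omega), Nat.add_sub_cancel, seg_self]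
    | p j =>
      rw [Fin.insertNth_apply_succAbove]
      by_cases h : j.castSucc < i
      · rw [Fin.succAbove_of_castSucc_lt _ _ h]
        rw [Fin.lt_def, Fin.val_castSucc] at h
        exact seg_succ' x.2 j (by simp; omega) (by simp; omega)
      · rw [Fin.succAbove_of_le_castSucc _ _ (not_lt.1 h)]
        rw [Fin.lt_def, Fin.val_castSucc] at h
        exact seg_succ' x.2 j (by simp; omega) (by simp; omega)

theorem tail_degeneracy (i : Fin (n + 1)) (x : Tup N B n) :
    tail (Fin.predAboveOrderHom i) x = 1 := by
  apply tail_of_eq_last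
  apply Fin.ext
  change ((i.predAbove (Fin.last (n + 1)) : Fin (n + 1)) : ℕ) = _
  rw [val_predAbove, if_neg (by simp; omega)]
  simp

end faces

section hochFaces

variable {A B N : Type*} [Ring A] [Ring B] [AddCommGroup N] [Module B N] [Module Bᵐᵒᵖ N] {n : ℕ}

theorem hochOp_face [SMulCommClass B Bᵐᵒᵖ N] (i : Fin (n + 1)) (x : Tup N B (n + 1)) :
    hochOp B N (Fin.succAboveOrderEmb i.castSucc).toOrderHom x =
      ((rmul i.castSucc (x.2 i) x).1, fun l => (rmul i.castSucc (x.2 i) x).2 (i.succAbove l)) := by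
  unfold hochOp
  rw [tail_face, plain_face]
  unfold lmulZero
  rw [one_smul]

theorem hochOp_face_last [SMulCommClass B Bᵐᵒᵖ N] (x : Tup N B (n + 1)) :
    hochOp B N (Fin.succAboveOrderEmb (Fin.last (n + 1))).toOrderHom x =
      (x.2 (Fin.last n) • x.1, fun l => x.2 l.castSucc) := by
  unfold hochOp
  rw [tail_face_last, plain_face_last]
  rfl

theorem hochOp_degeneracy [SMulCommClass B Bᵐᵒᵖ N] (i : Fin (n + 1)) (x : Tup N B n) :
    hochOp B N (Fin.predAboveOrderHom i) x = (x.1, Fin.insertNth i 1 x.2) := by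
  unfold hochOp
  rw [tail_degeneracy, plain_degeneracy]
  unfold lmulZero
  rw [one_smul]

end hochFaces

section barFaces

variable {A B N : Type*} [Ring A] [Ring B] [AddCommGroup N] [Module Bᵐᵒᵖ N] {n : ℕ} [Module B A]
  (E : AugmentedAlgebra A B)

theorem barOp_face (i : Fin (n + 1)) (x : Tup N B (n + 1)) :
    E.barOp (Fin.succAboveOrderEmb i.castSucc).toOrderHom x =
      ((rmul i.castSucc (x.2 i) x).1, fun l => (rmul i.castSucc (x.2 i) x).2 (i.succAbove l)) := by
  unfold AugmentedAlgebra.barOp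
  rw [tail_face, plain_face, E.aug_one, map_one, rmul_one]

theorem barOp_face_last (x : Tup N B (n + 1)) :
    E.barOp (Fin.succAboveOrderEmb (Fin.last (n + 1))).toOrderHom x =
      rmul (Fin.last n) (E.incl (E.aug (x.2 (Fin.last n)))) (x.1, fun l => x.2 l.castSucc) := by
  unfold AugmentedAlgebra.barOp
  rw [tail_face_last, plain_face_last]

theorem barOp_degeneracy (i : Fin (n + 1)) (x : Tup N B n) :
    E.barOp (Fin.predAboveOrderHom i) x = (x.1, Fin.insertNth i 1 x.2) := by
  unfold AugmentedAlgebra.barOp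
  rw [tail_degeneracy, plain_degeneracy, E.aug_one, map_one, rmul_one]

end barFaces

end Tup

section

universe w u v

variable (k : Type v) (R : Type u) (M : Type w) [CommRing k] [Ring R] [Algebra (LC k) R]
  [DistribMulAction Emb R] [EmbBundle k R] [AddCommGroup M] [Module R M] [Module Rᵐᵒᵖ M]
  [SMulCommClass R Rᵐᵒᵖ M] [Module (LC k) M] [IsScalarTower (LC k) R M]
  [IsScalarTower (LC k) Rᵐᵒᵖ M] [DistribMulAction Emb M] [CovariantBimodule k R M]

/-- The bisimplicial abelian group `⊥(Γ/𝒫, C(R/𝒫(k), M))`. -/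
noncomputable def perpHochschild : SimplicialObject (SimplicialObject AddCommGrpCat.{max w u}) :=
  ((SimplicialObject.whiskering _ _).obj Gam.augmented.barFunctor).obj (hochschildGam k R M)

/-- The diagonal of `⊥(Γ/𝒫, C(R/𝒫(k), M))`. -/
noncomputable abbrev diagPerpHochschild : SimplicialObject AddCommGrpCat.{max w u} :=
  bisimplicialDiag (perpHochschild k R M)

/-- `HH(R/𝒫(k), M)`, as a complex of right `Γ`-modules. -/
noncomputable abbrev hochschildGamComplex : ChainComplex (ModuleCat.{max w u} Gamᵐᵒᵖ) ℕ :=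
  (AlgebraicTopology.alternatingFaceMapComplex _).obj (hochschildGam k R M)

/-- The simplicial abelian group `C(R #_𝒫 Γ/𝒫(k), M #_𝒫 Γ)`. -/
noncomputable abbrev crossHochschild : SimplicialObject AddCommGrpCat.{max w u} :=
  hochschild (Cross.unit k R) (Cross k M)

/-- `HH(R #_𝒫 Γ/𝒫(k), M #_𝒫 Γ)`. -/
noncomputable abbrev crossHochschildComplex : ChainComplex AddCommGrpCat.{max w u} ℕ :=
  (AlgebraicTopology.alternatingFaceMapComplex _).obj (crossHochschild k R M)

variable {R M}

/-- The class of `m ⊗ a_1 ⊗ ⋯ ⊗ a_n ⊗ f_1 ⊗ ⋯ ⊗ f_n` in the diagonal of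
`⊥(Γ/𝒫, C(R/𝒫(k), M))`. -/
noncomputable def diagClass {n : ℕ} (m : M) (a : Fin n → R) (f : Fin n → Emb) :
    (diagPerpHochschild k R M).obj (op (SimplexCategory.mk n)) :=
  Tup.TensorGroup.mk Gam.augmented.incl
    ((Tup.HochGroup.mk (algebraMap (LC k) R) (m, a), fun i => Gam.U (f i)) :
      Tup (Tup.HochGroup (algebraMap (LC k) R) M n) Gam n)

/-- The class of `x_0 ⊗ ⋯ ⊗ x_n` in `C_n(R #_𝒫 Γ/𝒫(k), M #_𝒫 Γ)`. -/
noncomputable def crossClass {n : ℕ} (x : Cross k M) (y : Fin n → Cross k R) :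
    (crossHochschild k R M).obj (op (SimplexCategory.mk n)) :=
  Tup.HochGroup.mk (Cross.unit k R) ((x, y) : Tup (Cross k M) (Cross k R) n)

/-- The map `φ` is given by
`φ [m ⊗ a_1 ⊗ ⋯ ⊗ a_n ⊗ f_1 ⊗ ⋯ ⊗ f_n] =
  [(f_1 ⋯ f_n)†(m) # (f_1 ⋯ f_n)† ⊗ a_1 # f_1 ⊗ f_1†(a_2) # f_2 ⊗ ⋯ ⊗ (f_1 ⋯ f_{n-1})†(a_n) # f_n]`.
The factor with index `i : Fin n` is the one of `a_{i+1}` and `f_{i+1}`, and `Fin.partialProd f j` is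
`f_1 ⋯ f_j`. -/
def IsCrossMap (φ : diagPerpHochschild k R M ⟶ crossHochschild k R M) : Prop :=
  ∀ (n : ℕ) (m : M) (a : Fin n → R) (f : Fin n → Emb),
    φ.app (op (SimplexCategory.mk n)) (diagClass k m a f) =
      crossClass k
        (Cross.tmul k ((Fin.partialProd f (Fin.last n)).dag • m)
          (Gam.U (Fin.partialProd f (Fin.last n)).dag))
        (fun i => Cross.tmul k ((Fin.partialProd f i.castSucc).dag • a i) (Gam.U (f i)))

end

/-!
For `f_1, …, f_n` write `F_l = f_1 ⋯ f_l`. There are two parts.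

**The quasi-isomorphism `e`.** This is the Eilenberg-Zilber theorem, since `⊥(Γ/𝒫, -)` is an additive functor: the
hyperhomology is the total complex of the bisimplicial abelian group `⊥(Γ/𝒫, C(R/𝒫(k), M))`
(`AugmentedAlgebra.hyperhomologyIso`). The total complex and the complex of the diagonal are compared by the method of
acyclic models, in the category of functors on bisimplicial objects. The models are replaced by the décalage in both
directions, `L F (Y) = F(Y_{• + 1, • + 1})`, with the zeroth faces `L F ⟶ F`. In both complexes the objects are
relatively projective, the zeroth degeneracies being sections of `L ⟶ 𝟭`, and the extra structure of the décalage
contracts them. As both are `Y_{0,0}` in degree zero, `RelativeComparison.homotopyEquiv` applies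
(`EilenbergZilber.totDiagEquiv`).

**The isomorphism `φ`.** The formula for `φ` makes sense for partial injections (`Cross.shear`). In every variable `f_i`
it is additive on disjoint unions of domains, because the class of the result for the restriction of `f_i` to `A` is the
class for `f_i` with `a_0` multiplied by `χ_{F_i(A)}` (`Cross.shearHom_update`); such functions extend to `Γ`
(`Gam.exists_hom`). The recurring device is that a family of characteristic functions `e_0, …, e_n` with
`e_{i-1} x_i = x_i e_i` can be moved through `x_0 ⊗ ⋯ ⊗ x_n` and absorbed by each factor (`Tup.Balanced.rmul_shift`,
`Tup.Balanced.congr_of_rmul`); it gives the compatibility with all simplicial operators as well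
(`Cross.mk_shear_pull`).

The inverse maps `m # g ⊗ b_1 # f_1 ⊗ ⋯ ⊗ b_n # f_n` to the class of
`χ F_n(m) ⊗ b_1 ⊗ F_1(b_2) ⊗ ⋯ ⊗ F_{n-1}(b_n) ⊗ f_1 ⊗ ⋯ ⊗ f_n`, where `χ` is the characteristic function of the set of
fixed points of `F_n g`. That it is inverse to `φ` on one side is a calculation. On the other side it means that only the
fixed points of `h = F_n g` contribute to the class of `m # g ⊗ b_1 # f_1 ⊗ ⋯ ⊗ b_n # f_n` (`Cross.pureClass_fix`).
A characteristic function `χ_A` moved once around the cycle becomes `χ` of the image of `A` under `h†`; so the part over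
`A` vanishes when `A` is disjoint from this image. The complement of the fixed points is the union of three such sets,
as the graph of a partial injection has a proper colouring by three colours (`Emb.exists_coloring`).
-/

open Tup

/-! ### Comparison of complexes of models -/

namespace RelativeComparison

universe v u

variable {V : Type u} [Category.{v} V] [Preadditive V] {L : V ⥤ V} [L.Additive] (ε : L ⟶ 𝟭 V)

/-- The component of `ε` at `X`, with target `X`. -/
def component (X : V) : L.obj X ⟶ X := ε.app X

theorem component_naturality {X Y : V} (f : X ⟶ Y) :
    L.map f ≫ component ε Y = component ε X ≫ f := ε.naturality f

/-- Sections of `L (P_n) ⟶ P_n`: the objects of `P` are relatively projective with respect to `ε : L ⟶ 𝟭`. No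
compatibility with the differential is required. -/
structure Sections (P : ChainComplex V ℕ) where
  s : ∀ n, P.X n ⟶ L.obj (P.X n)
  s_ε : ∀ n, s n ≫ component ε (P.X n) = 𝟙 _

/-- A homotopy `t` from `ε : L Q ⟶ Q` to the map that is `κ` in degree zero and zero in positive degrees. It takes
values in `Q`, so that a map to `Q_n` with vanishing boundary lifts along the differential after application of `L`. -/
structure Contraction (Q : ChainComplex V ℕ) where
  κ : L.obj (Q.X 0) ⟶ Q.X 0
  t : ∀ n, L.obj (Q.X n) ⟶ Q.X (n + 1)
  t_zero : t 0 ≫ Q.d 1 0 = component ε (Q.X 0) - κ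
  t_succ : ∀ n, t (n + 1) ≫ Q.d (n + 2) (n + 1) = component ε (Q.X (n + 1)) - L.map (Q.d (n + 1) n) ≫ t n

variable {ε} {P Q : ChainComplex V ℕ} (S : Sections ε P) (K : Contraction ε Q)

/-- The components of the extension of `f` to a chain map: `s`, followed by `L` of what they have to bound, and `t`. -/
def liftComponent (f : P.X 0 ⟶ Q.X 0) : ∀ n, P.X n ⟶ Q.X n
  | 0 => f
  | n + 1 => S.s (n + 1) ≫ L.map (P.d (n + 1) n ≫ liftComponent f n) ≫ K.t n

theorem liftComponent_comm (f : P.X 0 ⟶ Q.X 0) (hf : L.map (P.d 1 0 ≫ f) ≫ K.κ = 0) (n : ℕ) :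
    liftComponent S K f (n + 1) ≫ Q.d (n + 1) n = P.d (n + 1) n ≫ liftComponent S K f n := by
  have key : ∀ (n : ℕ) (g : P.X (n + 1) ⟶ Q.X n),
      (S.s (n + 1) ≫ L.map g) ≫ component ε (Q.X n) = g := fun n g => by
    rw [Category.assoc, component_naturality, ← Category.assoc, S.s_ε, Category.id_comp]
  induction n with
  | zero =>
    simp only [liftComponent, Category.assoc]
    rw [K.t_zero, Preadditive.comp_sub, hf, sub_zero, ← Category.assoc, key]
  | succ n ih =>
    have h0 : L.map (P.d (n + 2) (n + 1) ≫ liftComponent S K f (n + 1)) ≫ L.map (Q.d (n + 1) n) = 0 := by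
      rw [← L.map_comp, Category.assoc, ih, P.d_comp_d_assoc, Limits.zero_comp, L.map_zero]
    change (S.s (n + 2) ≫ L.map (P.d (n + 2) (n + 1) ≫ liftComponent S K f (n + 1)) ≫ K.t (n + 1)) ≫ _ = _
    rw [Category.assoc, Category.assoc, K.t_succ, Preadditive.comp_sub, reassoc_of% h0, Limits.zero_comp, sub_zero,
      ← Category.assoc, key]

/-- The extension of `f` to a chain map. -/
def lift (f : P.X 0 ⟶ Q.X 0) (hf : L.map (P.d 1 0 ≫ f) ≫ K.κ = 0) : P ⟶ Q where
  f := liftComponent S K f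
  comm' i j h := by
    obtain rfl : j + 1 = i := h
    exact liftComponent_comm S K f hf j

/-- The components of a homotopy between chain maps that agree in degree zero. -/
def homotopyComponent (u v : P ⟶ Q) : ∀ n, P.X n ⟶ Q.X (n + 1)
  | 0 => 0
  | n + 1 => S.s (n + 1) ≫
      L.map (u.f (n + 1) - v.f (n + 1) - P.d (n + 1) n ≫ homotopyComponent u v n) ≫ K.t (n + 1)

theorem homotopyComponent_comm (u v : P ⟶ Q) (h : u.f 0 = v.f 0) (n : ℕ) :
    homotopyComponent S K u v (n + 1) ≫ Q.d (n + 2) (n + 1) =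
      u.f (n + 1) - v.f (n + 1) - P.d (n + 1) n ≫ homotopyComponent S K u v n := by
  have key : ∀ (n : ℕ) (g : P.X (n + 1) ⟶ Q.X (n + 1)), g ≫ Q.d (n + 1) n = 0 →
      (S.s (n + 1) ≫ L.map g ≫ K.t (n + 1)) ≫ Q.d (n + 2) (n + 1) = g := fun n g hg => by
    have h0 : L.map g ≫ L.map (Q.d (n + 1) n) = 0 := by rw [← L.map_comp, hg, L.map_zero]
    rw [Category.assoc, Category.assoc, K.t_succ, Preadditive.comp_sub, reassoc_of% h0, Limits.zero_comp, sub_zero,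
      component_naturality, ← Category.assoc, S.s_ε, Category.id_comp]
  induction n with
  | zero =>
    apply key
    simp only [homotopyComponent, Limits.comp_zero, sub_zero, Preadditive.sub_comp, u.comm, v.comm, h, sub_self]
  | succ n ih =>
    apply key
    rw [Preadditive.sub_comp, Preadditive.sub_comp, Category.assoc, ih, u.comm, v.comm, Preadditive.comp_sub,
      Preadditive.comp_sub, P.d_comp_d_assoc, Limits.zero_comp, sub_zero, sub_self]

/-- Chain maps that agree in degree zero are homotopic. -/
def homotopy (u v : P ⟶ Q) (h : u.f 0 = v.f 0) : Homotopy u v where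
  hom i j := if hij : i + 1 = j then homotopyComponent S K u v i ≫ (Q.XIsoOfEq hij).hom else 0
  zero i j hij := dif_neg hij
  comm i := by
    cases i with
    | zero =>
      rw [dNext_eq_zero _ _ (by simp), prevD_eq _ (show (ComplexShape.down ℕ).Rel 1 0 by simp)]
      simp [homotopyComponent, h]
    | succ n =>
      rw [dNext_eq _ (show (ComplexShape.down ℕ).Rel (n + 1) n by simp),
        prevD_eq _ (show (ComplexShape.down ℕ).Rel (n + 2) (n + 1) by simp)]
      simp only [dif_pos, HomologicalComplex.XIsoOfEq_rfl, Iso.refl_hom, Category.comp_id]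
      rw [homotopyComponent_comm S K u v h]
      abel

/-- Two complexes of models with isomorphic objects in degree zero are homotopy equivalent. -/
def homotopyEquiv (S : Sections ε P) (S' : Sections ε Q) (K : Contraction ε P) (K' : Contraction ε Q)
    (f : P.X 0 ≅ Q.X 0) (h : L.map (P.d 1 0 ≫ f.hom) ≫ K'.κ = 0)
    (h' : L.map (Q.d 1 0 ≫ f.inv) ≫ K.κ = 0) : HomotopyEquiv P Q where
  hom := lift S K' f.hom h
  inv := lift S' K f.inv h'
  homotopyHomInvId := homotopy S K _ _ f.hom_inv_id
  homotopyInvHomId := homotopy S' K' _ _ f.inv_hom_id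

end RelativeComparison

/-! ### Décalage -/

namespace SimplexCategory

/-- The functor `[n] ↦ [n + 1]` that adjoins a new least element. -/
def shift : SimplexCategory ⥤ SimplexCategory where
  obj a := mk (a.len + 1)
  map {a b} f := mkHom
    { toFun := Fin.cases 0 fun i => (f.toOrderHom i).succ
      monotone' := by
        intro i j h
        cases i using Fin.cases with
        | zero => exact Fin.zero_le _
        | succ i =>
          cases j using Fin.cases with
          | zero => exact absurd h (by simp)
          | succ j => exact Fin.succ_le_succ_iff.2 (f.toOrderHom.monotone (Fin.succ_le_succ_iff.1 h)) }
  map_id a := by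
    ext i : 3
    cases i using Fin.cases <;> rfl
  map_comp f g := by
    ext i : 3
    cases i using Fin.cases <;> rfl

/-- The inclusion `[n] → [n + 1]` that misses the new least element. -/
def shiftInclusion : 𝟭 SimplexCategory ⟶ shift where
  app a := δ (n := a.len) 0
  naturality a b f := by
    ext i : 3
    rfl

theorem shift_map_δ {n : ℕ} (i : Fin (n + 2)) : shift.map (δ i) = δ (n := n + 1) i.succ := by
  ext j : 3
  cases j using Fin.cases with
  | zero => exact (Fin.succ_succAbove_zero i).symm
  | succ j => exact (Fin.succ_succAbove_succ i j).symm

end SimplexCategory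

namespace EilenbergZilber

open SimplexCategory

universe v u

variable {C : Type u} [Category.{v} C]

/-- The simultaneous décalage `(p, q) ↦ Y_{p + 1, q + 1}` of a bisimplicial object in both directions. -/
def bidec : SimplicialObject (SimplicialObject C) ⥤ SimplicialObject (SimplicialObject C) where
  obj Y := shift.op ⋙ Y ⋙ (Functor.whiskeringLeft _ _ C).obj shift.op
  map f := Functor.whiskerLeft shift.op (Functor.whiskerRight f ((Functor.whiskeringLeft _ _ C).obj shift.op))

variable (C) in
/-- The object of bidegree `(a, b)` of a bisimplicial object, as a functor. -/
def ev (a b : SimplexCategory) : SimplicialObject (SimplicialObject C) ⥤ C where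
  obj Y := (Y.obj (op a)).obj (op b)
  map f := (f.app (op a)).app (op b)

/-- The operator of a bisimplicial object determined by a pair of monotone maps. -/
def evMap {a b c d : SimplexCategory} (θ : a ⟶ c) (η : b ⟶ d) : ev C c d ⟶ ev C a b where
  app Y := (Y.map θ.op).app (op d) ≫ (Y.obj (op a)).map η.op
  naturality Y Z f := by
    have h := congrArg (fun g => NatTrans.app g (op d)) (f.naturality θ.op)
    have h' := (f.app (op a)).naturality η.op
    simp only [NatTrans.comp_app] at h
    change (f.app (op c)).app (op d) ≫ (Z.map θ.op).app (op d) ≫ (Z.obj (op a)).map η.op =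
      ((Y.map θ.op).app (op d) ≫ (Y.obj (op a)).map η.op) ≫ (f.app (op a)).app (op b)
    rw [Category.assoc, h', ← reassoc_of% h]

theorem evMap_comp {a b c d a' b' : SimplexCategory} (θ : a ⟶ c) (η : b ⟶ d) (θ' : a' ⟶ a) (η' : b' ⟶ b) :
    (evMap θ η : ev C c d ⟶ _) ≫ evMap θ' η' = evMap (θ' ≫ θ) (η' ≫ η) := by
  ext Y
  change ((Y.map θ.op).app (op d) ≫ (Y.obj (op a)).map η.op) ≫ (Y.map θ'.op).app (op b) ≫ (Y.obj (op a')).map η'.op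
    = (Y.map (θ' ≫ θ).op).app (op d) ≫ (Y.obj (op a')).map (η' ≫ η).op
  rw [op_comp, op_comp, Functor.map_comp, Functor.map_comp, NatTrans.comp_app, Category.assoc, Category.assoc,
    (Y.map θ'.op).naturality_assoc]

theorem evMap_comp_assoc {a b c d a' b' : SimplexCategory} (θ : a ⟶ c) (η : b ⟶ d) (θ' : a' ⟶ a) (η' : b' ⟶ b)
    {F : SimplicialObject (SimplicialObject C) ⥤ C} (g : ev C a' b' ⟶ F) :
    (evMap θ η : ev C c d ⟶ _) ≫ evMap θ' η' ≫ g = evMap (θ' ≫ θ) (η' ≫ η) ≫ g := by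
  rw [← Category.assoc, evMap_comp]

theorem evMap_id (a b : SimplexCategory) : (evMap (𝟙 a) (𝟙 b) : ev C a b ⟶ _) = 𝟙 _ := by
  ext Y
  change (Y.map (𝟙 _)).app _ ≫ (Y.obj _).map (𝟙 _) = 𝟙 _
  rw [CategoryTheory.Functor.map_id, CategoryTheory.Functor.map_id]
  exact Category.id_comp _

theorem evMap_id_left {a b d : SimplexCategory} (η : b ⟶ d) (Y : SimplicialObject (SimplicialObject C)) :
    (evMap (𝟙 a) η).app Y = (Y.obj (op a)).map η.op := by
  change (Y.map (𝟙 _)).app _ ≫ _ = _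
  rw [CategoryTheory.Functor.map_id]
  exact Category.id_comp _

theorem evMap_id_right {a b c : SimplexCategory} (θ : a ⟶ c) (Y : SimplicialObject (SimplicialObject C)) :
    (evMap θ (𝟙 b)).app Y = (Y.map θ.op).app (op b) := by
  change _ ≫ (Y.obj _).map (𝟙 _) = _
  rw [CategoryTheory.Functor.map_id]
  exact Category.comp_id _

/-- The natural map `Y_{p + 1, q + 1} → Y_{p, q}` given by the zeroth faces. -/
def bidecCounit : bidec (C := C) ⟶ 𝟭 _ where
  app Y :=
    { app := fun a =>
        { app := fun b => (evMap (shiftInclusion.app a.unop) (shiftInclusion.app b.unop)).app Y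
          naturality := fun b b' η => by
            have h : (evMap (𝟙 (shift.obj a.unop)) (shift.map η.unop) : ev C _ _ ⟶ _) ≫
                evMap (shiftInclusion.app a.unop) (shiftInclusion.app b'.unop) =
                evMap (shiftInclusion.app a.unop) (shiftInclusion.app b.unop) ≫ evMap (𝟙 _) η.unop := by
              rw [evMap_comp, evMap_comp, ← shiftInclusion.naturality]
              rfl
            have h' := NatTrans.congr_app h Y
            rw [NatTrans.comp_app, NatTrans.comp_app, evMap_id_left, evMap_id_left] at h'
            exact h' }
      naturality := fun a a' θ => by
        apply NatTrans.ext
        funext b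
        have h : (evMap (shift.map θ.unop) (𝟙 (shift.obj b.unop)) : ev C _ _ ⟶ _) ≫
            evMap (shiftInclusion.app a'.unop) (shiftInclusion.app b.unop) =
            evMap (shiftInclusion.app a.unop) (shiftInclusion.app b.unop) ≫ evMap θ.unop (𝟙 _) := by
          rw [evMap_comp, evMap_comp, ← shiftInclusion.naturality]
          rfl
        have h' := NatTrans.congr_app h Y
        rw [NatTrans.comp_app, NatTrans.comp_app, evMap_id_right, evMap_id_right] at h'
        exact h' }
  naturality Y Z f := by
    apply NatTrans.ext
    funext a
    apply NatTrans.ext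
    funext b
    exact (evMap (shiftInclusion.app a.unop) (shiftInclusion.app b.unop)).naturality f

variable (C) in
/-- Precomposition with the décalage. -/
abbrev decFunctor : (SimplicialObject (SimplicialObject C) ⥤ C) ⥤ (SimplicialObject (SimplicialObject C) ⥤ C) :=
  (Functor.whiskeringLeft _ _ C).obj bidec

variable (C) in
/-- The transformation `F (bidec Y) → F Y`. -/
def decCounit : decFunctor C ⟶ 𝟭 _ where
  app F := Functor.whiskerRight bidecCounit F
  naturality F G f := by
    ext Y
    exact (f.naturality (bidecCounit.app Y)).symm

theorem decFunctor_evMap {a b c d : SimplexCategory} (θ : a ⟶ c) (η : b ⟶ d) :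
    (decFunctor C).map (evMap θ η) = evMap (shift.map θ) (shift.map η) := rfl

variable [Preadditive C]

instance : (decFunctor C).Additive where

/-- A functor to chain complexes as a chain complex of functors. -/
def complexOfFunctor {B : Type*} [Category* B] (F : B ⥤ ChainComplex C ℕ) : ChainComplex (B ⥤ C) ℕ where
  X n := F ⋙ HomologicalComplex.eval _ _ n
  d i j := { app := fun Y => (F.obj Y).d i j
             naturality := fun _ _ f => (F.map f).comm i j }
  shape i j h := by
    ext Y
    exact (F.obj Y).shape i j h
  d_comp_d' i j k _ _ := by
    ext Y
    exact (F.obj Y).d_comp_d i j k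

/-! ### The diagonal -/

variable (C) in
/-- The diagonal, as a functor. -/
def diagFunctor : SimplicialObject (SimplicialObject C) ⥤ SimplicialObject C where
  obj := bisimplicialDiag
  map {Y Z} f :=
    { app := fun a => (f.app a).app a
      naturality := fun a b θ => ((evMap θ.unop θ.unop).naturality f).symm }

variable (C) in
/-- The chain complex of the diagonal. -/
noncomputable def diagComplex : ChainComplex (SimplicialObject (SimplicialObject C) ⥤ C) ℕ :=
  complexOfFunctor (diagFunctor C ⋙ AlgebraicTopology.alternatingFaceMapComplex C)

theorem diagComplex_d (n : ℕ) : (diagComplex C).d (n + 1) n =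
    ∑ i : Fin (n + 2), (-1 : ℤ) ^ (i : ℕ) • (evMap (δ i) (δ i) : ev C (mk (n + 1)) (mk (n + 1)) ⟶ ev C (mk n) (mk n)) := by
  ext Y
  rw [NatTrans.app_sum]
  exact AlgebraicTopology.AlternatingFaceMapComplex.obj_d_eq _ n

variable (C) in
/-- The zeroth degeneracies are sections of the counit. -/
def diagSections : RelativeComparison.Sections (decCounit C) (diagComplex C) where
  s n := (evMap (σ 0) (σ 0) : ev C (mk n) (mk n) ⟶ ev C (mk (n + 1)) (mk (n + 1)))
  s_ε n := by
    change (evMap (σ 0) (σ 0) : ev C (mk n) (mk n) ⟶ ev C (mk (n + 1)) (mk (n + 1))) ≫ evMap (δ 0) (δ 0) = 𝟙 _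
    have h : δ (0 : Fin (n + 2)) ≫ σ 0 = 𝟙 _ := δ_comp_σ_self (i := (0 : Fin (n + 1)))
    rw [evMap_comp, h, evMap_id]

variable (C) in
/-- The chain complex of the diagonal of `bidec Y` is that of `Y` without the zeroth faces. -/
def diagContraction : RelativeComparison.Contraction (decCounit C) (diagComplex C) where
  κ := (evMap (δ 1) (δ 1) : ev C (mk 1) (mk 1) ⟶ ev C (mk 0) (mk 0))
  t n := 𝟙 (ev C (mk (n + 1)) (mk (n + 1)))
  t_zero := by
    rw [diagComplex_d]
    refine (Category.id_comp _).trans ?_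
    rw [Fin.sum_univ_two]
    exact (congrArg₂ (· + ·) (one_smul ℤ _) (neg_one_zsmul _)).trans (sub_eq_add_neg _ _).symm
  t_succ n := by
    have h : (decFunctor C).map ((diagComplex C).d (n + 1) n) = ∑ i : Fin (n + 2), (-1 : ℤ) ^ (i : ℕ) •
        (evMap (δ i.succ) (δ i.succ) : ev C (mk (n + 2)) (mk (n + 2)) ⟶ ev C (mk (n + 1)) (mk (n + 1))) := by
      rw [diagComplex_d]
      refine ((decFunctor C).map_sum _ _).trans (Finset.sum_congr rfl fun i _ => ?_)
      refine (decFunctor C).map_zsmul.trans ?_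
      refine congrArg _ ((decFunctor_evMap _ _).trans ?_)
      rw [shift_map_δ]
      rfl
    rw [diagComplex_d]
    refine (Category.id_comp _).trans ?_
    refine Eq.trans ?_ (congrArg (fun x => _ - x) (Category.comp_id _).symm)
    rw [Fin.sum_univ_succ, h]
    refine Eq.trans ?_ (sub_eq_add_neg _ _).symm
    refine congrArg₂ (· + ·) (one_smul ℤ _) ?_
    refine Eq.trans (Finset.sum_congr rfl fun i _ => ?_) (Finset.sum_neg_distrib _)
    rw [Fin.val_succ, pow_succ, mul_neg_one, neg_smul]

end EilenbergZilber

/-! ### The total complex -/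

namespace HomologicalComplex₂

variable {C : Type*} [Category* C] [Preadditive C]
  (K : HomologicalComplex₂ C (ComplexShape.down ℕ) (ComplexShape.down ℕ)) [K.HasTotal (ComplexShape.down ℕ)]

theorem ιTotal_d_eq (p q n n' : ℕ) (h : p + q = n) :
    K.ιTotal (ComplexShape.down ℕ) p q n h ≫ (K.total (ComplexShape.down ℕ)).d n n' =
      K.d₁ (ComplexShape.down ℕ) p q n' + K.d₂ (ComplexShape.down ℕ) p q n' := by
  rw [total_d, Preadditive.comp_add, ι_D₁, ι_D₂]

theorem d₁_succ (p q n : ℕ) (h : p + q = n) : K.d₁ (ComplexShape.down ℕ) (p + 1) q n =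
    (K.d (p + 1) p).f q ≫ K.ιTotal (ComplexShape.down ℕ) p q n h :=
  (K.d₁_eq _ (show (ComplexShape.down ℕ).Rel (p + 1) p from rfl) _ n h).trans (one_smul _ _)

theorem d₂_succ (p q n : ℕ) (h : p + q = n) : K.d₂ (ComplexShape.down ℕ) p (q + 1) n =
    (-1 : ℤ) ^ p • ((K.X p).d (q + 1) q ≫ K.ιTotal (ComplexShape.down ℕ) p q n h) := by
  refine (K.d₂_eq _ _ (show (ComplexShape.down ℕ).Rel (q + 1) q from rfl) n h).trans ?_
  rw [Units.smul_def]
  congr 1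

theorem d₁_zero (q n : ℕ) : K.d₁ (ComplexShape.down ℕ) 0 q n = 0 :=
  K.d₁_eq_zero _ _ _ _ (by simp)

theorem d₂_zero (p n : ℕ) : K.d₂ (ComplexShape.down ℕ) p 0 n = 0 :=
  K.d₂_eq_zero _ _ _ _ (by simp)

end HomologicalComplex₂

namespace EilenbergZilber

open SimplexCategory

universe v u

variable {C : Type u} [Category.{v} C] [Preadditive C]

variable (C) in
/-- The double complex of a bisimplicial object. -/
noncomputable def doubleComplex : SimplicialObject (SimplicialObject C) ⥤
    HomologicalComplex₂ C (ComplexShape.down ℕ) (ComplexShape.down ℕ) :=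
  AlgebraicTopology.alternatingFaceMapComplex (SimplicialObject C) ⋙
    (AlgebraicTopology.alternatingFaceMapComplex C).mapHomologicalComplex _

variable (C) in
/-- The differential in the first direction. -/
noncomputable def hface (p : ℕ) (b : SimplexCategory) : ev C (mk (p + 1)) b ⟶ ev C (mk p) b :=
  ∑ i : Fin (p + 2), (-1 : ℤ) ^ (i : ℕ) • evMap (δ i) (𝟙 b)

variable (C) in
/-- The differential in the second direction. -/
noncomputable def vface (a : SimplexCategory) (q : ℕ) : ev C a (mk (q + 1)) ⟶ ev C a (mk q) :=
  ∑ i : Fin (q + 2), (-1 : ℤ) ^ (i : ℕ) • evMap (𝟙 a) (δ i)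

theorem hface_app (p q : ℕ) (Y : SimplicialObject (SimplicialObject C)) :
    (((doubleComplex C).obj Y).d (p + 1) p).f q = (hface C p (mk q)).app Y := by
  have h : ((AlgebraicTopology.alternatingFaceMapComplex (SimplicialObject C)).obj Y).d (p + 1) p =
      ∑ i : Fin (p + 2), (-1 : ℤ) ^ (i : ℕ) • Y.δ i := AlgebraicTopology.AlternatingFaceMapComplex.obj_d_eq _ p
  change (((AlgebraicTopology.alternatingFaceMapComplex (SimplicialObject C)).obj Y).d (p + 1) p).app (op (mk q)) = _
  rw [h, hface, NatTrans.app_sum, NatTrans.app_sum]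
  refine Finset.sum_congr rfl fun i _ => ?_
  refine congrArg (fun x => (-1 : ℤ) ^ (i : ℕ) • x) (evMap_id_right (δ i) Y).symm

theorem vface_app (p q : ℕ) (Y : SimplicialObject (SimplicialObject C)) :
    (((doubleComplex C).obj Y).X p).d (q + 1) q = (vface C (mk p) q).app Y := by
  have h : ((AlgebraicTopology.alternatingFaceMapComplex C).obj (Y.obj (op (mk p)))).d (q + 1) q =
      ∑ i : Fin (q + 2), (-1 : ℤ) ^ (i : ℕ) • (Y.obj (op (mk p))).δ i :=
    AlgebraicTopology.AlternatingFaceMapComplex.obj_d_eq _ q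
  change ((AlgebraicTopology.alternatingFaceMapComplex C).obj (Y.obj (op (mk p)))).d (q + 1) q = _
  rw [h, vface, NatTrans.app_sum]
  refine Finset.sum_congr rfl fun i _ => ?_
  refine congrArg (fun x => (-1 : ℤ) ^ (i : ℕ) • x) (evMap_id_left (δ i) Y).symm

variable [Limits.HasCoproducts.{0} C]

variable (C) in
/-- The total complex of a bisimplicial object, as a complex of functors. -/
noncomputable def totComplex : ChainComplex (SimplicialObject (SimplicialObject C) ⥤ C) ℕ :=
  complexOfFunctor (doubleComplex C ⋙ HomologicalComplex₂.totalFunctor C _ _ (ComplexShape.down ℕ))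

variable (C) in
/-- The inclusion of a summand in the total complex. -/
noncomputable def totι (p q n : ℕ) (h : p + q = n) : ev C (mk p) (mk q) ⟶ (totComplex C).X n where
  app Y := ((doubleComplex C).obj Y).ιTotal (ComplexShape.down ℕ) p q n h
  naturality _ _ f := (HomologicalComplex₂.ιTotal_map _ _ ((doubleComplex C).map f) (ComplexShape.down ℕ) p q n h).symm

/-- Morphisms out of the total complex of the bisimplicial objects `W Y`. -/
noncomputable def totDesc (W : SimplicialObject (SimplicialObject C) ⥤ SimplicialObject (SimplicialObject C))
    {G : SimplicialObject (SimplicialObject C) ⥤ C} {n : ℕ}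
    (f : ∀ p q : ℕ, p + q = n → (W ⋙ ev C (mk p) (mk q) ⟶ G)) : W ⋙ (totComplex C).X n ⟶ G where
  app Y := ((doubleComplex C).obj (W.obj Y)).totalDesc fun p q h => (f p q h).app Y
  naturality Y Z g := by
    apply HomologicalComplex₂.total.hom_ext
    intro p q h
    have h1 := ((totι C p q n h).naturality (W.map g))
    have h2 := (f p q h).naturality g
    have h3 : ∀ Y, (totι C p q n h).app (W.obj Y) ≫
        ((doubleComplex C).obj (W.obj Y)).totalDesc (fun p q h => (f p q h).app Y) = (f p q h).app Y := fun Y =>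
      HomologicalComplex₂.ι_totalDesc _ _ _ _ _
    change (totι C p q n h).app (W.obj Y) ≫ ((totComplex C).X n).map (W.map g) ≫ _ =
      (totι C p q n h).app (W.obj Y) ≫ _ ≫ G.map g
    calc _ = ((totι C p q n h).app (W.obj Y) ≫ ((totComplex C).X n).map (W.map g)) ≫ _ := (Category.assoc _ _ _).symm
      _ = ((ev C (mk p) (mk q)).map (W.map g) ≫ (totι C p q n h).app (W.obj Z)) ≫
        ((doubleComplex C).obj (W.obj Z)).totalDesc (fun p q h => (f p q h).app Z) := congrArg (· ≫ _) h1.symm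
      _ = (ev C (mk p) (mk q)).map (W.map g) ≫ (f p q h).app Z :=
        (Category.assoc _ _ _).trans (congrArg (_ ≫ ·) (h3 Z))
      _ = (f p q h).app Y ≫ G.map g := h2
      _ = _ := (congrArg (· ≫ G.map g) (h3 Y)).symm.trans (Category.assoc _ _ _)

theorem totι_totDesc (W : SimplicialObject (SimplicialObject C) ⥤ SimplicialObject (SimplicialObject C))
    {G : SimplicialObject (SimplicialObject C) ⥤ C} {n : ℕ}
    (f : ∀ p q : ℕ, p + q = n → (W ⋙ ev C (mk p) (mk q) ⟶ G)) (p q : ℕ) (h : p + q = n) :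
    Functor.whiskerLeft W (totι C p q n h) ≫ totDesc W f = f p q h := by
  apply NatTrans.ext
  funext Y
  exact ((doubleComplex C).obj (W.obj Y)).ι_totalDesc (fun p q h => (f p q h).app Y) p q h

theorem tot_hom_ext {W : SimplicialObject (SimplicialObject C) ⥤ SimplicialObject (SimplicialObject C)}
    {G : SimplicialObject (SimplicialObject C) ⥤ C} {n : ℕ} {f g : W ⋙ (totComplex C).X n ⟶ G}
    (h : ∀ (p q : ℕ) (h : p + q = n), Functor.whiskerLeft W (totι C p q n h) ≫ f =
      Functor.whiskerLeft W (totι C p q n h) ≫ g) : f = g := by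
  ext Y
  apply HomologicalComplex₂.total.hom_ext
  intro p q hpq
  exact NatTrans.congr_app (h p q hpq) Y

variable (C) in
/-- The differential of the total complex in the first direction, at the summand `(p, q)`. -/
noncomputable def totD₁ (p q n : ℕ) (h : p + q = n + 1) : ev C (mk p) (mk q) ⟶ (totComplex C).X n :=
  match p, h with
  | 0, _ => 0
  | p + 1, h => hface C p (mk q) ≫ totι C p q n (by omega)

variable (C) in
/-- The differential of the total complex in the second direction, at the summand `(p, q)`, with its sign. -/
noncomputable def totD₂ (p q n : ℕ) (h : p + q = n + 1) : ev C (mk p) (mk q) ⟶ (totComplex C).X n :=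
  match q, h with
  | 0, _ => 0
  | q + 1, h => (-1 : ℤ) ^ p • (vface C (mk p) q ≫ totι C p q n (by omega))

theorem totι_d (p q n : ℕ) (h : p + q = n + 1) :
    totι C p q (n + 1) h ≫ (totComplex C).d (n + 1) n = totD₁ C p q n h + totD₂ C p q n h := by
  apply NatTrans.ext
  funext Y
  refine (((doubleComplex C).obj Y).ιTotal_d_eq p q (n + 1) n h).trans ?_
  refine congrArg₂ (· + ·) ?_ ?_
  · cases p with
    | zero => exact ((doubleComplex C).obj Y).d₁_zero q n
    | succ p =>
      refine (((doubleComplex C).obj Y).d₁_succ p q n (by omega)).trans ?_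
      rw [hface_app]
      rfl
  · cases q with
    | zero => exact ((doubleComplex C).obj Y).d₂_zero p n
    | succ q =>
      refine (((doubleComplex C).obj Y).d₂_succ p q n (by omega)).trans ?_
      rw [vface_app]
      rfl

variable (C) in
/-- The faces with positive indices of the differential in the first direction; this is the differential of
the décalage. -/
noncomputable def hfacePos (p : ℕ) (b : SimplexCategory) : ev C (mk (p + 2)) b ⟶ ev C (mk (p + 1)) b :=
  ∑ i : Fin (p + 2), (-1 : ℤ) ^ (i : ℕ) • evMap (δ i.succ) (𝟙 b)

variable (C) in
/-- The faces with positive indices of the differential in the second direction. -/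
noncomputable def vfacePos (a : SimplexCategory) (q : ℕ) : ev C a (mk (q + 2)) ⟶ ev C a (mk (q + 1)) :=
  ∑ i : Fin (q + 2), (-1 : ℤ) ^ (i : ℕ) • evMap (𝟙 a) (δ i.succ)

theorem decFunctor_hface (p : ℕ) (b : SimplexCategory) :
    (decFunctor C).map (hface C p b) = hfacePos C p (shift.obj b) := by
  rw [hface, Functor.map_sum]
  refine Finset.sum_congr rfl fun i _ => ?_
  rw [Functor.map_zsmul, decFunctor_evMap, shift_map_δ, CategoryTheory.Functor.map_id]
  rfl

theorem decFunctor_vface (a : SimplexCategory) (q : ℕ) :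
    (decFunctor C).map (vface C a q) = vfacePos C (shift.obj a) q := by
  rw [vface, Functor.map_sum]
  refine Finset.sum_congr rfl fun i _ => ?_
  rw [Functor.map_zsmul, decFunctor_evMap, shift_map_δ, CategoryTheory.Functor.map_id]
  rfl

theorem hface_succ (p : ℕ) (b : SimplexCategory) :
    hface C (p + 1) b = evMap (δ 0) (𝟙 b) - hfacePos C p b := by
  rw [hface, Fin.sum_univ_succ, hfacePos, sub_eq_add_neg, ← Finset.sum_neg_distrib]
  refine congrArg₂ (· + ·) (one_smul _ _) (Finset.sum_congr rfl fun i _ => ?_)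
  rw [Fin.val_succ, pow_succ, mul_neg_one, neg_smul]

theorem vface_succ (a : SimplexCategory) (q : ℕ) :
    vface C a (q + 1) = evMap (𝟙 a) (δ 0) - vfacePos C a q := by
  rw [vface, Fin.sum_univ_succ, vfacePos, sub_eq_add_neg, ← Finset.sum_neg_distrib]
  refine congrArg₂ (· + ·) (one_smul _ _) (Finset.sum_congr rfl fun i _ => ?_)
  rw [Fin.val_succ, pow_succ, mul_neg_one, neg_smul]

theorem hface_zero (b : SimplexCategory) : hface C 0 b = evMap (δ 0) (𝟙 b) - evMap (δ 1) (𝟙 b) := by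
  rw [hface, Fin.sum_univ_two, sub_eq_add_neg]
  exact congrArg₂ (· + ·) (one_smul _ _) (neg_one_zsmul _)

theorem vface_zero (a : SimplexCategory) : vface C a 0 = evMap (𝟙 a) (δ 0) - evMap (𝟙 a) (δ 1) := by
  rw [vface, Fin.sum_univ_two, sub_eq_add_neg]
  exact congrArg₂ (· + ·) (one_smul _ _) (neg_one_zsmul _)

theorem evMap_id_hfacePos (p : ℕ) {b d : SimplexCategory} (η : b ⟶ d) :
    evMap (𝟙 _) η ≫ hfacePos C p b = hfacePos C p d ≫ evMap (𝟙 _) η := by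
  rw [hfacePos, hfacePos, Preadditive.comp_sum, Preadditive.sum_comp]
  refine Finset.sum_congr rfl fun i _ => ?_
  rw [Preadditive.comp_zsmul, Preadditive.zsmul_comp, evMap_comp, evMap_comp]
  simp

theorem evMap_id_hfacePos_assoc (p : ℕ) {b d : SimplexCategory} (η : b ⟶ d)
    {F : SimplicialObject (SimplicialObject C) ⥤ C} (g : _ ⟶ F) :
    evMap (𝟙 _) η ≫ hfacePos C p b ≫ g = hfacePos C p d ≫ evMap (𝟙 _) η ≫ g := by
  rw [← Category.assoc, evMap_id_hfacePos, Category.assoc]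

theorem evMap_vfacePos_id {a c : SimplexCategory} (θ : a ⟶ c) (q : ℕ) :
    evMap θ (𝟙 _) ≫ vfacePos C a q = vfacePos C c q ≫ evMap θ (𝟙 _) := by
  rw [vfacePos, vfacePos, Preadditive.comp_sum, Preadditive.sum_comp]
  refine Finset.sum_congr rfl fun i _ => ?_
  rw [Preadditive.comp_zsmul, Preadditive.zsmul_comp, evMap_comp, evMap_comp]
  simp

theorem evMap_vfacePos_id_assoc {a c : SimplexCategory} (θ : a ⟶ c) (q : ℕ)
    {F : SimplicialObject (SimplicialObject C) ⥤ C} (g : _ ⟶ F) :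
    evMap θ (𝟙 _) ≫ vfacePos C a q ≫ g = vfacePos C c q ≫ evMap θ (𝟙 _) ≫ g := by
  rw [← Category.assoc, evMap_vfacePos_id, Category.assoc]

/-- The zeroth face is a chain map from the décalage. -/
theorem vfacePos_face (a : SimplexCategory) (q : ℕ) :
    evMap (𝟙 a) (δ 0) ≫ vface C a q = vfacePos C a q ≫ evMap (𝟙 a) (δ 0) := by
  rw [vface, vfacePos, Preadditive.comp_sum, Preadditive.sum_comp]
  refine Finset.sum_congr rfl fun i _ => ?_
  rw [Preadditive.comp_zsmul, Preadditive.zsmul_comp, evMap_comp, evMap_comp]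
  congr 2
  exact (δ_comp_δ (Fin.zero_le i)).symm

theorem vfacePos_face_assoc (a : SimplexCategory) (q : ℕ) {F : SimplicialObject (SimplicialObject C) ⥤ C}
    (g : _ ⟶ F) : evMap (𝟙 a) (δ 0) ≫ vface C a q ≫ g = vfacePos C a q ≫ evMap (𝟙 a) (δ 0) ≫ g := by
  rw [← Category.assoc, vfacePos_face, Category.assoc]

/-- The last face `Y_1 → Y_0` annihilates the boundaries of the décalage. -/
theorem hfacePos_last (b : SimplexCategory) : hfacePos C 0 b ≫ evMap (δ 1) (𝟙 b) = 0 := by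
  have h : δ (1 : Fin 2) ≫ δ (Fin.succ 0 : Fin 3) = δ 1 ≫ δ (Fin.succ 1) := (δ_comp_δ (le_refl (1 : Fin 2))).symm
  rw [hfacePos, Fin.sum_univ_two, Preadditive.add_comp, Preadditive.zsmul_comp, Preadditive.zsmul_comp,
    evMap_comp, evMap_comp, h]
  simp

theorem hfacePos_last_assoc (b : SimplexCategory) {F : SimplicialObject (SimplicialObject C) ⥤ C} (g : _ ⟶ F) :
    hfacePos C 0 b ≫ evMap (δ 1) (𝟙 b) ≫ g = 0 ≫ g := by
  rw [← Category.assoc, hfacePos_last]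

theorem vfacePos_last (a : SimplexCategory) : vfacePos C a 0 ≫ evMap (𝟙 a) (δ 1) = 0 := by
  have h : δ (1 : Fin 2) ≫ δ (Fin.succ 0 : Fin 3) = δ 1 ≫ δ (Fin.succ 1) := (δ_comp_δ (le_refl (1 : Fin 2))).symm
  rw [vfacePos, Fin.sum_univ_two, Preadditive.add_comp, Preadditive.zsmul_comp, Preadditive.zsmul_comp,
    evMap_comp, evMap_comp, h]
  simp

theorem vfacePos_last_assoc (a : SimplexCategory) {F : SimplicialObject (SimplicialObject C) ⥤ C} (g : _ ⟶ F) :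
    vfacePos C a 0 ≫ evMap (𝟙 a) (δ 1) ≫ g = 0 ≫ g := by
  rw [← Category.assoc, vfacePos_last]

end EilenbergZilber

namespace EilenbergZilber

open SimplexCategory

universe v u

variable {C : Type u} [Category.{v} C] [Preadditive C] [Limits.HasCoproducts.{0} C]

variable (C) in
/-- The zeroth degeneracies are sections of the counit. -/
noncomputable def totSections : RelativeComparison.Sections (decCounit C) (totComplex C) where
  s n := totDesc (𝟭 _) fun p q h =>
    (evMap (σ 0) (σ 0) : ev C (mk p) (mk q) ⟶ ev C (mk (p + 1)) (mk (q + 1))) ≫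
      Functor.whiskerLeft bidec (totι C p q n h)
  s_ε n := by
    refine tot_hom_ext (W := 𝟭 _) fun p q h => ?_
    have h0 : ∀ n : ℕ, δ (0 : Fin (n + 2)) ≫ σ 0 = 𝟙 _ := fun n => δ_comp_σ_self (i := (0 : Fin (n + 1)))
    have h1 : (evMap (σ 0) (σ 0) : ev C (mk p) (mk q) ⟶ ev C (mk (p + 1)) (mk (q + 1))) ≫ evMap (δ 0) (δ 0) =
        𝟙 (ev C (mk p) (mk q)) := by
      rw [evMap_comp, h0, h0, evMap_id]
    have h2 := RelativeComparison.component_naturality (decCounit C) (totι C p q n h)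
    refine (Category.assoc _ _ _).symm.trans ?_
    refine (congrArg (· ≫ _) (totι_totDesc (𝟭 _) _ p q h)).trans ?_
    refine (Category.assoc _ _ _).trans ?_
    refine (congrArg (_ ≫ ·) h2).trans ?_
    refine (Category.assoc _ _ _).symm.trans ?_
    refine (congrArg (· ≫ _) h1).trans ?_
    exact (Category.id_comp _).trans (Category.comp_id _).symm

variable (C) in
/-- The part of the contraction of the total complex in the second direction; it lives over the vertices
of the first direction. -/
noncomputable def totLast (p q n : ℕ) (h : p + q = n) :
    ev C (mk (p + 1)) (mk (q + 1)) ⟶ (totComplex C).X (n + 1) :=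
  match p, h with
  | 0, _ => evMap (δ 1) (𝟙 _) ≫ totι C 0 (q + 1) (n + 1) (by omega)
  | _ + 1, _ => 0

variable (C) in
/-- The components of the contraction of the total complex. -/
noncomputable def totContract (p q n : ℕ) (h : p + q = n) :
    ev C (mk (p + 1)) (mk (q + 1)) ⟶ (totComplex C).X (n + 1) :=
  evMap (𝟙 _) (δ 0) ≫ totι C (p + 1) q (n + 1) (by omega) + totLast C p q n h

variable (C) in
/-- The composite of the first part of the differential of the décalage and the contraction. -/
noncomputable def decD₁ (p q n : ℕ) (h : p + q = n + 1) :
    ev C (mk (p + 1)) (mk (q + 1)) ⟶ (totComplex C).X (n + 1) :=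
  match p, h with
  | 0, _ => 0
  | p + 1, _ => hfacePos C p (mk (q + 1)) ≫ totContract C p q n (by omega)

variable (C) in
/-- The composite of the second part of the differential of the décalage and the contraction. -/
noncomputable def decD₂ (p q n : ℕ) (h : p + q = n + 1) :
    ev C (mk (p + 1)) (mk (q + 1)) ⟶ (totComplex C).X (n + 1) :=
  match q, h with
  | 0, _ => 0
  | q + 1, _ => (-1 : ℤ) ^ p • (vfacePos C (mk (p + 1)) q ≫ totContract C p q n (by omega))

theorem totLast_succ (p q n : ℕ) (h : p + 1 + q = n) : totLast C (p + 1) q n h = 0 := rfl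

theorem hfacePos_totLast (p q n : ℕ) (h : p + q = n) :
    hfacePos C p (mk (q + 1)) ≫ totLast C p q n h = 0 := by
  cases p with
  | zero => exact (hfacePos_last_assoc _ _).trans Limits.zero_comp
  | succ p => exact Limits.comp_zero

/-- The condition on a contraction in degree zero. -/
theorem totContract_d_zero : totContract C 0 0 0 rfl ≫ (totComplex C).d 1 0 =
    evMap (δ 0) (δ 0) ≫ totι C 0 0 0 rfl - evMap (δ 1) (δ 1) ≫ totι C 0 0 0 rfl := by
  simp only [totContract, totLast, Preadditive.add_comp, Category.assoc]
  rw [totι_d, totι_d]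
  simp only [totD₁, totD₂, hface_zero, vface_zero, pow_zero, one_smul, zero_add, add_zero]
  simp only [Preadditive.sub_comp, Preadditive.comp_sub, evMap_comp_assoc, Category.comp_id, Category.id_comp]
  abel

/-- The condition on a contraction in positive degrees, at the summand `(p, q)`. The summand `totLast` compensates for
the last face that the differential in the first direction contributes when `p = 0`. -/
theorem totContract_d (p q n : ℕ) (h : p + q = n + 1) :
    totContract C p q (n + 1) h ≫ (totComplex C).d (n + 2) (n + 1) =
      evMap (δ 0) (δ 0) ≫ totι C p q (n + 1) h - (decD₁ C p q n h + decD₂ C p q n h) := by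
  cases p with
  | zero =>
    cases q with
    | zero => omega
    | succ q =>
      simp only [totContract, totLast, Preadditive.add_comp, Category.assoc]
      rw [totι_d _ _ _ (by omega), totι_d _ _ _ (by omega)]
      simp only [totD₁, totD₂, decD₁, decD₂, totContract, totLast, hface_zero, vface_succ, pow_zero, one_smul,
        zero_add, pow_one, neg_smul]
      simp only [Preadditive.sub_comp, Preadditive.comp_sub, Preadditive.comp_add, Preadditive.comp_neg,
        evMap_comp_assoc, Category.comp_id, Category.id_comp, vfacePos_face_assoc, evMap_vfacePos_id_assoc]
      abel
  | succ p =>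
    have hD : decD₁ C (p + 1) q n h =
        hfacePos C p (mk (q + 1)) ≫ evMap (𝟙 _) (δ 0) ≫ totι C (p + 1) q (n + 1) (by omega) := by
      refine (Preadditive.comp_add _ _ _ _ _ _).trans ?_
      rw [hfacePos_totLast, add_zero]
    rw [hD, totContract, totLast_succ, add_zero, Category.assoc, totι_d _ _ _ (by omega)]
    simp only [totD₁, hface_succ, Preadditive.sub_comp, Preadditive.comp_sub, Preadditive.comp_add,
      evMap_comp_assoc, Category.comp_id, Category.id_comp, evMap_id_hfacePos_assoc]
    cases q with
    | zero => simp only [totD₂, decD₂, Limits.comp_zero, add_zero]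
    | succ q =>
      simp only [totD₂, decD₂, totContract, totLast_succ, add_zero, pow_succ (-1 : ℤ) (p + 1),
        mul_neg_one, neg_smul, Preadditive.comp_neg, Preadditive.comp_zsmul]
      rw [← vfacePos_face_assoc]
      generalize (-1 : ℤ) ^ (p + 1) = c
      abel

variable (C) in
/-- The last faces; the degree is zero, so that `p` and `q` are `0`. -/
noncomputable def totLastFace (p q : ℕ) (h : p + q = 0) : ev C (mk (p + 1)) (mk (q + 1)) ⟶ (totComplex C).X 0 :=
  evMap (δ (Fin.last (p + 1))) (δ (Fin.last (q + 1))) ≫ totι C p q 0 h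

variable (C) in
/-- The contraction of the total complex: the total complex of `bidec Y` maps to that of `Y`
through the identity in the first direction and the zeroth face in the second; over the vertices of the
first direction, the identity in the second direction enters. -/
noncomputable def totContraction : RelativeComparison.Contraction (decCounit C) (totComplex C) where
  κ := totDesc bidec fun p q h => totLastFace C p q h
  t n := totDesc bidec fun p q h => totContract C p q n h
  t_zero := by
    refine tot_hom_ext fun p q h => ?_
    obtain rfl : p = 0 := by omega
    obtain rfl : q = 0 := by omega
    refine (Category.assoc _ _ _).symm.trans ?_
    refine (congrArg (· ≫ _) (totι_totDesc bidec _ 0 0 h)).trans ?_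
    refine totContract_d_zero.trans ?_
    refine Eq.trans ?_ (Preadditive.comp_sub _ _ _).symm
    refine congrArg₂ (· - ·) ?_ ?_
    · exact (RelativeComparison.component_naturality (decCounit C) (totι C 0 0 0 h)).symm
    · exact (totι_totDesc bidec (fun p q h => totLastFace C p q h) 0 0 h).symm
  t_succ n := by
    refine tot_hom_ext (W := bidec) fun p q h => ?_
    refine (Category.assoc _ _ _).symm.trans ?_
    refine (congrArg (· ≫ _) (totι_totDesc bidec _ p q h)).trans ?_
    refine (totContract_d p q n h).trans ?_
    refine Eq.trans ?_ (Preadditive.comp_sub _ _ _).symm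
    refine congrArg₂ (· - ·) ?_ ?_
    · exact (RelativeComparison.component_naturality (decCounit C) (totι C p q (n + 1) h)).symm
    · refine Eq.trans ?_ (Category.assoc _ _ _)
      have hd : Functor.whiskerLeft bidec (totι C p q (n + 1) h) ≫
          (decFunctor C).map ((totComplex C).d (n + 1) n) =
          (decFunctor C).map (totD₁ C p q n h) + (decFunctor C).map (totD₂ C p q n h) := by
        refine ((decFunctor C).map_comp _ _).symm.trans ?_
        rw [totι_d, Functor.map_add]
      refine Eq.trans ?_ (congrArg (· ≫ _) hd.symm)
      refine Eq.trans ?_ (Preadditive.add_comp _ _ _ _ _ _).symm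
      refine congrArg₂ (· + ·) ?_ ?_
      · cases p with
        | zero => exact Limits.zero_comp.symm
        | succ p =>
          refine Eq.trans ?_ (congrArg (· ≫ _)
            ((decFunctor C).map_comp (hface C p (mk q)) (totι C p q n (by omega))).symm)
          refine Eq.trans ?_ (Category.assoc _ _ _).symm
          refine Eq.trans ?_ (congrArg₂ (· ≫ ·) (decFunctor_hface p _).symm (totι_totDesc bidec _ p q _).symm)
          rfl
      · cases q with
        | zero => exact Limits.zero_comp.symm
        | succ q =>
          refine Eq.trans ?_ (congrArg (· ≫ _)
            ((decFunctor C).map_zsmul (f := vface C (mk p) q ≫ totι C p q n (by omega)) (r := (-1) ^ p)).symm)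
          refine Eq.trans ?_ (Preadditive.zsmul_comp _ _ _).symm
          refine congrArg (fun x => (-1 : ℤ) ^ p • x) ?_
          refine Eq.trans ?_ (congrArg (· ≫ _)
            ((decFunctor C).map_comp (vface C (mk p) q) (totι C p q n (by omega))).symm)
          refine Eq.trans ?_ (Category.assoc _ _ _).symm
          refine Eq.trans ?_ (congrArg₂ (· ≫ ·) (decFunctor_vface _ q).symm (totι_totDesc bidec _ p q _).symm)
          rfl

variable (C) in
/-- In degree zero both complexes are `Y_{0,0}`. -/
noncomputable def totZeroIso : (totComplex C).X 0 ≅ ev C (mk 0) (mk 0) where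
  hom := totDesc (𝟭 _) fun p q h => evMap ((mk 0).const (mk p) 0) ((mk 0).const (mk q) 0)
  inv := totι C 0 0 0 rfl
  hom_inv_id := by
    refine tot_hom_ext (W := 𝟭 _) fun p q h => ?_
    obtain rfl : p = 0 := by omega
    obtain rfl : q = 0 := by omega
    refine (Category.assoc _ _ _).symm.trans ?_
    refine (congrArg (· ≫ _) (totι_totDesc (𝟭 _) _ 0 0 h)).trans ?_
    have h0 : (mk 0).const (mk 0) 0 = 𝟙 _ := by ext i; simp
    rw [h0]
    refine (congrArg (· ≫ _) (evMap_id _ _)).trans ?_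
    exact (Category.id_comp _).trans (Category.comp_id _).symm
  inv_hom_id := by
    have h0 : (mk 0).const (mk 0) 0 = 𝟙 _ := by ext i; simp
    refine (totι_totDesc (𝟭 _) _ 0 0 rfl).trans ?_
    rw [h0]
    exact evMap_id _ _

theorem totι_totZeroIso : totι C 0 0 0 rfl ≫ (totZeroIso C).hom = 𝟙 _ := (totZeroIso C).inv_hom_id

theorem evMap_last : (evMap (δ 1) (δ 1) : ev C (mk 1) (mk 1) ⟶ ev C (mk 0) (mk 0)) =
    evMap (δ 1) (𝟙 _) ≫ evMap (𝟙 _) (δ 1) := by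
  rw [evMap_comp, Category.comp_id, Category.id_comp]

theorem evMap_last' : (evMap (δ 1) (δ 1) : ev C (mk 1) (mk 1) ⟶ ev C (mk 0) (mk 0)) =
    evMap (𝟙 _) (δ 1) ≫ evMap (δ 1) (𝟙 _) := by
  rw [evMap_comp, Category.comp_id, Category.id_comp]

/-- The complexes of the total complex and of the diagonal of a bisimplicial object are naturally homotopy
equivalent. -/
noncomputable def totDiagEquiv : HomotopyEquiv (totComplex C) (diagComplex C) :=
  RelativeComparison.homotopyEquiv (totSections C) (diagSections C) (totContraction C) (diagContraction C)
    (totZeroIso C)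
    (by
      refine tot_hom_ext (W := bidec) fun p q h => ?_
      refine Eq.trans ?_ Limits.comp_zero.symm
      have key : totι C p q 1 h ≫ (totComplex C).d 1 0 ≫ (totZeroIso C).hom = 
        (totD₁ C p q 0 h + totD₂ C p q 0 h) ≫ (totZeroIso C).hom := by rw [← totι_d, Category.assoc]
      have h1 : (decFunctor C).map (totι C p q 1 h) ≫
          (decFunctor C).map ((totComplex C).d 1 0 ≫ (totZeroIso C).hom) ≫ (diagContraction C).κ = 0 := by
        refine (Category.assoc _ _ _).symm.trans ?_
        refine (congrArg (· ≫ _) ((decFunctor C).map_comp _ _).symm).trans ?_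
        refine (congrArg (fun x => (decFunctor C).map x ≫ _) key).trans ?_
        rcases p with _ | p
        · obtain rfl : q = 1 := by omega
          have e : (totD₁ C 0 1 0 h + totD₂ C 0 1 0 h) ≫ (totZeroIso C).hom = vface C (mk 0) 0 := by
            simp only [totD₁, totD₂, zero_add, pow_zero, one_smul, Category.assoc, totι_totZeroIso, Category.comp_id]
          rw [e, decFunctor_vface]
          change vfacePos C (mk 1) 0 ≫ (evMap (δ 1) (δ 1) : ev C (mk 1) (mk 1) ⟶ ev C (mk 0) (mk 0)) = 0
          rw [evMap_last', vfacePos_last_assoc, Limits.zero_comp]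
        · obtain rfl : p = 0 := by omega
          obtain rfl : q = 0 := by omega
          have e : (totD₁ C 1 0 0 h + totD₂ C 1 0 0 h) ≫ (totZeroIso C).hom = hface C 0 (mk 0) := by
            simp only [totD₁, totD₂, add_zero, Category.assoc, totι_totZeroIso, Category.comp_id]
          rw [e, decFunctor_hface]
          change hfacePos C 0 (mk 1) ≫ (evMap (δ 1) (δ 1) : ev C (mk 1) (mk 1) ⟶ ev C (mk 0) (mk 0)) = 0
          rw [evMap_last, hfacePos_last_assoc, Limits.zero_comp]
      exact h1)
    (by
      have h : δ (1 : Fin 2) ≫ δ (Fin.succ 0 : Fin 3) = δ 1 ≫ δ (Fin.succ 1) :=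
        (δ_comp_δ (le_refl (1 : Fin 2))).symm
      have h0 : (decFunctor C).map ((diagComplex C).d 1 0) =
          evMap (δ (Fin.succ 0)) (δ (Fin.succ 0)) - (evMap (δ (Fin.succ 1)) (δ (Fin.succ 1)) :
            ev C (mk 2) (mk 2) ⟶ ev C (mk 1) (mk 1)) := by
        rw [diagComplex_d, Fin.sum_univ_two]
        refine ((decFunctor C).map_add).trans ((congrArg₂ (· + ·) ?_ ?_).trans (sub_eq_add_neg _ _).symm)
        · refine ((decFunctor C).map_zsmul).trans ((one_smul ℤ _).trans ((decFunctor_evMap _ _).trans ?_))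
          rw [shift_map_δ]
          rfl
        · refine ((decFunctor C).map_zsmul).trans ((neg_one_zsmul _).trans (congrArg _ ?_))
          refine (decFunctor_evMap _ _).trans ?_
          rw [shift_map_δ]
          rfl
      have h1 : (decFunctor C).map (totι C 0 0 0 rfl) ≫ (totContraction C).κ = evMap (δ 1) (δ 1) ≫ totι C 0 0 0 rfl :=
        totι_totDesc bidec (fun p q h => totLastFace C p q h) 0 0 rfl
      refine (congrArg (· ≫ _) ((decFunctor C).map_comp _ _)).trans ?_
      refine (Category.assoc _ _ _).trans ?_
      refine (congrArg₂ (· ≫ ·) h0 h1).trans ?_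
      refine (Preadditive.sub_comp _ _ _).trans (sub_eq_zero.2 ?_)
      have h2 : (evMap (δ (Fin.succ 0)) (δ (Fin.succ 0)) : ev C (mk 2) (mk 2) ⟶ ev C (mk 1) (mk 1)) ≫
          evMap (δ 1) (δ 1) ≫ totι C 0 0 0 rfl =
          evMap (δ (Fin.succ 1)) (δ (Fin.succ 1)) ≫ evMap (δ 1) (δ 1) ≫ totι C 0 0 0 rfl := by
        rw [evMap_comp_assoc, evMap_comp_assoc, h]
      exact h2)

end EilenbergZilber

/-! ### Hyperhomology and the diagonal -/

section

universe w u v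

namespace EilenbergZilber

/-- The chain complex of the total complex of a bisimplicial object is homotopy equivalent to that of its
diagonal. -/
noncomputable def totalDiagEquiv {C : Type u} [Category.{v} C] [Preadditive C] [Limits.HasCoproducts.{0} C]
    (Y : SimplicialObject (SimplicialObject C)) :
    HomotopyEquiv (((doubleComplex C).obj Y).total (ComplexShape.down ℕ))
      ((AlgebraicTopology.alternatingFaceMapComplex C).obj (bisimplicialDiag Y)) :=
  Functor.mapHomotopyEquiv ((evaluation _ C).obj Y) (totDiagEquiv (C := C))

end EilenbergZilber

instance {A : Type v} {B : Type u} [Ring A] [Ring B] [Module B A] (E : AugmentedAlgebra A B) :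
    (E.barFunctor : ModuleCat.{w} Bᵐᵒᵖ ⥤ _).Additive where
  map_add {N N' f g} := by
    apply NatTrans.ext
    funext Δ
    apply AddCommGrpCat.hom_ext
    refine TensorGroup.hom_ext (ι := E.incl) (N := N) (n := Δ.unop.len) fun x => ?_
    have h := (TensorGroup.balanced_mk (ι := E.incl) (N := N') (n := Δ.unop.len)).add_zero
      (f.hom x.1) (g.hom x.1) x.2
    refine (E.barCoeff_mk (f + g).hom Δ.unop.len x).trans (h.trans ?_)
    exact congrArg₂ (· + ·) (E.barCoeff_mk f.hom Δ.unop.len x).symm (E.barCoeff_mk g.hom Δ.unop.len x).symm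

variable {A : Type v} {B : Type u} [Ring A] [Ring B] [Module B A] (E : AugmentedAlgebra A B)

/-- The double complexes that define the hyperhomology of the chain complex of a simplicial module `X` and
the total complex of the bisimplicial abelian group `⊥(B/A, X)` have the same objects; their differentials agree
since `⊥(B/A, -)` is additive. -/
noncomputable def AugmentedAlgebra.barDoubleComplexIso (X : SimplicialObject (ModuleCat.{w} Bᵐᵒᵖ)) :
    ((E.barFunctor ⋙ AlgebraicTopology.alternatingFaceMapComplex
      AddCommGrpCat.{max w u}).mapHomologicalComplex (ComplexShape.down ℕ)).obj
        ((AlgebraicTopology.alternatingFaceMapComplex _).obj X) ≅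
      (EilenbergZilber.doubleComplex _).obj (((SimplicialObject.whiskering _ _).obj E.barFunctor).obj X) :=
  HomologicalComplex.Hom.isoOfComponents
    (fun q => Iso.refl ((AlgebraicTopology.alternatingFaceMapComplex AddCommGrpCat.{max w u}).obj
      (E.barFunctor.obj (X.obj (op (SimplexCategory.mk q)))))) fun i j h => by
    obtain rfl : j + 1 = i := h
    refine (Category.id_comp _).trans (Eq.trans ?_ (Category.comp_id _).symm)
    have e : ((AlgebraicTopology.alternatingFaceMapComplex _).obj
        (((SimplicialObject.whiskering _ _).obj E.barFunctor).obj X)).d (j + 1) j =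
        E.barFunctor.map (((AlgebraicTopology.alternatingFaceMapComplex _).obj X).d (j + 1) j) := by
      refine (AlgebraicTopology.AlternatingFaceMapComplex.obj_d_eq _ j).trans ?_
      refine Eq.trans ?_ (congrArg (fun x => E.barFunctor.map x)
        (AlgebraicTopology.AlternatingFaceMapComplex.obj_d_eq X j)).symm
      refine Eq.trans ?_ (E.barFunctor.map_sum _ _).symm
      exact Finset.sum_congr rfl fun i _ => (E.barFunctor.map_zsmul).symm
    exact congrArg (fun x => (AlgebraicTopology.alternatingFaceMapComplex _).map x) e

/-- The hyperhomology of the chain complex of `X` is the total complex of `⊥(B/A, X)`. -/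
noncomputable def AugmentedAlgebra.hyperhomologyIso (X : SimplicialObject (ModuleCat.{w} Bᵐᵒᵖ)) :
    E.hyperhomology ((AlgebraicTopology.alternatingFaceMapComplex _).obj X) ≅
      ((EilenbergZilber.doubleComplex _).obj (((SimplicialObject.whiskering _ _).obj E.barFunctor).obj X)).total
        (ComplexShape.down ℕ) :=
  HomologicalComplex₂.total.mapIso (E.barDoubleComplexIso X) _

/-- The hyperhomology of the chain complex of a simplicial module `X` is computed by the diagonal of the
bisimplicial abelian group `⊥(B/A, X)`. -/
theorem AugmentedAlgebra.exists_quasiIso_diag (X : SimplicialObject (ModuleCat.{w} Bᵐᵒᵖ)) :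
    ∃ e : E.hyperhomology ((AlgebraicTopology.alternatingFaceMapComplex _).obj X) ⟶
      (AlgebraicTopology.alternatingFaceMapComplex _).obj
        (bisimplicialDiag (((SimplicialObject.whiskering _ _).obj E.barFunctor).obj X)), QuasiIso e := by
  have h := HomotopyEquiv.quasiIso_hom (EilenbergZilber.totalDiagEquiv
    (((SimplicialObject.whiskering _ _).obj E.barFunctor).obj X))
  exact ⟨(E.hyperhomologyIso X).hom ≫ (EilenbergZilber.totalDiagEquiv _).hom, inferInstance⟩

end

/-! ### Multiadditive maps -/

/-- Maps on `n`-tuples that are additive in each variable. -/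
def IsMultiadditive {V G : Type*} [AddCommGroup V] [AddCommGroup G] {n : ℕ} (T : (Fin n → V) → G) : Prop :=
  ∀ (b : Fin n → V) (j : Fin n) (v w : V),
    T (Function.update b j (v + w)) = T (Function.update b j v) + T (Function.update b j w)

namespace IsMultiadditive

universe u v

variable {S V G : Type*} [AddCommGroup V] [AddCommGroup G] {n : ℕ}

/-- A multiadditive map as a homomorphism in one of the variables. -/
def hom {T : (Fin n → V) → G} (hT : IsMultiadditive T) (b : Fin n → V) (j : Fin n) : V →+ G :=
  AddMonoidHom.mk' (fun v => T (Function.update b j v)) (hT b j)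

theorem hom_apply {T : (Fin n → V) → G} (hT : IsMultiadditive T) (b : Fin n → V) (j : Fin n) (v : V) :
    hT.hom b j v = T (Function.update b j v) := rfl

theorem ext {s : S → V} (hs : AddSubgroup.closure (Set.range s) = ⊤) {T T' : (Fin n → V) → G}
    (hT : IsMultiadditive T) (hT' : IsMultiadditive T') (h : ∀ b, T (s ∘ b) = T' (s ∘ b)) : T = T' := by
  have key : ∀ (m : ℕ) (b : Fin n → V), (∀ i : Fin n, m ≤ i → b i ∈ Set.range s) → T b = T' b := by
    intro m
    induction m with
    | zero =>
      intro b hb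
      choose c hc using fun i => hb i (Nat.zero_le _)
      obtain rfl : s ∘ c = b := funext hc
      exact h c
    | succ m ih =>
      intro b hb
      by_cases hm : m < n
      · have e : hT.hom b ⟨m, hm⟩ = hT'.hom b ⟨m, hm⟩ := by
          refine AddMonoidHom.eq_of_eqOn_dense hs ?_
          rintro _ ⟨x, rfl⟩
          refine ih _ fun i hi => ?_
          by_cases him : i = ⟨m, hm⟩
          · subst him
            rw [Function.update_self]
            exact ⟨x, rfl⟩
          · rw [Function.update_of_ne him]
            refine hb i ?_
            rcases hi.eq_or_lt with h | h
            · exact absurd (Fin.ext h.symm) him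
            · exact h
        have := DFunLike.congr_fun e (b ⟨m, hm⟩)
        rwa [hom_apply, hom_apply, Function.update_eq_self] at this
      · exact ih b fun i hi => absurd i.2 (by omega)
  exact funext fun b => key n b fun i hi => absurd i.2 (by omega)

theorem comp_homs {T : (Fin n → V) → G} (hT : IsMultiadditive T) (u : Fin n → (V →+ V)) :
    IsMultiadditive fun b => T fun i => u i (b i) := by
  intro b j v w
  have e : ∀ v, (fun i => u i (Function.update b j v i)) = Function.update (fun i => u i (b i)) j (u j v) :=
    fun v => funext fun i => Function.apply_update (fun i => u i) b j v i
  simp only [e, map_add]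
  exact hT _ _ _ _

/-- A map on tuples of generators that extends to a homomorphism in each variable extends to a multiadditive
map. -/
theorem exists_extension {V : Type u} [AddCommGroup V] {s : S → V}
    (hs : AddSubgroup.closure (Set.range s) = ⊤) :
    ∀ {n : ℕ} {G : Type max u v} [AddCommGroup G] (F : (Fin n → S) → G)
      (_ : ∀ (b : Fin n → S) (i : Fin n), ∃ L : V →+ G, ∀ v, L (s v) = F (Function.update b i v)),
      ∃ T : (Fin n → V) → G, IsMultiadditive T ∧ ∀ b, T (s ∘ b) = F b := by
  have hext : ∀ {G : Type max u v} [AddCommGroup G] {f g : V →+ G}, (∀ v, f (s v) = g (s v)) → f = g := by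
    intro G _ f g h
    refine AddMonoidHom.eq_of_eqOn_dense hs ?_
    rintro _ ⟨x, rfl⟩
    exact h x
  intro n
  induction n with
  | zero => 
    intro G _ F _
    exact ⟨fun _ => F Fin.elim0, fun _ j => j.elim0, fun b => congrArg F (funext fun i => i.elim0)⟩
  | succ n ih =>
    intro G _ F hF
    have h0 : ∀ b : Fin n → S, ∃ L : V →+ G, ∀ v, L (s v) = F (Fin.cons v b) := by
      intro b
      rcases isEmpty_or_nonempty S with hS | ⟨⟨v⟩⟩
      · exact ⟨0, fun v => hS.elim v⟩
      · obtain ⟨L, hL⟩ := hF (Fin.cons v b) 0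
        exact ⟨L, fun w => by rw [hL, Fin.update_cons_zero]⟩
    choose L hL using h0
    -- by additivity in the remaining variable, `L` extends in each variable
    have h1 : ∀ (b : Fin n → S) (i : Fin n), ∃ L' : V →+ (V →+ G), ∀ v, L' (s v) = L (Function.update b i v) := by
      intro b i
      have h2 : ∀ x : V, ∃ N : V →+ G, ∀ w, N (s w) = L (Function.update b i w) x := by
        intro x
        have hx : x ∈ AddSubgroup.closure (Set.range s) := hs ▸ AddSubgroup.mem_top x
        induction hx using AddSubgroup.closure_induction with
        | mem x hx =>
          obtain ⟨v, rfl⟩ := hx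
          obtain ⟨N, hN⟩ := hF (Fin.cons v b) i.succ
          exact ⟨N, fun w => by rw [hN, hL, Fin.cons_update]⟩
        | zero => exact ⟨0, fun w => by rw [map_zero]; rfl⟩
        | add x y _ _ hx hy =>
          obtain ⟨N, hN⟩ := hx
          obtain ⟨N', hN'⟩ := hy
          exact ⟨N + N', fun w => by rw [map_add, AddMonoidHom.add_apply, hN, hN']⟩
        | neg x _ hx =>
          obtain ⟨N, hN⟩ := hx
          exact ⟨-N, fun w => by rw [map_neg, AddMonoidHom.neg_apply, hN]⟩
      choose N hN using h2
      refine ⟨(AddMonoidHom.mk' N fun x y => hext fun w => ?_).flip, fun w => ?_⟩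
      · rw [AddMonoidHom.add_apply, hN, hN, hN, map_add]
      · ext x
        exact hN x w
    obtain ⟨T, hT, hT'⟩ := ih L h1
    refine ⟨fun b => T (Fin.tail b) (b 0), fun b j v w => ?_, fun b => ?_⟩
    · cases j using Fin.cases with
      | zero => simp only [Fin.tail_update_zero, Function.update_self, map_add]
      | succ j =>
        simp only [Fin.tail_update_succ, Function.update_of_ne (Fin.succ_ne_zero j).symm]
        exact DFunLike.congr_fun (hT (Fin.tail b) j v w) (b 0)
    · change T (s ∘ Fin.tail b) (s (b 0)) = F b
      rw [hT', hL, Fin.cons_self_tail]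

end IsMultiadditive

/-! ### Moving coefficients through a tensor product -/

namespace Tup

variable {A B N : Type*} [Ring A] [Ring B] [AddCommGroup N] [Module Bᵐᵒᵖ N] {n : ℕ}
  {ι : A →+* B} {G : Type*} [AddCommGroup G] {φ : Tup N B n → G}

/-- If `e_i x_{i+1} = x_{i+1} e_{i+1}`, then `x_0 e_0 ⊗ ⋯ ⊗ x_n = x_0 ⊗ ⋯ ⊗ x_j e_j ⊗ ⋯ ⊗ x_n`. -/
theorem Balanced.rmul_shift (h : Balanced ι φ) (x : Tup N B n) (e : Fin (n + 1) → A) (j : Fin (n + 1))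
    (he : ∀ i : Fin n, i.castSucc < j → ι (e i.castSucc) * x.2 i = x.2 i * ι (e i.succ)) :
    φ (rmul 0 (ι (e 0)) x) = φ (rmul j (ι (e j)) x) := by
  induction j using Fin.induction with
  | zero => rfl
  | succ j ih =>
    rw [ih fun i hi => he i (hi.trans Fin.castSucc_lt_succ), h.bal, rmul_succ, lmul, he j Fin.castSucc_lt_succ]

/-- In `x_0 e_0 ⊗ y_1 ⊗ ⋯ ⊗ y_n` with `e_i y_{i+1} = y_{i+1} e_{i+1}`, the factor `y_{i+1}` matters only through
`e_i y_{i+1}`. -/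
theorem Balanced.congr_of_rmul (h : Balanced ι φ) (m : N) (y z : Fin n → B) (e : Fin (n + 1) → A)
    (hy : ∀ i : Fin n, ι (e i.castSucc) * y i = y i * ι (e i.succ))
    (hyz : ∀ i : Fin n, ι (e i.castSucc) * y i = ι (e i.castSucc) * z i) :
    φ (rmul 0 (ι (e 0)) (m, y)) = φ (rmul 0 (ι (e 0)) (m, z)) := by
  -- the first `j` factors from `y`, the others from `z`
  let mix (j : ℕ) : Fin n → B := fun i => if (i : ℕ) < j then y i else z i
  have key : ∀ j : ℕ, j ≤ n → φ (rmul 0 (ι (e 0)) (m, mix j)) = φ (rmul 0 (ι (e 0)) (m, z)) := by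
    intro j
    induction j with
    | zero => intro _; simp [mix]
    | succ j ih =>
      intro hj
      rw [← ih (by omega)]
      let i : Fin n := ⟨j, by omega⟩
      have h1 : ∀ l : ℕ, l = j ∨ l = j + 1 → φ (rmul 0 (ι (e 0)) (m, mix l)) =
          φ (lmul i (ι (e i.castSucc)) (m, mix l)) := by
        intro l hl
        rw [← h.bal]
        refine h.rmul_shift (m, mix l) e i.castSucc fun i' hi' => ?_
        have : (i' : ℕ) < l := by
          have : (i' : ℕ) < j := hi'
          omega
        simp only [mix, if_pos this, hy]
      rw [h1 _ (Or.inl rfl), h1 _ (Or.inr rfl)]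
      refine congrArg (fun c => φ (m, c)) (funext fun i' => ?_)
      by_cases hi : i' = i
      · subst hi
        rw [Function.update_self, Function.update_self]
        simp only [mix]
        rw [if_pos (show j < j + 1 by omega), if_neg (show ¬j < j by omega), hyz]
      · have : (i' : ℕ) ≠ j := fun h => hi (Fin.ext h)
        rw [Function.update_of_ne hi, Function.update_of_ne hi]
        simp only [mix]
        by_cases h' : (i' : ℕ) < j
        · rw [if_pos h', if_pos (by omega)]
        · rw [if_neg h', if_neg (by omega)]
  rw [← key n le_rfl]
  simp [mix]

end Tup

/-! ### Partial injections -/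

namespace Emb

theorem ext_iff_some {f g : Emb} (h : ∀ x y, f.app x = some y ↔ g.app x = some y) : f = g :=
  ext' fun n => Option.ext fun y => h n y

theorem mul_app_eq {f g : Emb} {x y : ℕ} :
    (f * g).app x = some y ↔ ∃ z, g.app x = some z ∧ f.app z = some y := by
  rw [mul_app, Option.bind_eq_some_iff]

theorem mem_image {f : Emb} {A : Set ℕ} {y : ℕ} : y ∈ f.image A ↔ ∃ x ∈ A, f.app x = some y := Iff.rfl

theorem image_mul (f g : Emb) (A : Set ℕ) : (f * g).image A = f.image (g.image A) := by
  ext y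
  simp only [mem_image, mul_app_eq]
  constructor
  · rintro ⟨x, hx, z, hz, hy⟩
    exact ⟨z, ⟨x, hx, hz⟩, hy⟩
  · rintro ⟨z, ⟨x, hx, hz⟩, hy⟩
    exact ⟨x, hx, z, hz, hy⟩

theorem image_mono (f : Emb) {A B : Set ℕ} (h : A ⊆ B) : f.image A ⊆ f.image B := by
  rintro y ⟨x, hx, hy⟩
  exact ⟨x, h hx, hy⟩

theorem image_union (f : Emb) (A B : Set ℕ) : f.image (A ∪ B) = f.image A ∪ f.image B := by
  ext y
  simp only [mem_image, Set.mem_union]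
  constructor
  · rintro ⟨x, hx | hx, hy⟩
    exacts [Or.inl ⟨x, hx, hy⟩, Or.inr ⟨x, hx, hy⟩]
  · rintro (⟨x, hx, hy⟩ | ⟨x, hx, hy⟩)
    exacts [⟨x, Or.inl hx, hy⟩, ⟨x, Or.inr hx, hy⟩]

theorem image_disjoint (f : Emb) {A B : Set ℕ} (h : Disjoint A B) : Disjoint (f.image A) (f.image B) := by
  rw [Set.disjoint_left] at h ⊢
  rintro y ⟨x, hx, hy⟩ ⟨x', hx', hy'⟩
  exact h hx (app_inj hy hy' ▸ hx')

theorem image_inter (f : Emb) (A B : Set ℕ) : f.image (A ∩ B) = f.image A ∩ f.image B := by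
  ext y
  constructor
  · rintro ⟨x, hx, hy⟩
    exact ⟨⟨x, hx.1, hy⟩, x, hx.2, hy⟩
  · rintro ⟨⟨x, hx, hy⟩, x', hx', hy'⟩
    obtain rfl := app_inj hy hy'
    exact ⟨x, ⟨hx, hx'⟩, hy⟩

theorem image_one (A : Set ℕ) : (1 : Emb).image A = A := by
  ext y
  simp only [mem_image, one_app, Option.some.injEq]
  exact ⟨fun ⟨x, hx, h⟩ => h ▸ hx, fun h => ⟨y, h, rfl⟩⟩

theorem image_idem (A B : Set ℕ) : (idem A).image B = A ∩ B := by
  ext y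
  simp only [mem_image, idem_app_eq]
  constructor
  · rintro ⟨x, hx, rfl, h⟩
    exact ⟨h, hx⟩
  · rintro ⟨h, h'⟩
    exact ⟨y, h', rfl, h⟩

theorem idem_mul (f : Emb) (A : Set ℕ) : idem A * f = f * idem (f.dag.image A) := by
  apply ext_iff_some
  intro x y
  simp only [mul_app_eq, idem_app_eq, mem_image, dag_app_eq]
  constructor
  · rintro ⟨z, h, rfl, h'⟩
    exact ⟨x, ⟨rfl, z, h', h⟩, h⟩
  · rintro ⟨z, ⟨rfl, z', h, h'⟩, hy⟩
    rw [hy] at h'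
    cases h'
    exact ⟨y, hy, rfl, h⟩

theorem image_dag_image (f : Emb) (A : Set ℕ) : f.image (f.dag.image A) = A ∩ f.image Set.univ := by
  rw [← image_mul, mul_dag, image_idem, Set.inter_comm]

theorem dag_image_image (f : Emb) (A : Set ℕ) : f.dag.image (f.image A) = A ∩ f.dag.image Set.univ := by
  have := image_dag_image f.dag A
  rwa [dag_dag] at this

/-- The fixed points. -/
def fix (f : Emb) : Set ℕ := {x | f.app x = some x}

theorem mem_fix {f : Emb} {x : ℕ} : x ∈ f.fix ↔ f.app x = some x := Iff.rfl

theorem fix_idem_mul (f : Emb) (A : Set ℕ) : (idem A * f).fix = A ∩ f.fix := by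
  ext x
  simp only [mem_fix, mul_app_eq, idem_app_eq, Set.mem_inter_iff]
  constructor
  · rintro ⟨z, h, rfl, h'⟩
    exact ⟨h', h⟩
  · rintro ⟨h, h'⟩
    exact ⟨x, h', rfl, h⟩

theorem fix_mul_idem (f : Emb) (A : Set ℕ) : (f * idem A).fix = f.fix ∩ A := by
  ext x
  simp only [mem_fix, mul_app_eq, idem_app_eq, Set.mem_inter_iff]
  constructor
  · rintro ⟨z, ⟨rfl, h⟩, h'⟩
    exact ⟨h', h⟩
  · rintro ⟨h, h'⟩
    exact ⟨x, ⟨rfl, h'⟩, h⟩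

/-- A partial injection has a proper colouring by three colours away from its fixed points: colour the integers
in increasing order, every one has at most two neighbours. -/
theorem exists_coloring (f : Emb) : ∃ col : ℕ → Fin 3, ∀ x y, f.app x = some y → x ≠ y → col x ≠ col y := by
  have hfree : ∀ s : Finset (Fin 3), s.card ≤ 2 → ∃ c, c ∉ s := by
    intro s hs
    by_contra! h
    have : s = Finset.univ := Finset.eq_univ_iff_forall.2 h
    rw [this] at hs
    simp at hs
  -- the colours of the neighbours that are already coloured
  let used (x : ℕ) (c : ∀ y < x, Fin 3) : Finset (Fin 3) :=
    ((f.app x).elim ∅ fun y => if h : y < x then {c y h} else ∅) ∪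
      ((f.dag.app x).elim ∅ fun y => if h : y < x then {c y h} else ∅)
  have hused : ∀ x c, (used x c).card ≤ 2 := by
    have h1 : ∀ (o : Option ℕ) (x : ℕ) (c : ∀ y < x, Fin 3),
        (o.elim (∅ : Finset (Fin 3)) fun y => if h : y < x then {c y h} else ∅).card ≤ 1 := by
      intro o x c
      cases o with
      | none => simp
      | some y => dsimp; split_ifs <;> simp
    intro x c
    exact (Finset.card_union_le _ _).trans (add_le_add (h1 _ x c) (h1 _ x c))
  let col : ℕ → Fin 3 := WellFounded.fix Nat.lt_wfRel.wf fun x c => (hfree _ (hused x c)).choose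
  have hcol : ∀ x, col x ∉ used x fun y _ => col y := by
    intro x
    have h : col x = _ := WellFounded.fix_eq Nat.lt_wfRel.wf
      (fun x c => (hfree _ (hused x c)).choose) x
    rw [h]
    exact (hfree _ (hused x _)).choose_spec
  refine ⟨col, fun x y hxy hne => ?_⟩
  rcases lt_or_gt_of_ne hne with h | h
  · have h1 := hcol y
    have h2 : f.dag.app y = some x := dag_app_eq.2 hxy
    simp only [used, h2, Finset.mem_union, Option.elim_some, dif_pos h, Finset.mem_singleton] at h1
    exact fun h3 => h1 (Or.inr h3.symm)
  · have h1 := hcol x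
    simp only [used, hxy, Finset.mem_union, Option.elim_some, dif_pos (show y < x from h), Finset.mem_singleton] at h1
    exact fun h3 => h1 (Or.inl h3)

end Emb

/-! ### Homomorphisms out of Karoubi's cone and out of crossed products -/

namespace Gam

theorem closure_range_U : AddSubgroup.closure (Set.range U) = ⊤ := by
  refine (AddSubgroup.eq_top_iff' _).2 fun A => ?_
  induction A using induction_on with
  | hU f => exact AddSubgroup.subset_closure ⟨f, rfl⟩
  | hz => exact zero_mem _
  | ha A B hA hB => exact add_mem hA hB
  | hn A hA => exact neg_mem hA

/-- The functions on partial injections that are additive on disjoint unions of domains. -/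
def tightSubgroup (G : Type*) [AddCommGroup G] : AddSubgroup (Emb → G) where
  carrier := {F | ∀ (f : Emb) (A B : Set ℕ), Disjoint A B →
    F (f * Emb.idem (A ∪ B)) = F (f * Emb.idem A) + F (f * Emb.idem B)}
  zero_mem' f A B _ := (add_zero 0).symm
  add_mem' {F F'} hF hF' f A B h := by
    change F _ + F' _ = F _ + F' _ + (F _ + F' _)
    rw [hF f A B h, hF' f A B h, add_add_add_comm]
  neg_mem' {F} hF f A B h := by
    change -F _ = -F _ + -F _
    rw [hF f A B h, neg_add]

/-- The type of these functions. -/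
def TightFun (G : Type*) [AddCommGroup G] : Type _ := tightSubgroup G

namespace TightFun

variable {G : Type*} [AddCommGroup G]

instance : AddCommGroup (TightFun G) := inferInstanceAs (AddCommGroup (tightSubgroup G))

/-- The value of such a function at `f`. -/
def evalHom (f : Emb) : TightFun G →+ G := (Pi.evalAddMonoidHom (fun _ : Emb => G) f).comp (tightSubgroup G).subtype

instance : DistribMulAction Emb (TightFun G) where
  smul f F := ⟨fun g => F.1 (g * f), fun g A B h => by
    have e : ∀ A, g * Emb.idem A * f = g * f * Emb.idem (f.dag.image A) := fun A => by
      rw [mul_assoc, Emb.idem_mul, mul_assoc]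
    beta_reduce
    rw [e, e, e, Emb.image_union]
    exact F.2 _ _ _ (Emb.image_disjoint _ h)⟩
  one_smul F := Subtype.ext (funext fun g => congrArg F.1 (mul_one g))
  mul_smul f f' F := Subtype.ext (funext fun g => congrArg F.1 (mul_assoc g f f').symm)
  smul_zero _ := rfl
  smul_add _ _ _ := rfl

theorem tight : Tight (DistribMulAction.toAddMonoidEnd Emb (TightFun G)) := fun A B h =>
  AddMonoidHom.ext fun F => Subtype.ext (funext fun f => F.2 f A B h)

end TightFun

/-- A function on partial injections that is additive on disjoint unions of domains extends to `Γ`. -/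
theorem exists_hom {G : Type*} [AddCommGroup G] (F : Emb → G) (hF : ∀ (f : Emb) (A B : Set ℕ), Disjoint A B →
    F (f * Emb.idem (A ∪ B)) = F (f * Emb.idem A) + F (f * Emb.idem B)) :
    ∃ L : Gam →+ G, ∀ f, L (U f) = F f := by
  -- `Γ` acts on the tight functions by right translation of the argument; the action on `F`, evaluated at `1`, is `F`
  let F' : TightFun G := ⟨F, hF⟩
  let ev : AddMonoid.End (TightFun G) →+ TightFun G := AddMonoidHom.eval F'
  refine ⟨(TightFun.evalHom 1).comp (ev.comp (extend TightFun.tight).toAddMonoidHom), fun f => ?_⟩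
  have h : TightFun.evalHom 1 (extend TightFun.tight (U f) F') = F (1 * f) :=
    congrArg (TightFun.evalHom 1) (extend_U TightFun.tight f F')
  rw [one_mul] at h
  exact h

theorem LC_hom_ext {G : Type*} [AddCommGroup G] {f g : LC ℤ →+ G}
    (h : ∀ A, f (LC.ind ℤ A) = g (LC.ind ℤ A)) : f = g := by
  ext p
  induction p using LC.induction_on with
  | hz => rw [map_zero, map_zero]
  | hi c A => rw [LC.smul_eq, eq_intCast, ← zsmul_eq_mul, map_zsmul, map_zsmul, h]
  | ha α β hα hβ => rw [map_add, map_add, hα, hβ]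

end Gam

namespace Cross

variable {k X : Type*} [CommRing k] [AddCommGroup X] [Module (LC k) X]

theorem closure_range_tmul :
    AddSubgroup.closure (Set.range fun p : X × Emb => tmul k p.1 (Gam.U p.2)) = ⊤ := by
  refine (AddSubgroup.eq_top_iff' _).2 fun w => ?_
  induction w using induction_on with
  | h x f => exact AddSubgroup.subset_closure ⟨(x, f), rfl⟩
  | hz => exact zero_mem _
  | ha v w hv hw => exact add_mem hv hw

theorem hom_ext {G : Type*} [AddCommGroup G] {f g : Cross k X →+ G}
    (h : ∀ x u, f (tmul k x (Gam.U u)) = g (tmul k x (Gam.U u))) : f = g := by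
  refine AddMonoidHom.eq_of_eqOn_dense closure_range_tmul ?_
  rintro _ ⟨⟨x, u⟩, rfl⟩
  exact h x u

/-- A homomorphism out of `X #_𝒫 Γ` is given by its values at the elements `x # U f`, subject to additivity in
`x`, additivity on disjoint unions of domains in `f`, and `χ_A x # U f = x # χ_A U f`. -/
theorem exists_hom {G : Type*} [AddCommGroup G] (F : X → Emb → G)
    (hadd : ∀ x y f, F (x + y) f = F x f + F y f)
    (htight : ∀ x f (A B : Set ℕ), Disjoint A B →
      F x (f * Emb.idem (A ∪ B)) = F x (f * Emb.idem A) + F x (f * Emb.idem B))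
    (hbal : ∀ x f A, F (LC.ind k A • x) f = F x (Emb.idem A * f)) :
    ∃ L : Cross k X →+ G, ∀ x f, L (tmul k x (Gam.U f)) = F x f := by
  choose L hL using fun x => Gam.exists_hom (F x) (htight x)
  let L' : X →+ Gam →+ G := AddMonoidHom.mk' L fun x y => Gam.hom_ext fun f => by
    rw [AddMonoidHom.add_apply, hL, hL, hL, hadd]
  have hb : ∀ (p : LC ℤ) (x : X) (A : Gam), L' (LC.ofInt k p • x) A = L' x (Gam.diag p * A) := by
    intro p x A
    let u : LC ℤ →+ Gam →+ G := AddMonoidHom.mk' (fun p => L' (LC.ofInt k p • x)) fun p q => by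
      rw [map_add, add_smul, map_add]
    let v : LC ℤ →+ Gam →+ G := AddMonoidHom.mk' (fun p => (L' x).comp (AddMonoidHom.mulLeft (Gam.diag p)))
      fun p q => AddMonoidHom.ext fun A => by
        change L' x (Gam.diag (p + q) * A) = L' x (Gam.diag p * A) + L' x (Gam.diag q * A)
        rw [map_add, add_mul, map_add]
    have huv : u = v := Gam.LC_hom_ext fun B => Gam.hom_ext fun f => by
      change L (LC.ofInt k (LC.ind ℤ B) • x) (Gam.U f) = L x (Gam.diag (LC.ind ℤ B) * Gam.U f)
      rw [LC.ofInt_ind, Gam.diag_ind, ← map_mul, hL, hL, hbal]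
    exact DFunLike.congr_fun (DFunLike.congr_fun huv p) A
  exact ⟨liftHom L' hb, fun x f => hL x f⟩

end Cross

/-! ### Balanced maps from multiadditive maps -/

namespace IsMultiadditive

variable {A B N S G : Type*} [Ring A] [Ring B] [AddCommGroup N] [AddCommGroup G] {n : ℕ}

/-- Families of multiadditive maps that depend additively on a parameter in `B`. -/
structure Family (E : B → (Fin n → B) → N →+ G) : Prop where
  multiadditive : ∀ v, IsMultiadditive (E v)
  add : ∀ v w b, E (v + w) b = E v b + E w b

theorem Family.eq_of_generators {E E' : B → (Fin n → B) → N →+ G} (hE : Family E) (hE' : Family E')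
    {ι : A →+* B} {t : Set A} (ht : AddSubgroup.closure t = ⊤) {N₀ : Set N} (hN₀ : AddSubgroup.closure N₀ = ⊤)
    {s : S → B} (hs : AddSubgroup.closure (Set.range s) = ⊤)
    (h : ∀ a ∈ t, ∀ c ∈ N₀, ∀ b : Fin n → S, E (ι a) (s ∘ b) c = E' (ι a) (s ∘ b) c) (a : A) (b : Fin n → B) :
    E (ι a) b = E' (ι a) b := by
  let u : A →+ (N →+ G) := AddMonoidHom.mk' (fun a => E (ι a) b) fun a a' => by rw [map_add, hE.add]
  let u' : A →+ (N →+ G) := AddMonoidHom.mk' (fun a => E' (ι a) b) fun a a' => by rw [map_add, hE'.add]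
  have hu : u = u' := AddMonoidHom.eq_of_eqOn_dense ht fun a ha =>
    congrFun (ext hs (hE.multiadditive (ι a)) (hE'.multiadditive (ι a)) fun b =>
      AddMonoidHom.eq_of_eqOn_dense hN₀ fun c hc => h a ha c hc b) b
  exact DFunLike.congr_fun hu a

variable {T : (Fin n → B) → N →+ G}

theorem comp_update (hT : IsMultiadditive T) (j : Fin n) (u : B →+ B) :
    IsMultiadditive fun b => T (Function.update b j (u (b j))) := by
  have h := hT.comp_homs (Function.update (fun _ => AddMonoidHom.id B) j u)
  have e : ∀ b : Fin n → B, (fun i => Function.update (fun _ => AddMonoidHom.id B) j u i (b i)) =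
      Function.update b j (u (b j)) := fun b => funext fun i => by
    by_cases hi : i = j
    · subst hi
      rw [Function.update_self, Function.update_self]
    · rw [Function.update_of_ne hi, Function.update_of_ne hi]
      rfl
  simpa only [e] using h

theorem exists_family_rmul [Module Bᵐᵒᵖ N] (hT : IsMultiadditive T) (i : Fin (n + 1)) :
    ∃ E : B → (Fin n → B) → N →+ G, Family E ∧
      ∀ v b c, E v b c = T (rmul i v ((c, b) : Tup N B n)).2 (rmul i v ((c, b) : Tup N B n)).1 := by
  cases i using Fin.cases with
  | zero =>
    refine ⟨fun v b => (T b).comp (DistribSMul.toAddMonoidHom N (MulOpposite.op v)), ⟨fun v b j x y => ?_,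
      fun v w b => ?_⟩, fun v b c => rfl⟩
    · ext c
      exact DFunLike.congr_fun (hT b j x y) _
    · ext c
      change T b (MulOpposite.op (v + w) • c) = T b (MulOpposite.op v • c) + T b (MulOpposite.op w • c)
      rw [MulOpposite.op_add, add_smul, map_add]
  | succ l =>
    refine ⟨fun v b => T (Function.update b l (b l * v)), ⟨fun v => hT.comp_update l (AddMonoidHom.mulRight v),
      fun v w b => ?_⟩, fun v b c => rfl⟩
    rw [mul_add, hT]

theorem exists_family_lmul (hT : IsMultiadditive T) (j : Fin n) :
    ∃ E : B → (Fin n → B) → N →+ G, Family E ∧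
      ∀ v b c, E v b c = T (lmul j v ((c, b) : Tup N B n)).2 (lmul j v ((c, b) : Tup N B n)).1 := by
  refine ⟨fun v b => T (Function.update b j (v * b j)), ⟨fun v => hT.comp_update j (AddMonoidHom.mulLeft v),
    fun v w b => ?_⟩, fun v b c => rfl⟩
  rw [add_mul, hT]

theorem exists_family_lmulZero [Module B N] (hT : IsMultiadditive T) :
    ∃ E : B → (Fin n → B) → N →+ G, Family E ∧
      ∀ v b c, E v b c = T (lmulZero v ((c, b) : Tup N B n)).2 (lmulZero v ((c, b) : Tup N B n)).1 := by
  refine ⟨fun v b => (T b).comp (DistribSMul.toAddMonoidHom N v), ⟨fun v b j x y => ?_,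
    fun v w b => ?_⟩, fun v b c => rfl⟩
  · ext c
    exact DFunLike.congr_fun (hT b j x y) _
  · ext c
    change T b ((v + w) • c) = T b (v • c) + T b (w • c)
    rw [add_smul, map_add]

variable {ι : A →+* B} {t : Set A} {N₀ : Set N} {s : S → B}

/-- It suffices to check that a multiadditive map is balanced on generators. -/
theorem balanced [Module Bᵐᵒᵖ N] (ht : AddSubgroup.closure t = ⊤)
    (hN₀ : AddSubgroup.closure N₀ = ⊤) (hs : AddSubgroup.closure (Set.range s) = ⊤) (hT : IsMultiadditive T)
    (h : ∀ a ∈ t, ∀ c ∈ N₀, ∀ (b : Fin n → S) (j : Fin n),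
      T (rmul j.castSucc (ι a) ((c, s ∘ b) : Tup N B n)).2 (rmul j.castSucc (ι a) ((c, s ∘ b) : Tup N B n)).1 =
        T (lmul j (ι a) ((c, s ∘ b) : Tup N B n)).2 (lmul j (ι a) ((c, s ∘ b) : Tup N B n)).1) :
    Balanced ι fun x : Tup N B n => T x.2 x.1 where
  add_zero m m' b := map_add _ _ _
  add_succ m b j v w := DFunLike.congr_fun (hT b j v w) m
  bal := by
    rintro ⟨c, b⟩ j a
    obtain ⟨E, hE, hE'⟩ := hT.exists_family_rmul j.castSucc
    obtain ⟨F, hF, hF'⟩ := hT.exists_family_lmul j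
    rw [← hE', ← hF']
    exact DFunLike.congr_fun (hE.eq_of_generators hF ht hN₀ hs (fun a ha c hc b => by
      rw [hE', hF']
      exact h a ha c hc b j) a b) c

/-- It suffices to check that a multiadditive map is balanced in the cyclic sense on generators. -/
theorem cycBalanced [Module Bᵐᵒᵖ N] [Module B N] (ht : AddSubgroup.closure t = ⊤)
    (hN₀ : AddSubgroup.closure N₀ = ⊤) (hs : AddSubgroup.closure (Set.range s) = ⊤) (hT : IsMultiadditive T)
    (h : ∀ a ∈ t, ∀ c ∈ N₀, ∀ (b : Fin n → S) (j : Fin n),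
      T (rmul j.castSucc (ι a) ((c, s ∘ b) : Tup N B n)).2 (rmul j.castSucc (ι a) ((c, s ∘ b) : Tup N B n)).1 =
        T (lmul j (ι a) ((c, s ∘ b) : Tup N B n)).2 (lmul j (ι a) ((c, s ∘ b) : Tup N B n)).1)
    (h' : ∀ a ∈ t, ∀ c ∈ N₀, ∀ b : Fin n → S,
      T (lmulZero (ι a) ((c, s ∘ b) : Tup N B n)).2 (lmulZero (ι a) ((c, s ∘ b) : Tup N B n)).1 =
        T (rmul (Fin.last n) (ι a) ((c, s ∘ b) : Tup N B n)).2
          (rmul (Fin.last n) (ι a) ((c, s ∘ b) : Tup N B n)).1) :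
    CycBalanced ι fun x : Tup N B n => T x.2 x.1 where
  toBalanced := balanced ht hN₀ hs hT h
  cyc := by
    rintro ⟨c, b⟩ a
    obtain ⟨E, hE, hE'⟩ := hT.exists_family_lmulZero
    obtain ⟨F, hF, hF'⟩ := hT.exists_family_rmul (Fin.last n)
    rw [← hE', ← hF']
    exact DFunLike.congr_fun (hE.eq_of_generators hF ht hN₀ hs (fun a ha c hc b => by
      rw [hE', hF']
      exact h' a ha c hc b) a b) c

end IsMultiadditive

theorem Tup.HochGroup.closure_range_mk {A B N : Type*} [Ring A] [Ring B] {ι : A →+* B} [AddCommGroup N]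
    [Module B N] [Module Bᵐᵒᵖ N] {n : ℕ} :
    AddSubgroup.closure (Set.range (HochGroup.mk ι : Tup N B n → HochGroup ι N n)) = ⊤ := by
  have h : (QuotientAddGroup.mk' (AddSubgroup.closure (Set.range
      (HochGroup.mk ι : Tup N B n → HochGroup ι N n))) : HochGroup ι N n →+ _) = 0 :=
    HochGroup.hom_ext fun x => (QuotientAddGroup.eq_zero_iff (HochGroup.mk ι x)).2
      (AddSubgroup.subset_closure (Set.mem_range_self x))
  refine (AddSubgroup.eq_top_iff' _).2 fun c => ?_
  exact (QuotientAddGroup.eq_zero_iff c).1 (DFunLike.congr_fun h c)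

theorem LC.closure_range_ind : AddSubgroup.closure (Set.range (LC.ind ℤ)) = ⊤ := by
  refine (AddSubgroup.eq_top_iff' _).2 fun p => ?_
  induction p using LC.induction_on with
  | hz => exact zero_mem _
  | hi c A =>
    rw [LC.smul_eq, eq_intCast, ← zsmul_eq_mul]
    exact zsmul_mem (AddSubgroup.subset_closure (Set.mem_range_self A)) c
  | ha α β hα hβ => exact add_mem hα hβ

/-! ### The shear map -/

namespace Emb

/-- Only the part of `A` in the range of `f` matters for the preimage of `A`. -/
theorem dag_image_inter_image (f : Emb) (A : Set ℕ) : f.dag.image (A ∩ f.image Set.univ) = f.dag.image A := by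
  ext x
  simp only [mem_image, Set.mem_inter_iff, dag_app_eq]
  exact ⟨fun ⟨y, h, h'⟩ => ⟨y, h.1, h'⟩, fun ⟨y, h, h'⟩ => ⟨y, ⟨h, x, trivial, h'⟩, h'⟩⟩

variable {n : ℕ}

theorem seg_update_mul_idem (f : Fin n → Emb) (i : Fin n) (A : Set ℕ) {t : ℕ} (h : (i : ℕ) < t) :
    seg (Function.update f i (f i * idem A)) 0 t = idem ((seg f 0 (i + 1)).image A) * seg f 0 t := by
  rw [seg_update f i _ (Nat.zero_le _) h, ← mul_assoc, ← seg_succ f i, seg_mul_seg f (Nat.zero_le _) (Nat.le_succ _),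
    mul_idem, mul_assoc, seg_mul_seg f (Nat.zero_le _) h]

theorem partialProd_eq_seg (f : Fin n → Emb) (l : Fin (n + 1)) : Fin.partialProd f l = seg f 0 l := by
  induction l using Fin.induction with
  | zero => rw [Fin.partialProd_zero, Fin.val_zero, seg_self]
  | succ l ih =>
    rw [Fin.partialProd_succ, ih, Fin.val_succ, Fin.val_castSucc, ← seg_succ f l,
      seg_mul_seg f (Nat.zero_le _) (Nat.le_succ _)]

end Emb

namespace Cross

variable {k : Type*} [CommRing k]

section

variable {X : Type*} [AddCommGroup X] [Module (LC k) X]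

theorem tmul_idem_mul (A : Set ℕ) (x : X) (f : Emb) :
    tmul k x (Gam.U (Emb.idem A * f)) = tmul k (LC.ind k A • x) (Gam.U f) := by
  rw [map_mul, ind_smul_tmul]

/-- The part of the coefficient off the range of `f` does not matter. -/
theorem tmul_range_smul (f : Emb) (x : X) :
    tmul k (LC.ind k (f.image Set.univ) • x) (Gam.U f) = tmul k x (Gam.U f) := by
  rw [← tmul_idem_mul, Emb.idem_image_mul]

theorem tmul_mul_dag_smul (f : Emb) (p : LC k) (x : X) :
    tmul k ((f • f.dag • p) • x) (Gam.U f) = tmul k (p • x) (Gam.U f) := by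
  rw [← mul_smul f, Emb.mul_dag, LC.idem_smul, mul_smul, tmul_range_smul]

end

variable {R M : Type*} [Ring R] [Algebra (LC k) R] [DistribMulAction Emb R] [EmbBundle k R]
  [AddCommGroup M] [Module R M] [Module Rᵐᵒᵖ M] [SMulCommClass R Rᵐᵒᵖ M] [Module (LC k) M] [IsScalarTower (LC k) R M]
  [IsScalarTower (LC k) Rᵐᵒᵖ M] [DistribMulAction Emb M] [CovariantBimodule k R M] {n : ℕ}

theorem unit_apply (p : LC k) : unit k R p = tmul k (algebraMap (LC k) R p) (Gam.U 1) := by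
  rw [map_one]
  rfl

theorem unit_mul_tmul (p : LC k) (a : R) (f : Emb) :
    unit k R p * tmul k a (Gam.U f) = tmul k (p • a) (Gam.U f) := by
  rw [unit_apply, tmul_mul_tmul, one_smul, one_mul, Algebra.smul_def]

theorem tmul_mul_unit (p : LC k) (a : R) (f : Emb) :
    tmul k a (Gam.U f) * unit k R p = tmul k ((f • p) • a) (Gam.U f) := by
  rw [unit_apply, tmul_mul_tmul, mul_one, emb_smul_algebraMap, ← Algebra.commutes, Algebra.smul_def]

theorem unit_smul_tmul (p : LC k) (m : M) (f : Emb) :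
    unit k R p • tmul k m (Gam.U f) = tmul k (p • m) (Gam.U f) := by
  rw [unit_apply, tmul_smul_tmul, one_smul, one_mul, algebraMap_smul_coeff]

theorem op_unit_smul_tmul (p : LC k) (m : M) (f : Emb) :
    MulOpposite.op (unit k R p) • tmul k m (Gam.U f) = tmul k ((f • p) • m) (Gam.U f) := by
  rw [unit_apply, op_tmul_smul_tmul, mul_one, emb_smul_algebraMap, op_algebraMap_smul_coeff]

variable (k) in
/-- The tuple `(F_n†(m) # F_n†, a_1 # f_1, F_1†(a_2) # f_2, …, F_{n-1}†(a_n) # f_n)`, where `F_l = f_1 ⋯ f_l`. -/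
noncomputable def shear (f : Fin n → Emb) (x : Tup M R n) : Tup (Cross k M) (Cross k R) n :=
  (tmul k ((seg f 0 n).dag • x.1) (Gam.U (seg f 0 n).dag),
    fun i => tmul k ((seg f 0 i).dag • x.2 i) (Gam.U (f i)))

theorem seg_zero_succ (f : Fin n → Emb) (j : Fin n) : seg f 0 (j + 1) = seg f 0 j * f j := by
  rw [← seg_mul_seg f (Nat.zero_le _) (Nat.le_succ j), seg_succ]

theorem shear_update (f : Fin n → Emb) (m : M) (b : Fin n → R) (j : Fin n) (v : R) :
    shear k f (m, Function.update b j v) =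
      ((shear k f (m, b)).1, Function.update (shear k f (m, b)).2 j (tmul k ((seg f 0 j).dag • v) (Gam.U (f j)))) :=
  Prod.ext rfl (funext fun i =>
    Function.apply_update (fun (i : Fin n) v => tmul k ((seg f 0 i).dag • v) (Gam.U (f i))) b j v i)

/-- Coefficients in the `i`-th place are transported by `(f_1 ⋯ f_i)†`. -/
theorem shear_rmul (f : Fin n → Emb) (i : Fin (n + 1)) (p : LC k) (x : Tup M R n) :
    shear k f (rmul i (algebraMap (LC k) R p) x) = rmul i (unit k R ((seg f 0 i).dag • p)) (shear k f x) := by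
  have hR := EmbBundle.embModule k (R := R)
  have hM := CovariantBimodule.embModule k R (M := M)
  cases i using Fin.cases with
  | zero =>
    rw [rmul_zero, rmul_zero, Fin.val_zero, seg_self, Emb.dag_one, one_smul, op_algebraMap_smul_coeff]
    refine Prod.ext ?_ rfl
    refine Eq.trans ?_ (op_unit_smul_tmul p ((seg f 0 n).dag • x.1) (seg f 0 n).dag).symm
    rw [← hM.smul_smul]
    rfl
  | succ j =>
    have h : tmul k ((seg f 0 j).dag • (x.2 j * algebraMap (LC k) R p)) (Gam.U (f j)) =
        tmul k ((seg f 0 j).dag • x.2 j) (Gam.U (f j)) * unit k R ((seg f 0 (j + 1)).dag • p) := by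
      rw [tmul_mul_unit, seg_zero_succ, Emb.dag_mul, mul_smul, tmul_mul_dag_smul, ← hR.smul_smul, ← Algebra.commutes,
        Algebra.smul_def]
    rw [rmul_succ, rmul_succ, shear_update, h]
    rfl

theorem shear_lmul (f : Fin n → Emb) (j : Fin n) (p : LC k) (x : Tup M R n) :
    shear k f (lmul j (algebraMap (LC k) R p) x) = lmul j (unit k R ((seg f 0 j).dag • p)) (shear k f x) := by
  have hR := EmbBundle.embModule k (R := R)
  have h : tmul k ((seg f 0 j).dag • (algebraMap (LC k) R p * x.2 j)) (Gam.U (f j)) =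
      unit k R ((seg f 0 j).dag • p) * tmul k ((seg f 0 j).dag • x.2 j) (Gam.U (f j)) := by
    rw [unit_mul_tmul, ← hR.smul_smul, Algebra.smul_def]
  unfold lmul
  rw [shear_update, h]
  rfl

theorem shear_lmulZero (f : Fin n → Emb) (p : LC k) (x : Tup M R n) :
    shear k f (lmulZero (algebraMap (LC k) R p) x) = lmulZero (unit k R ((seg f 0 n).dag • p)) (shear k f x) := by
  have hM := CovariantBimodule.embModule k R (M := M)
  refine Prod.ext ?_ rfl
  refine Eq.trans ?_ (unit_smul_tmul ((seg f 0 n).dag • p) ((seg f 0 n).dag • x.1) (seg f 0 n).dag).symm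
  rw [← hM.smul_smul, ← algebraMap_smul_coeff (R := R)]
  rfl

variable (k R M) in
theorem cycBalanced_shear (f : Fin n → Emb) : CycBalanced (algebraMap (LC k) R)
    fun x : Tup M R n => HochGroup.mk (unit k R) (shear k f x) := by
  have hc : CycBalanced (unit k R) (HochGroup.mk (unit k R) : Tup (Cross k M) (Cross k R) n → _) :=
    HochGroup.cycBalanced_mk
  refine ⟨⟨fun m m' b => ?_, fun m b j v w => ?_, fun x j p => ?_⟩, fun x p => ?_⟩
  · have h : shear k f (m + m', b) = ((shear k f (m, b)).1 + (shear k f (m', b)).1, (shear k f (m, b)).2) := by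
      refine Prod.ext ?_ rfl
      change tmul k ((seg f 0 n).dag • (m + m')) _ = _
      rw [smul_add, add_tmul]
      rfl
    rw [h, hc.add_zero]
    rfl
  · rw [shear_update, shear_update, shear_update, smul_add, add_tmul, hc.add_succ]
  · rw [shear_rmul, shear_lmul, hc.bal]
    rfl
  · rw [shear_lmulZero, shear_rmul, hc.cyc]
    rfl

variable (k R M) in
/-- The value of the shear map at fixed partial injections. -/
noncomputable def shearHom (f : Fin n → Emb) :
    HochGroup (algebraMap (LC k) R) M n →+ HochGroup (unit k R) (Cross k M) n :=
  HochGroup.lift (cycBalanced_shear k R M f)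

theorem shearHom_mk (f : Fin n → Emb) (x : Tup M R n) :
    shearHom k R M f (HochGroup.mk _ x) = HochGroup.mk _ (shear k f x) :=
  HochGroup.lift_mk _ x

theorem unit_ind_mul (f : Fin n → Emb) (B : Set ℕ) (j : Fin n) (a : R) :
    unit k R (LC.ind k ((seg f 0 j).dag.image B)) * tmul k a (Gam.U (f j)) =
      tmul k a (Gam.U (f j)) * unit k R (LC.ind k ((seg f 0 (j + 1)).dag.image B)) := by
  rw [unit_mul_tmul, tmul_mul_unit, seg_zero_succ, Emb.dag_mul, Emb.image_mul, ← LC.emb_smul_ind (f j).dag,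
    tmul_mul_dag_smul]

/-- Restriction of the domain of `f_{i+1}` to `A` amounts to restriction of the coefficients to
`f_1 ⋯ f_{i+1}(A)`. -/
theorem shearHom_update (f : Fin n → Emb) (i : Fin n) (A : Set ℕ) (m : M) (a : Fin n → R) :
    shearHom k R M (Function.update f i (f i * Emb.idem A)) (HochGroup.mk _ (m, a)) =
      shearHom k R M f (HochGroup.mk _ (LC.ind k ((seg f 0 (i + 1)).image A) • m, a)) := by
  have hR := EmbBundle.embModule k (R := R)
  have hM := CovariantBimodule.embModule k R (M := M)
  have hc : CycBalanced (unit k R) (HochGroup.mk (unit k R) : Tup (Cross k M) (Cross k R) n → _) :=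
    HochGroup.cycBalanced_mk
  set B : Set ℕ := (seg f 0 (i + 1)).image A with hB
  set f' := Function.update f i (f i * Emb.idem A) with hf'
  have hseg : ∀ l : ℕ, seg f' 0 l = if (i : ℕ) < l then Emb.idem B * seg f 0 l else seg f 0 l := by
    intro l
    split_ifs with h
    · exact Emb.seg_update_mul_idem f i A h
    · exact seg_update_of_not f i _ (by omega)
  have h0 : LC.ind k ((seg f 0 ((0 : Fin (n + 1)) : ℕ)).dag.image B) = LC.ind k B := by
    rw [Fin.val_zero, seg_self, Emb.dag_one, Emb.image_one]
  have h1 : shear k f (LC.ind k B • m, a) =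
      rmul 0 (unit k R (LC.ind k ((seg f 0 ((0 : Fin (n + 1)) : ℕ)).dag.image B))) (shear k f (m, a)) := by
    have h := shear_rmul f 0 (LC.ind k B) (m, a)
    rw [rmul_zero, op_algebraMap_smul_coeff, LC.emb_smul_ind] at h
    exact h
  have h2 : shear k f' (m, a) = rmul 0 (unit k R (LC.ind k ((seg f 0 ((0 : Fin (n + 1)) : ℕ)).dag.image B)))
      ((shear k f (m, a)).1, (shear k f' (m, a)).2) := by
    refine Prod.ext ?_ rfl
    rw [h0]
    refine Eq.trans ?_ (op_unit_smul_tmul (LC.ind k B) ((seg f 0 n).dag • m) (seg f 0 n).dag).symm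
    change tmul k ((seg f' 0 n).dag • m) (Gam.U (seg f' 0 n).dag) = _
    rw [hseg, if_pos i.2, Emb.dag_mul, Emb.dag_idem, mul_smul, hM.idem_smul, hM.smul_smul, Emb.mul_idem,
      tmul_idem_mul, LC.emb_smul_ind, ← mul_smul, ind_mul_self]
  rw [shearHom_mk, shearHom_mk, h1, h2]
  refine (hc.toBalanced.congr_of_rmul (shear k f (m, a)).1 (shear k f (m, a)).2 (shear k f' (m, a)).2
    (fun l => LC.ind k ((seg f 0 l).dag.image B)) (fun j => ?_) fun j => ?_).symm
  · exact unit_ind_mul f B j _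
  · change _ * tmul k ((seg f 0 j).dag • a j) (Gam.U (f j)) =
      _ * tmul k ((seg f' 0 j).dag • a j) (Gam.U (f' j))
    rw [unit_mul_tmul, unit_mul_tmul, Fin.val_castSucc, hseg]
    by_cases hj : i = j
    · subst hj
      rw [if_neg (lt_irrefl _), hf', Function.update_self]
      rw [← tmul_idem_mul, ← tmul_idem_mul]
      congr 2
      have h3 : (seg f 0 i).dag.image B ∩ (f i).image A = (seg f 0 i).dag.image B := by
        rw [hB, seg_zero_succ, Emb.image_mul, Emb.dag_image_image]
        exact Set.inter_eq_left.2 Set.inter_subset_left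
      rw [Emb.mul_idem, ← mul_assoc, Emb.idem_mul_idem, h3]
    · rw [hf', Function.update_of_ne (Ne.symm hj)]
      split_ifs with h
      · rw [Emb.dag_mul, Emb.dag_idem, mul_smul, hR.idem_smul, hR.smul_smul, LC.emb_smul_ind, ← mul_smul,
          ind_mul_self]
      · rfl

theorem shearHom_update' (f : Fin n → Emb) (i : Fin n) (A : Set ℕ) (m : M) (a : Fin n → R) :
    shearHom k R M (Function.update f i (Emb.idem A * f i)) (HochGroup.mk _ (m, a)) =
      shearHom k R M f (HochGroup.mk _ (LC.ind k ((seg f 0 i).image A) • m, a)) := by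
  have hM := CovariantBimodule.embModule k R (M := M)
  rw [Emb.idem_mul, shearHom_update, shearHom_mk, shearHom_mk]
  refine congrArg _ (Prod.ext ?_ rfl)
  change tmul k ((seg f 0 n).dag • _ • m) _ = tmul k ((seg f 0 n).dag • _ • m) _
  rw [hM.smul_smul, hM.smul_smul, LC.emb_smul_ind, LC.emb_smul_ind]
  refine congrArg (fun A => tmul k (LC.ind k A • (seg f 0 n).dag • m) (Gam.U (seg f 0 n).dag)) ?_
  -- the range of `f_1 ⋯ f_n` is contained in that of `f_1 ⋯ f_{i+1}`
  rw [seg_split f i (Nat.zero_le _) i.2, seg_zero_succ]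
  simp only [Emb.dag_mul, Emb.image_mul, Emb.image_dag_image]
  rw [Emb.dag_image_image, Emb.dag_image_image, Set.inter_right_comm, Emb.dag_image_inter_image]

end Cross

/-! ### The shear map on tensor products -/

theorem seg_U {n : ℕ} (f : Fin n → Emb) (s t : ℕ) : seg (fun i => Gam.U (f i)) s t = Gam.U (seg f s t) := by
  unfold seg
  rw [map_list_prod, List.map_map]
  congr 1
  apply List.map_congr_left
  intro l _
  simp only [Function.comp_apply]
  split_ifs
  · rfl
  · rw [map_one]

theorem seg_succ_right {B : Type*} [Monoid B] {n : ℕ} (b : Fin n → B) (j : Fin n) {s : ℕ} (h : s ≤ j) :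
    seg b s (j + 1) = seg b s j * b j := by
  rw [← seg_mul_seg b h (Nat.le_succ j), seg_succ]

namespace Tup

variable {A B N : Type*} [Ring A] [Ring B] {ι : A →+* B} [AddCommGroup N] [Module Bᵐᵒᵖ N] {n : ℕ}

theorem TensorGroup.hom_ext_of_closure {S G : Type*} [AddCommGroup G] {N₀ : Set N}
    (hN₀ : AddSubgroup.closure N₀ = ⊤) {s : S → B} (hs : AddSubgroup.closure (Set.range s) = ⊤)
    {f g : TensorGroup ι N n →+ G}
    (h : ∀ c ∈ N₀, ∀ b : Fin n → S, f (TensorGroup.mk ι (c, s ∘ b)) = g (TensorGroup.mk ι (c, s ∘ b))) : f = g := by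
  have hb := TensorGroup.balanced_mk (ι := ι) (N := N) (n := n)
  have key : ∀ f : TensorGroup ι N n →+ G, ∃ T : (Fin n → B) → N →+ G, IsMultiadditive T ∧
      ∀ b c, T b c = f (TensorGroup.mk ι (c, b)) := fun f =>
    ⟨fun b => AddMonoidHom.mk' (fun c => f (TensorGroup.mk ι (c, b))) fun c c' => by rw [hb.add_zero, map_add],
      fun b j v w => AddMonoidHom.ext fun c => (congrArg f (hb.add_succ c b j v w)).trans (map_add f _ _),
      fun _ _ => rfl⟩
  obtain ⟨T, hT, hT'⟩ := key f
  obtain ⟨T', hT₁, hT₁'⟩ := key g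
  have : T = T' := hT.ext hs hT₁ fun b => AddMonoidHom.eq_of_eqOn_dense hN₀ fun c hc => by
    rw [hT', hT₁', h c hc]
  apply TensorGroup.hom_ext
  rintro ⟨c, b⟩
  rw [← hT', ← hT₁', this]

theorem HochGroup.hom_ext_of_closure [Module B N] {S G : Type*} [AddCommGroup G] {N₀ : Set N}
    (hN₀ : AddSubgroup.closure N₀ = ⊤) {s : S → B} (hs : AddSubgroup.closure (Set.range s) = ⊤)
    {f g : HochGroup ι N n →+ G}
    (h : ∀ c ∈ N₀, ∀ b : Fin n → S, f (HochGroup.mk ι (c, s ∘ b)) = g (HochGroup.mk ι (c, s ∘ b))) : f = g := by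
  have hb := (HochGroup.cycBalanced_mk (ι := ι) (N := N) (n := n)).toBalanced
  have key : (f.comp (TensorGroup.lift hb)) = g.comp (TensorGroup.lift hb) :=
    TensorGroup.hom_ext_of_closure hN₀ hs fun c hc b => by
      rw [AddMonoidHom.comp_apply, AddMonoidHom.comp_apply, TensorGroup.lift_mk]
      exact h c hc b
  apply HochGroup.hom_ext
  intro x
  have := DFunLike.congr_fun key (TensorGroup.mk ι x)
  rwa [AddMonoidHom.comp_apply, AddMonoidHom.comp_apply, TensorGroup.lift_mk] at this

end Tup

namespace Cross

variable {k : Type*} [CommRing k] {R M : Type*} [Ring R] [Algebra (LC k) R] [DistribMulAction Emb R] [EmbBundle k R]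
  [AddCommGroup M] [Module R M] [Module Rᵐᵒᵖ M] [SMulCommClass R Rᵐᵒᵖ M] [Module (LC k) M] [IsScalarTower (LC k) R M]
  [IsScalarTower (LC k) Rᵐᵒᵖ M] [DistribMulAction Emb M] [CovariantBimodule k R M] {n p q : ℕ}

variable (k R M) in
/-- The shear map is additive on disjoint unions of domains of `f_i`, as restriction of the domain amounts to
multiplication of the coefficient by a characteristic function. -/
theorem shearHom_tight (f : Fin n → Emb) (i : Fin n) :
    ∃ L : Gam →+ HochGroup (algebraMap (LC k) R) M n →+ HochGroup (unit k R) (Cross k M) n,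
      ∀ v, L (Gam.U v) = shearHom k R M (Function.update f i v) := by
  have hc : CycBalanced (algebraMap (LC k) R) (HochGroup.mk (algebraMap (LC k) R) : Tup M R n → _) :=
    HochGroup.cycBalanced_mk
  refine Gam.exists_hom (fun v => shearHom k R M (Function.update f i v)) fun v A B h => ?_
  have e : ∀ A, shearHom k R M (Function.update f i (v * Emb.idem A)) =
      shearHom k R M (Function.update (Function.update f i v) i (Function.update f i v i * Emb.idem A)) := fun A => by
    rw [Function.update_self, Function.update_idem]
  apply HochGroup.hom_ext
  rintro ⟨m, a⟩
  rw [e, e, e, AddMonoidHom.add_apply, shearHom_update, shearHom_update, shearHom_update, ← map_add,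
    ← hc.add_zero, ← add_smul, Emb.image_union, LC.ind_union (Emb.image_disjoint _ h)]

variable (k R M n) in
theorem exists_shearMulti : ∃ T : (Fin n → Gam) →
    HochGroup (algebraMap (LC k) R) M n →+ HochGroup (unit k R) (Cross k M) n,
    IsMultiadditive T ∧ ∀ f, T (Gam.U ∘ f) = shearHom k R M f :=
  IsMultiadditive.exists_extension Gam.closure_range_U _ (shearHom_tight k R M)

variable (k R M n) in
/-- The multiadditive extension of the shear map to `Γ`. -/
noncomputable def shearMulti : (Fin n → Gam) →
    HochGroup (algebraMap (LC k) R) M n →+ HochGroup (unit k R) (Cross k M) n :=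
  (exists_shearMulti k R M n).choose

theorem shearMulti_U (f : Fin n → Emb) : shearMulti k R M n (Gam.U ∘ f) = shearHom k R M f :=
  (exists_shearMulti k R M n).choose_spec.2 f

variable (k R M n) in
theorem balanced_shearMulti : Balanced Gam.augmented.incl
    fun x : Tup (HochGroup (algebraMap (LC k) R) M n) Gam n => shearMulti k R M n x.2 x.1 := by
  refine IsMultiadditive.balanced LC.closure_range_ind HochGroup.closure_range_mk Gam.closure_range_U
    (exists_shearMulti k R M n).choose_spec.1 ?_
  rintro _ ⟨A, rfl⟩ _ ⟨⟨m, a⟩, rfl⟩ f j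
  have hA : Gam.augmented.incl (LC.ind ℤ A) = Gam.U (Emb.idem A) := Gam.diag_ind A
  have hcomp : ∀ (f : Fin n → Emb) (j : Fin n) (v : Emb), Function.update (Gam.U ∘ f) j (Gam.U v) =
      Gam.U ∘ Function.update f j v := fun f j v => (Function.comp_update Gam.U f j v).symm
  rw [hA]
  have hr : shearMulti k R M n (lmul j (Gam.U (Emb.idem A))
      ((HochGroup.mk (algebraMap (LC k) R) (m, a), Gam.U ∘ f) : Tup _ Gam n)).2
        (HochGroup.mk (algebraMap (LC k) R) (m, a)) =
      shearHom k R M f (HochGroup.mk _ (LC.ind k ((seg f 0 j).image A) • m, a)) := by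
    rw [← shearHom_update', ← shearMulti_U, ← hcomp, map_mul]
    rfl
  refine Eq.trans ?_ hr.symm
  cases n with
  | zero => exact j.elim0
  | succ n =>
    cases j using Fin.cases with
    | zero =>
      rw [Fin.castSucc_zero, Fin.val_zero, seg_self, Emb.image_one]
      change shearMulti k R M (n + 1) (Gam.U ∘ f) (MulOpposite.op (Gam.U (Emb.idem A)) • HochGroup.mk _ (m, a)) = _
      rw [shearMulti_U, op_U_smul, Emb.dag_idem, embHoch_idem]
    | succ j =>
      rw [← Fin.succ_castSucc, rmul_succ]
      have h := shearHom_update (k := k) (R := R) (M := M) f j.castSucc A m a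
      rw [← shearMulti_U, ← hcomp, map_mul] at h
      exact h

variable (k R M n) in
/-- The map `φ` in degree `n`. -/
noncomputable def shearMap : TensorGroup Gam.augmented.incl (HochGroup (algebraMap (LC k) R) M n) n →+
    HochGroup (unit k R) (Cross k M) n :=
  TensorGroup.lift (balanced_shearMulti k R M n)

theorem shearMap_mk (c : HochGroup (algebraMap (LC k) R) M n) (f : Fin n → Emb) :
    shearMap k R M n (TensorGroup.mk _ (c, fun i => Gam.U (f i))) = shearHom k R M f c :=
  (TensorGroup.lift_mk _ _).trans (DFunLike.congr_fun (shearMulti_U f) c)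

theorem diag_hom_ext {G : Type*} [AddCommGroup G]
    {u v : TensorGroup Gam.augmented.incl (HochGroup (algebraMap (LC k) R) M q) n →+ G}
    (h : ∀ (x : Tup M R q) (f : Fin n → Emb),
      u (TensorGroup.mk _ (HochGroup.mk _ x, fun i => Gam.U (f i))) =
        v (TensorGroup.mk _ (HochGroup.mk _ x, fun i => Gam.U (f i)))) : u = v := by
  refine TensorGroup.hom_ext_of_closure HochGroup.closure_range_mk Gam.closure_range_U ?_
  rintro _ ⟨x, rfl⟩ f
  exact h x f

/-! ### Compatibility with the simplicial operators -/

/-- The product of consecutive factors of `shear k f x`. In the product `F_s†` is followed by `F_s`, so that the formula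
holds over the domain of `F_s` only. -/
theorem seg_shear (f : Fin n → Emb) (x : Tup M R n) {s t : ℕ} (hst : s ≤ t) (ht : t ≤ n) :
    unit k R (LC.ind k ((seg f 0 s).dag.image Set.univ)) * seg (shear k f x).2 s t =
      tmul k ((seg f 0 s).dag • seg x.2 s t) (Gam.U (seg f s t)) := by
  have hR := EmbBundle.embModule k (R := R)
  induction t, hst using Nat.le_induction with
  | base =>
    rw [seg_self, seg_self, seg_self, mul_one, unit_apply, EmbBundle.emb_one k, Algebra.algebraMap_eq_smul_one]
  | succ t hst ih =>
    let j : Fin n := ⟨t, ht⟩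
    have hx : (shear k f x).2 j = tmul k ((seg f 0 t).dag • x.2 j) (Gam.U (f j)) := rfl
    rw [seg_succ_right _ j hst, seg_succ_right _ j hst, seg_succ_right _ j hst, ← mul_assoc, ih (by omega), hx, tmul_mul_tmul,
      ← seg_mul_seg f (Nat.zero_le s) hst, Emb.dag_mul, ← mul_smul, ← mul_assoc, Emb.mul_dag, mul_smul,
      hR.idem_smul, mul_smul_comm, ← EmbBundle.emb_mul k, ← tmul_idem_mul, ← mul_assoc, Emb.idem_image_mul]

/-- The product of the last factors of `shear k f x` with the zeroth one. The zeroth factor, or the first of the last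
ones, is supported on the domain of `F_s`, so that there is no restriction as in `seg_shear`. -/
theorem seg_shear_smul (f : Fin n → Emb) (x : Tup M R n) {s : ℕ} (hs : s ≤ n) (m : M) (g : Emb) :
    seg (shear k f x).2 s n • tmul k ((seg f 0 n).dag • m) (Gam.U ((seg f 0 n).dag * g)) =
      tmul k ((seg f 0 s).dag • seg x.2 s n • m) (Gam.U (seg f s n * (seg f 0 n).dag * g)) := by
  have hR := EmbBundle.embModule k (R := R)
  have hM := CovariantBimodule.embModule k R (M := M)
  have h : seg (shear k f x).2 s n • tmul k ((seg f 0 n).dag • m) (Gam.U ((seg f 0 n).dag * g)) =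
      (unit k R (LC.ind k ((seg f 0 s).dag.image Set.univ)) * seg (shear k f x).2 s n) •
        tmul k ((seg f 0 n).dag • m) (Gam.U ((seg f 0 n).dag * g)) := by
    rcases hs.eq_or_lt with rfl | hs
    · rw [seg_self, one_smul, mul_one, unit_smul_tmul, hM.ran]
    · have hx : (shear k f x).2 ⟨s, hs⟩ = tmul k ((seg f 0 s).dag • x.2 ⟨s, hs⟩) (Gam.U (f ⟨s, hs⟩)) := rfl
      have hseg := seg_split (shear k f x).2 ⟨s, hs⟩ (le_refl s) hs
      rw [hseg, seg_self, one_mul, ← mul_assoc, hx, unit_mul_tmul, hR.ran]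
  have h1 : seg f s n • (seg f 0 n).dag • m = LC.ind k ((seg f s n).image Set.univ) • (seg f 0 s).dag • m := by
    rw [← seg_mul_seg f (Nat.zero_le s) hs, Emb.dag_mul, ← mul_smul, ← mul_assoc, Emb.mul_dag, mul_smul, hM.idem_smul]
  have hl : ∀ (c : LC k) (a : R) (m : M), a • c • m = c • a • m := fun c a m => by
    rw [← op_algebraMap_smul_coeff (R := R) c, smul_comm, op_algebraMap_smul_coeff]
  rw [h, seg_shear f x hs le_rfl, tmul_smul_tmul, h1, hl, ← CovariantBimodule.emb_smul k R, ← tmul_idem_mul,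
    ← mul_assoc, ← mul_assoc, Emb.idem_image_mul]

end Cross

namespace Cross

variable {k : Type*} [CommRing k] {R M : Type*} [Ring R] [Algebra (LC k) R] [DistribMulAction Emb R] [EmbBundle k R]
  [AddCommGroup M] [Module R M] [Module Rᵐᵒᵖ M] [SMulCommClass R Rᵐᵒᵖ M] [Module (LC k) M] [IsScalarTower (LC k) R M]
  [IsScalarTower (LC k) Rᵐᵒᵖ M] [DistribMulAction Emb M] [CovariantBimodule k R M] {n p q : ℕ}

/-- The last factors of the operator of `⊥(Γ/𝒫, -)`, moved to the front. -/
theorem mk_barOp_U (θ : Fin (p + 1) →o Fin (q + 1)) (c : HochGroup (algebraMap (LC k) R) M n) (f : Fin q → Emb) :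
    TensorGroup.mk Gam.augmented.incl (Gam.augmented.barOp θ (c, fun i => Gam.U (f i))) =
      TensorGroup.mk Gam.augmented.incl (embHoch k R M n (Emb.idem ((seg f (θ 0) q).image Set.univ))
        (embHoch k R M n (seg f 0 (θ 0)).dag c), fun i => Gam.U (pull θ f i)) := by
  have hb := TensorGroup.balanced_mk (ι := Gam.augmented.incl) (N := HochGroup (algebraMap (LC k) R) M n) (n := p)
  let e : Fin (p + 1) → LC ℤ := fun l => LC.ind ℤ ((seg f (θ l) q).image Set.univ)
  have hplain : plain θ ((c, fun i => Gam.U (f i)) : Tup (HochGroup (algebraMap (LC k) R) M n) Gam q) =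
      (embHoch k R M n (seg f 0 (θ 0)).dag c, fun i => Gam.U (pull θ f i)) := by
    refine Prod.ext ?_ (funext fun i => seg_U f _ _)
    rw [← op_U_smul, ← seg_U]
    rfl
  have htail : Gam.augmented.aug (tail θ ((c, fun i => Gam.U (f i)) : Tup (HochGroup (algebraMap (LC k) R) M n) Gam q)) =
      e (Fin.last p) := by
    change _ = LC.ind ℤ ((seg f (θ (Fin.last p)) q).image Set.univ)
    rw [← Gam.augmented_aug_U, ← seg_U]
    rfl
  have hind : ∀ A, Gam.augmented.incl (LC.ind ℤ A) = Gam.U (Emb.idem A) := Gam.diag_ind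
  unfold AugmentedAlgebra.barOp
  rw [htail, hplain, ← hb.rmul_shift _ e (Fin.last p) fun i _ => ?_]
  · rw [rmul_zero, hind, op_U_smul, Emb.dag_idem]
  · have h : (θ i.castSucc : ℕ) ≤ θ i.succ := le_map_iff θ i
    have h' : (θ i.succ : ℕ) ≤ q := Fin.is_le _
    change Gam.augmented.incl (LC.ind ℤ _) * Gam.U (seg f _ _) = Gam.U (seg f _ _) * Gam.augmented.incl (LC.ind ℤ _)
    rw [hind, hind, ← map_mul, ← map_mul, Emb.mul_idem, ← Emb.image_mul, seg_mul_seg f h h']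

/-- The effect on coefficients of moving the first and the last factors to the front. -/
theorem pull_dag_smul {X : Type*} [AddCommGroup X] [Module (LC k) X] [DistribMulAction Emb X] (hX : EmbModule k X)
    (θ : Fin (p + 1) →o Fin (q + 1)) (f : Fin q → Emb) (l : Fin (p + 1)) (a : X) :
    (seg (pull θ f) 0 l).dag • Emb.idem ((seg f (θ 0) q).image Set.univ) • (seg f 0 (θ 0)).dag • a =
      LC.ind k ((seg f 0 (θ l)).dag.image ((seg f 0 q).image Set.univ)) • (seg f 0 (θ l)).dag • a := by
  have h0 : (θ 0 : ℕ) ≤ θ l := Fin.le_def.1 (θ.monotone (Fin.zero_le l))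
  have h1 : seg (pull θ f) 0 l = seg f (θ 0) (θ l) := seg_pull θ f 0 l (Fin.zero_le l)
  have h2 : (seg f (θ 0) (θ l)).dag * Emb.idem ((seg f (θ 0) q).image Set.univ) * (seg f 0 (θ 0)).dag =
      (seg f 0 (θ l)).dag * Emb.idem ((seg f 0 q).image Set.univ) := by
    rw [mul_assoc, ← seg_mul_seg f (Nat.zero_le _) h0, Emb.dag_mul, mul_assoc,
      ← Emb.dag_idem ((seg f 0 q).image Set.univ), ← Emb.dag_mul,
      ← Emb.dag_idem ((seg f (θ 0) q).image Set.univ), ← Emb.dag_mul, Emb.mul_idem, ← Emb.image_mul,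
      seg_mul_seg f (Nat.zero_le _) (Fin.is_le _)]
  rw [h1, ← mul_smul, ← mul_smul, h2, mul_smul, hX.idem_smul, hX.smul_smul, LC.emb_smul_ind]

theorem hochOp_shear_fst (θ : Fin (p + 1) →o Fin (q + 1)) (f : Fin q → Emb) (x : Tup M R q) :
    (hochOp (Cross k R) (Cross k M) θ (shear k f x)).1 =
      tmul k ((seg f 0 (θ (Fin.last p))).dag • (hochOp R M θ x).1)
        (Gam.U (seg f (θ (Fin.last p)) q * (seg f 0 q).dag * seg f 0 (θ 0))) := by
  have h := seg_shear (k := k) f x (Nat.zero_le (θ 0)) (Fin.is_le (θ 0))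
  rw [seg_self, Emb.dag_one, Emb.image_one, LC.ind_univ, map_one, one_mul, one_smul] at h
  change seg (shear k f x).2 (θ (Fin.last p)) q • MulOpposite.op (seg (shear k f x).2 0 (θ 0)) •
    tmul k ((seg f 0 q).dag • x.1) (Gam.U (seg f 0 q).dag) = _
  rw [h, op_tmul_smul_tmul, ← CovariantBimodule.emb_op_smul k R]
  exact seg_shear_smul f x (Fin.is_le _) _ _

/-- The domain of `c b† a` is contained in `a†(ran b)`, so that the characteristic function of this set acts from the
right as the identity. -/
theorem op_unit_smul_tmul_self (a b c : Emb) (m : M) :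
    MulOpposite.op (unit k R (LC.ind k (a.dag.image (b.image Set.univ)))) • tmul k m (Gam.U (c * b.dag * a)) =
      tmul k m (Gam.U (c * b.dag * a)) := by
  have h : (c * b.dag * a).image (a.dag.image (b.image Set.univ)) = (c * b.dag * a).image Set.univ := by
    rw [Emb.image_mul, Emb.image_mul _ a, Emb.image_dag_image, Emb.image_mul, Emb.image_mul, Set.inter_comm,
      Emb.dag_image_inter_image]
  rw [op_unit_smul_tmul, LC.emb_smul_ind, h, tmul_range_smul]

/-- Both sides are the restriction of `b†` to the domain of `a`, with values in the range of `c`. -/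
theorem _root_.Emb.idem_mul_dag_eq (a b c : Emb) :
    Emb.idem ((a * b).dag.image ((a * b * c).image Set.univ)) * b.dag = c * (a * b * c).dag * a := by
  rw [Emb.image_mul (a * b) c, Emb.dag_image_image, Emb.dag_mul (a * b) c, ← mul_assoc, Emb.mul_dag, Emb.dag_mul,
    Emb.image_mul, mul_assoc, mul_assoc b.dag, ← Emb.idem_mul_idem, mul_assoc, ← Emb.mul_idem]
  have h := Emb.mul_dag a.dag
  rw [Emb.dag_dag] at h
  rw [h]

/-- The shear map takes the operator of the diagonal to that of the Hochschild complex. The zeroth factors of both tuples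
agree; the other ones agree over the preimages `F_θ(l)†(ran F_q)`, and these can be moved to the zeroth factor, which is
supported on the first of them. -/
theorem mk_shear_pull (θ : Fin (p + 1) →o Fin (q + 1)) (f : Fin q → Emb) (x : Tup M R q) :
    HochGroup.mk (unit k R) (shear k (pull θ f) (embTup (Emb.idem ((seg f (θ 0) q).image Set.univ))
      (embTup (seg f 0 (θ 0)).dag (hochOp R M θ x)))) =
      HochGroup.mk (unit k R) (hochOp (Cross k R) (Cross k M) θ (shear k f x)) := by
  have hR := EmbBundle.embModule k (R := R)
  have hM := CovariantBimodule.embModule k R (M := M)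
  have hc : CycBalanced (unit k R) (HochGroup.mk (unit k R) : Tup (Cross k M) (Cross k R) p → _) :=
    HochGroup.cycBalanced_mk
  have h0 : (θ 0 : ℕ) ≤ θ (Fin.last p) := Fin.le_def.1 (θ.monotone (Fin.zero_le _))
  obtain ⟨D, hD⟩ : ∃ D, D = (seg f 0 q).image Set.univ := ⟨_, rfl⟩
  obtain ⟨e, he⟩ : ∃ e : Fin (p + 1) → LC k, ∀ l, e l = LC.ind k ((seg f 0 (θ l)).dag.image D) := ⟨_, fun _ => rfl⟩
  obtain ⟨y, hy⟩ : ∃ y : Fin p → Cross k R, ∀ i, y i =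
    tmul k (e i.castSucc • (seg f 0 (θ i.castSucc)).dag • seg x.2 (θ i.castSucc) (θ i.succ))
      (Gam.U (seg f (θ i.castSucc) (θ i.succ))) := ⟨_, fun _ => rfl⟩
  obtain ⟨z, hz⟩ : ∃ z : Fin p → Cross k R, ∀ i, z i = seg (shear k f x).2 (θ i.castSucc) (θ i.succ) :=
    ⟨_, fun _ => rfl⟩
  obtain ⟨v, hv⟩ : ∃ v : Cross k M, v = (hochOp (Cross k R) (Cross k M) θ (shear k f x)).1 := ⟨_, rfl⟩
  have hemb : Emb.idem ((seg f 0 (θ (Fin.last p))).dag.image D) * (seg f (θ 0) (θ (Fin.last p))).dag =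
      seg f (θ (Fin.last p)) q * (seg f 0 q).dag * seg f 0 (θ 0) := by
    have := Emb.idem_mul_dag_eq (seg f 0 (θ 0)) (seg f (θ 0) (θ (Fin.last p))) (seg f (θ (Fin.last p)) q)
    rwa [seg_mul_seg f (Nat.zero_le _) h0, seg_mul_seg f (Nat.zero_le _) (Fin.is_le _), ← hD] at this
  have h1 : shear k (pull θ f) (embTup (Emb.idem ((seg f (θ 0) q).image Set.univ))
      (embTup (seg f 0 (θ 0)).dag (hochOp R M θ x))) = (v, y) := by
    refine Prod.ext ?_ (funext fun i => ?_)
    · change tmul k ((seg (pull θ f) 0 (Fin.last p)).dag • Emb.idem _ • (seg f 0 (θ 0)).dag • (hochOp R M θ x).1)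
        (Gam.U (seg (pull θ f) 0 (Fin.last p)).dag) = v
      have h1 : seg (pull θ f) 0 (Fin.last p) = seg f (θ 0) (θ (Fin.last p)) := seg_pull θ f 0 _ (Fin.zero_le _)
      rw [pull_dag_smul hM, h1, ← tmul_idem_mul, ← hD, hemb, hv, hochOp_shear_fst]
    · change tmul k ((seg (pull θ f) 0 i.castSucc).dag • Emb.idem _ • (seg f 0 (θ 0)).dag • _) _ = y i
      rw [pull_dag_smul hR, hy, he, hD]
      rfl
  have h2 : hochOp (Cross k R) (Cross k M) θ (shear k f x) = (v, z) :=
    Prod.ext hv.symm (funext fun i => (hz i).symm)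
  have hrm : ∀ y, rmul 0 (unit k R (e 0)) ((v, y) : Tup (Cross k M) (Cross k R) p) = (v, y) := fun y => by
    rw [rmul_zero, he, hD, hv, hochOp_shear_fst, op_unit_smul_tmul_self]
  rw [h1, h2, ← hrm y, ← hrm z]
  refine hc.toBalanced.congr_of_rmul v y z e (fun i => ?_) fun i => ?_
  · have h3 : e i.succ = (seg f (θ i.castSucc) (θ i.succ)).dag • e i.castSucc := by
      rw [he, he, LC.emb_smul_ind, ← Emb.image_mul, ← Emb.dag_mul, seg_mul_seg f (Nat.zero_le _) (le_map_iff θ i)]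
    rw [hy, unit_mul_tmul, tmul_mul_unit, h3, tmul_mul_dag_smul]
  · have h3 : e i.castSucc = e i.castSucc * LC.ind k ((seg f 0 (θ i.castSucc)).dag.image Set.univ) := by
      rw [he, LC.ind_mul_ind, Set.inter_eq_left.2 (Emb.image_mono _ (Set.subset_univ _))]
    have h4 : unit k R (e i.castSucc) * z i =
        tmul k (e i.castSucc • (seg f 0 (θ i.castSucc)).dag • seg x.2 (θ i.castSucc) (θ i.succ))
          (Gam.U (seg f (θ i.castSucc) (θ i.succ))) := by
      rw [h3, map_mul, mul_assoc, hz, seg_shear f x (le_map_iff θ i) (Fin.is_le _), unit_mul_tmul, ← h3]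
    have h5 : e i.castSucc * e i.castSucc = e i.castSucc := by rw [he, ind_mul_self]
    rw [h4, hy, unit_mul_tmul, ← mul_smul, h5]

variable (k R M) in
/-- The shear map commutes with the operators of the diagonal and of the Hochschild complex. -/
theorem shearMap_comp (θ : Fin (p + 1) →o Fin (q + 1)) :
    (shearMap k R M p).comp ((Gam.augmented.barMap θ).comp (Gam.augmented.barCoeff (hochLinear k R M θ) q)) =
      (hochMap (unit k R) (Cross k M) θ).comp (shearMap k R M q) := by
  apply diag_hom_ext
  intro x f
  rw [AddMonoidHom.comp_apply, AddMonoidHom.comp_apply, AddMonoidHom.comp_apply, Gam.augmented.barCoeff_mk,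
    Gam.augmented.barMap_mk, shearMap_mk, shearHom_mk, hochMap_mk]
  have h : hochLinear k R M θ (HochGroup.mk (algebraMap (LC k) R) x) = HochGroup.mk _ (hochOp R M θ x) :=
    hochMap_mk _ θ x
  rw [h]
  refine (congrArg (shearMap k R M p) (mk_barOp_U θ _ f)).trans ?_
  rw [shearMap_mk, embHoch_mk, embHoch_mk, shearHom_mk, mk_shear_pull]

end Cross

/-! ### The inverse of the shear map -/

namespace LC

variable {k : Type*} [CommRing k]

/-- Over the fixed points of `f` a sequence agrees with its translate by `f`. -/
theorem ind_fix_mul (f : Emb) (p : LC k) : ind k f.fix * (f • p) = ind k f.fix * p := ext' fun n => by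
  rw [val_mul, val_mul, val_ind, val_emb_smul]
  split_ifs with h
  · rw [Emb.dag_app_eq.2 (Emb.mem_fix.1 h)]
    rfl
  · rw [zero_mul, zero_mul]

end LC

namespace Tup

section

variable {k R M : Type*} [CommRing k] [Ring R] [Algebra (LC k) R] [AddCommGroup M] [Module R M] [Module Rᵐᵒᵖ M]
  [SMulCommClass R Rᵐᵒᵖ M] [Module (LC k) M] [IsScalarTower (LC k) R M] [IsScalarTower (LC k) Rᵐᵒᵖ M] {n : ℕ}

/-- As `R` is central over `𝒫(k)`, a coefficient of `a_{j+1}` can be moved to `m`. -/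
theorem HochGroup.mk_update_smul (m : M) (b : Fin n → R) (j : Fin n) (p : LC k) :
    HochGroup.mk (algebraMap (LC k) R) (m, Function.update b j (p • b j)) = HochGroup.mk _ (p • m, b) := by
  have hc : CycBalanced (algebraMap (LC k) R) (HochGroup.mk (algebraMap (LC k) R) : Tup M R n → _) :=
    HochGroup.cycBalanced_mk
  have h := hc.toBalanced.rmul_shift (m, b) (fun _ => p) j.castSucc fun i _ => Algebra.commutes _ _
  rw [hc.bal, rmul_zero, op_algebraMap_smul_coeff] at h
  unfold lmul at h
  rw [Algebra.smul_def]
  exact h.symm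

end

variable {N : Type*} [AddCommGroup N] [Module Gamᵐᵒᵖ N] {n : ℕ}

/-- Restriction of the domain of `f_{i+1}` to `A` amounts to the action of `χ` of `f_1 ⋯ f_{i+1}(A)` on `c`. -/
theorem TensorGroup.mk_update_mul_idem (c : N) (f : Fin n → Emb) (i : Fin n) (A : Set ℕ) :
    TensorGroup.mk Gam.augmented.incl (c, fun l => Gam.U (Function.update f i (f i * Emb.idem A) l)) =
      TensorGroup.mk Gam.augmented.incl
        (MulOpposite.op (Gam.U (Emb.idem ((seg f 0 (i + 1)).image A))) • c, fun l => Gam.U (f l)) := by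
  have hb := TensorGroup.balanced_mk (ι := Gam.augmented.incl) (N := N) (n := n)
  have hind : ∀ A, Gam.augmented.incl (LC.ind ℤ A) = Gam.U (Emb.idem A) := Gam.diag_ind
  have h := hb.rmul_shift (c, fun l => Gam.U (f l)) (fun l => LC.ind ℤ ((seg f l (i + 1)).image A)) i.succ
    fun j hj => by
      have hj : (j : ℕ) < i + 1 := hj
      change Gam.augmented.incl (LC.ind ℤ _) * Gam.U (f j) = Gam.U (f j) * Gam.augmented.incl (LC.ind ℤ _)
      rw [hind, hind, ← map_mul, ← map_mul, Emb.mul_idem, ← Emb.image_mul, Fin.val_castSucc, Fin.val_succ,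
        ← seg_succ f j, seg_mul_seg f (Nat.le_succ _) hj]
  rw [hind, hind, rmul_zero, rmul_succ, Fin.val_succ, seg_self, Emb.image_one, ← map_mul] at h
  refine Eq.trans ?_ h.symm
  exact congrArg (fun b => TensorGroup.mk Gam.augmented.incl (c, b)) (Function.comp_update Gam.U f i _)

theorem TensorGroup.mk_range (c : N) (f : Fin n → Emb) :
    TensorGroup.mk Gam.augmented.incl
        (MulOpposite.op (Gam.U (Emb.idem ((seg f 0 n).image Set.univ))) • c, fun l => Gam.U (f l)) =
      TensorGroup.mk Gam.augmented.incl (c, fun l => Gam.U (f l)) := by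
  cases n with
  | zero => rw [seg_self, Emb.image_one, Emb.idem_univ, map_one, MulOpposite.op_one, one_smul]
  | succ n =>
    refine (TensorGroup.mk_update_mul_idem c f (Fin.last n) Set.univ).symm.trans ?_
    rw [Emb.idem_univ, mul_one, Function.update_eq_self]

end Tup

namespace Cross

variable {k : Type*} [CommRing k] {R M : Type*} [Ring R] [Algebra (LC k) R] [DistribMulAction Emb R] [EmbBundle k R]
  [AddCommGroup M] [Module R M] [Module Rᵐᵒᵖ M] [SMulCommClass R Rᵐᵒᵖ M] [Module (LC k) M] [IsScalarTower (LC k) R M]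
  [IsScalarTower (LC k) Rᵐᵒᵖ M] [DistribMulAction Emb M] [CovariantBimodule k R M] {n : ℕ}

variable (k) in
/-- The inverse of the shear map at `m # g ⊗ b_1 # f_1 ⊗ ⋯ ⊗ b_n # f_n`: with `F_l = f_1 ⋯ f_l`, it is the class of
`χ F_n(m) ⊗ b_1 ⊗ F_1(b_2) ⊗ ⋯ ⊗ F_{n-1}(b_n) ⊗ f_1 ⊗ ⋯ ⊗ f_n`, where `χ` is the characteristic function of the
fixed points of `F_n g`. -/
noncomputable def unshear (m : M) (g : Emb) (b : Fin n → R) (f : Fin n → Emb) :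
    TensorGroup Gam.augmented.incl (HochGroup (algebraMap (LC k) R) M n) n :=
  TensorGroup.mk _ (HochGroup.mk _ (LC.ind k (seg f 0 n * g).fix • seg f 0 n • m, fun l => seg f 0 l • b l),
    fun l => Gam.U (f l))

theorem mk_smul_add (p p' : LC k) (m : M) (b : Fin n → R) (f : Fin n → Emb) :
    TensorGroup.mk Gam.augmented.incl (HochGroup.mk (algebraMap (LC k) R) ((p + p') • m, b), fun l => Gam.U (f l)) =
      TensorGroup.mk Gam.augmented.incl (HochGroup.mk _ (p • m, b), fun l => Gam.U (f l)) +
      TensorGroup.mk Gam.augmented.incl (HochGroup.mk _ (p' • m, b), fun l => Gam.U (f l)) := by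
  have hc : CycBalanced (algebraMap (LC k) R) (HochGroup.mk (algebraMap (LC k) R) : Tup M R n → _) :=
    HochGroup.cycBalanced_mk
  have hb := TensorGroup.balanced_mk (ι := Gam.augmented.incl) (N := HochGroup (algebraMap (LC k) R) M n) (n := n)
  rw [add_smul, hc.add_zero, hb.add_zero]

theorem unshear_add (m m' : M) (g : Emb) (b : Fin n → R) (f : Fin n → Emb) :
    unshear k (m + m') g b f = unshear k m g b f + unshear k m' g b f := by
  have hc : CycBalanced (algebraMap (LC k) R) (HochGroup.mk (algebraMap (LC k) R) : Tup M R n → _) :=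
    HochGroup.cycBalanced_mk
  have hb := TensorGroup.balanced_mk (ι := Gam.augmented.incl) (N := HochGroup (algebraMap (LC k) R) M n) (n := n)
  unfold unshear
  rw [smul_add, smul_add, hc.add_zero, hb.add_zero]

theorem unshear_tight (m : M) (g : Emb) (b : Fin n → R) (f : Fin n → Emb) {A B : Set ℕ} (h : Disjoint A B) :
    unshear k m (g * Emb.idem (A ∪ B)) b f =
      unshear k m (g * Emb.idem A) b f + unshear k m (g * Emb.idem B) b f := by
  unfold unshear
  rw [← mul_assoc, ← mul_assoc, ← mul_assoc, Emb.fix_mul_idem, Emb.fix_mul_idem, Emb.fix_mul_idem,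
    Set.inter_union_distrib_left, LC.ind_union (h.mono Set.inter_subset_right Set.inter_subset_right), mk_smul_add]

/-- A coefficient `p` of `m` becomes the coefficient `F_n p`. -/
theorem unshear_coeff_zero (p : LC k) (m : M) (g : Emb) (b : Fin n → R) (f : Fin n → Emb) :
    unshear k (p • m) g b f = TensorGroup.mk _ (HochGroup.mk _ ((seg f 0 n • p) •
      LC.ind k (seg f 0 n * g).fix • seg f 0 n • m, fun l => seg f 0 l • b l), fun l => Gam.U (f l)) := by
  unfold unshear
  rw [(CovariantBimodule.embModule k R).smul_smul, smul_comm (LC.ind k _)]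

theorem unshear_bal (m : M) (g : Emb) (A : Set ℕ) (b : Fin n → R) (f : Fin n → Emb) :
    unshear k (LC.ind k A • m) g b f = unshear k m (Emb.idem A * g) b f := by
  rw [unshear_coeff_zero]
  unfold unshear
  rw [LC.emb_smul_ind, ← mul_smul, LC.ind_mul_ind, ← Emb.fix_idem_mul, ← mul_assoc, ← Emb.mul_idem, mul_assoc]

theorem unshear_update_add (m : M) (g : Emb) (b : Fin n → R) (f : Fin n → Emb) (i : Fin n) (v w : R) :
    unshear k m g (Function.update b i (v + w)) f =
      unshear k m g (Function.update b i v) f + unshear k m g (Function.update b i w) f := by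
  have hc : CycBalanced (algebraMap (LC k) R) (HochGroup.mk (algebraMap (LC k) R) : Tup M R n → _) :=
    HochGroup.cycBalanced_mk
  have hb := TensorGroup.balanced_mk (ι := Gam.augmented.incl) (N := HochGroup (algebraMap (LC k) R) M n) (n := n)
  have e : ∀ v, (fun l : Fin n => seg f 0 l • Function.update b i v l) =
      Function.update (fun l : Fin n => seg f 0 l • b l) i (seg f 0 i • v) := fun v => funext fun l =>
    Function.apply_update (fun (l : Fin n) (v : R) => seg f 0 l • v) b i v l
  unfold unshear
  rw [e, e, e, smul_add, hc.add_succ, hb.add_zero]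

/-- A coefficient `p` of the factor with index `i` becomes the coefficient `F_i p`. -/
theorem unshear_coeff (p : LC k) (m : M) (g : Emb) (b : Fin n → R) (f : Fin n → Emb) (i : Fin n) :
    unshear k m g (Function.update b i (p • b i)) f = TensorGroup.mk _ (HochGroup.mk _ ((seg f 0 i • p) •
      LC.ind k (seg f 0 n * g).fix • seg f 0 n • m, fun l => seg f 0 l • b l), fun l => Gam.U (f l)) := by
  have e : (fun l : Fin n => seg f 0 l • Function.update b i (p • b i) l) =
      Function.update (fun l : Fin n => seg f 0 l • b l) i ((seg f 0 i • p) • seg f 0 i • b i) := by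
    rw [← (EmbBundle.embModule k).smul_smul]
    exact funext fun l => Function.apply_update (fun (l : Fin n) (v : R) => seg f 0 l • v) b i _ l
  unfold unshear
  rw [e, HochGroup.mk_update_smul _ (fun l : Fin n => seg f 0 l • b l)]

/-- Restriction of the domain of `f_{i+1}` to `A` amounts to restriction of the coefficients to
`f_1 ⋯ f_{i+1}(A)`. -/
theorem unshear_mul_idem (m : M) (g : Emb) (b : Fin n → R) (f : Fin n → Emb) (i : Fin n) (A : Set ℕ) :
    unshear k m g b (Function.update f i (f i * Emb.idem A)) =
      TensorGroup.mk _ (HochGroup.mk _ (LC.ind k ((seg f 0 (i + 1)).image A) •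
        LC.ind k (seg f 0 n * g).fix • seg f 0 n • m, fun l => seg f 0 l • b l), fun l => Gam.U (f l)) := by
  have hR := EmbBundle.embModule k (R := R)
  have hM := CovariantBimodule.embModule k R (M := M)
  obtain ⟨B, hB⟩ : ∃ B, B = (seg f 0 (i + 1)).image A := ⟨_, rfl⟩
  obtain ⟨m', hm'⟩ : ∃ m', m' = LC.ind k (seg f 0 n * g).fix • seg f 0 n • m := ⟨_, rfl⟩
  have hseg : ∀ l : ℕ, seg (Function.update f i (f i * Emb.idem A)) 0 l =
      if (i : ℕ) < l then Emb.idem B * seg f 0 l else seg f 0 l := by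
    intro l
    split_ifs with h
    · rw [hB]
      exact Emb.seg_update_mul_idem f i A h
    · exact seg_update_of_not f i _ (by omega)
  have h0 : LC.ind k (seg (Function.update f i (f i * Emb.idem A)) 0 n * g).fix •
      seg (Function.update f i (f i * Emb.idem A)) 0 n • m = LC.ind k B • m' := by
    rw [hseg, if_pos i.2, mul_assoc, Emb.fix_idem_mul, ← LC.ind_mul_ind, mul_smul _ _ m, hM.idem_smul, mul_smul,
      smul_comm (LC.ind k (seg f 0 n * g).fix), ← mul_smul (LC.ind k B) (LC.ind k B), ind_mul_self, hm']
  have h1 : (fun l : Fin n => seg (Function.update f i (f i * Emb.idem A)) 0 l • b l) =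
      fun l => if l ∈ Finset.univ.filter (fun l => i < l) then LC.ind k B • seg f 0 l • b l else seg f 0 l • b l := by
    funext l
    rw [hseg]
    simp only [Finset.mem_filter, Finset.mem_univ, true_and, Fin.lt_def]
    split_ifs
    · rw [mul_smul, hR.idem_smul]
    · rfl
  unfold unshear
  rw [TensorGroup.mk_update_mul_idem, h0, h1, ← hm', ← hB]
  rw [HochGroup.mk_smul_coeff (LC.ind k B) (m', fun l : Fin n => seg f 0 l • b l) _ (ind_mul_self B), op_U_smul,
    Emb.dag_idem, embHoch_idem, ← mul_smul, ind_mul_self]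

theorem unshear_update_tight (m : M) (g : Emb) (b : Fin n → R) (f : Fin n → Emb) (i : Fin n) (v : Emb)
    {A B : Set ℕ} (h : Disjoint A B) :
    unshear k m g b (Function.update f i (v * Emb.idem (A ∪ B))) =
      unshear k m g b (Function.update f i (v * Emb.idem A)) +
        unshear k m g b (Function.update f i (v * Emb.idem B)) := by
  have e : ∀ A, Function.update f i (v * Emb.idem A) =
      Function.update (Function.update f i v) i (Function.update f i v i * Emb.idem A) := fun A => by
    rw [Function.update_self, Function.update_idem]
  rw [e, e, e, unshear_mul_idem, unshear_mul_idem, unshear_mul_idem, Emb.image_union,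
    LC.ind_union (Emb.image_disjoint _ h), mk_smul_add]

theorem unshear_update_bal (m : M) (g : Emb) (b : Fin n → R) (f : Fin n → Emb) (i : Fin n) (A : Set ℕ) :
    unshear k m g (Function.update b i (LC.ind k A • b i)) f =
      unshear k m g b (Function.update f i (Emb.idem A * f i)) := by
  have hM := CovariantBimodule.embModule k R (M := M)
  rw [Emb.idem_mul, unshear_mul_idem, unshear_coeff, LC.emb_smul_ind, seg_zero_succ, Emb.image_mul,
    Emb.image_dag_image, Emb.image_inter, ← LC.ind_mul_ind, mul_smul]
  -- the coefficient is supported on the range of `f_1 ⋯ f_{i+1}`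
  have h : LC.ind k ((seg f 0 i).image ((f i).image Set.univ)) • seg f 0 n • m = seg f 0 n • m := by
    rw [← hM.idem_smul, ← mul_smul, ← Emb.image_mul, ← seg_zero_succ,
      ← seg_mul_seg f (Nat.zero_le (i + 1 : ℕ)) i.2, ← mul_assoc, Emb.idem_image_mul]
  rw [smul_comm (LC.ind k ((seg f 0 i).image ((f i).image Set.univ))) (LC.ind k (seg f 0 n * g).fix), h]

end Cross

namespace Cross

universe v u w

variable {k : Type v} [CommRing k] {R : Type u} {M : Type w} [Ring R] [Algebra (LC k) R] [DistribMulAction Emb R]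
  [EmbBundle k R] [AddCommGroup M] [Module R M] [Module Rᵐᵒᵖ M] [SMulCommClass R Rᵐᵒᵖ M] [Module (LC k) M]
  [IsScalarTower (LC k) R M] [IsScalarTower (LC k) Rᵐᵒᵖ M] [DistribMulAction Emb M] [CovariantBimodule k R M] {n : ℕ}

variable (k) in
/-- The element `a # f`, for a pair `(a, f)`. -/
noncomputable abbrev pureTensor (p : R × Emb) : Cross k R := tmul k p.1 (Gam.U p.2)

variable (k R M n) in
theorem exists_unshearMulti : ∃ T : (Fin n → Cross k R) →
    Cross k M →+ TensorGroup Gam.augmented.incl (HochGroup (algebraMap (LC k) R) M n) n,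
    IsMultiadditive T ∧ ∀ (b : Fin n → R × Emb) (m : M) (g : Emb),
      T (pureTensor k ∘ b) (tmul k m (Gam.U g)) = unshear k m g (fun i => (b i).1) fun i => (b i).2 := by
  choose E hE using fun b : Fin n → R × Emb => exists_hom (k := k)
    (fun (m : M) g => unshear k m g (fun i => (b i).1) fun i => (b i).2) (fun m m' g => unshear_add m m' g _ _)
    (fun m g A B h => unshear_tight m g _ _ h) fun m g A => unshear_bal m g A _ _
  have hE' : ∀ (b : Fin n → R × Emb) (i : Fin n) (a : R) (v : Emb) (m : M) (g : Emb),
      E (Function.update b i (a, v)) (tmul k m (Gam.U g)) =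
        unshear k m g (Function.update (fun i => (b i).1) i a) (Function.update (fun i => (b i).2) i v) := by
    intro b i a v m g
    rw [hE]
    congr 1
    · exact Function.comp_update Prod.fst b i (a, v)
    · exact Function.comp_update Prod.snd b i (a, v)
  obtain ⟨T, hT, hT'⟩ := IsMultiadditive.exists_extension.{u, max w u} (s := pureTensor k (R := R)) closure_range_tmul E
    fun b i => by
      obtain ⟨L, hL⟩ := exists_hom (k := k) (fun (a : R) v => E (Function.update b i (a, v)))
        (fun a a' v => hom_ext fun m g => by
          rw [AddMonoidHom.add_apply, hE', hE', hE', unshear_update_add])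
        (fun a v A B h => hom_ext fun m g => by
          rw [AddMonoidHom.add_apply, hE', hE', hE', unshear_update_tight _ _ _ _ _ _ h])
        (fun a v A => hom_ext fun m g => by
          have h := unshear_update_bal m g (Function.update (fun i => (b i).1) i a)
            (Function.update (fun i => (b i).2) i v) i A (k := k)
          rw [Function.update_self, Function.update_self, Function.update_idem, Function.update_idem] at h
          rw [hE', hE', h])
      exact ⟨L, fun p => hL p.1 p.2⟩
  exact ⟨T, hT, fun b m g => by rw [hT', hE]⟩

variable (k R M n) in
/-- The multiadditive extension of `unshear`. -/
noncomputable def unshearMulti : (Fin n → Cross k R) →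
    Cross k M →+ TensorGroup Gam.augmented.incl (HochGroup (algebraMap (LC k) R) M n) n :=
  (exists_unshearMulti k R M n).choose

theorem unshearMulti_tmul (b : Fin n → R) (f : Fin n → Emb) (m : M) (g : Emb) :
    unshearMulti k R M n (fun i => tmul k (b i) (Gam.U (f i))) (tmul k m (Gam.U g)) = unshear k m g b f :=
  (exists_unshearMulti k R M n).choose_spec.2 (fun i => (b i, f i)) m g

theorem unshearMulti_update (b : Fin n → R) (f : Fin n → Emb) (i : Fin n) (p : LC k) (m : M) (g : Emb) :
    unshearMulti k R M n (Function.update (fun i => tmul k (b i) (Gam.U (f i))) i (tmul k (p • b i) (Gam.U (f i))))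
      (tmul k m (Gam.U g)) = unshear k m g (Function.update b i (p • b i)) f := by
  rw [← unshearMulti_tmul]
  refine congrArg (fun c => unshearMulti k R M n c _) (funext fun l => ?_)
  exact (Function.apply_update (fun l (v : R) => tmul k v (Gam.U (f l))) b i _ l).symm

variable (k R M n) in
/-- The relations hold, since by `unshear_coeff_zero` and `unshear_coeff` a coefficient on either side of a tensor sign
becomes the same coefficient of `m`. For the tensor sign behind `m # g` this is so over the fixed points of `F_n g`
only, which is the reason for the factor `χ` in `unshear`. -/
theorem cycBalanced_unshearMulti : CycBalanced (unit k R)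
    fun x : Tup (Cross k M) (Cross k R) n => unshearMulti k R M n x.2 x.1 := by
  refine IsMultiadditive.cycBalanced (t := Set.univ) (AddSubgroup.closure_univ) closure_range_tmul
    (s := pureTensor k (R := R)) closure_range_tmul (exists_unshearMulti k R M n).choose_spec.1 ?_ ?_
  · rintro p - _ ⟨⟨m, g⟩, rfl⟩ b j
    have hr : unshearMulti k R M n (Function.update (pureTensor k ∘ b) j (unit k R p * pureTensor k (b j)))
        (tmul k m (Gam.U g)) = TensorGroup.mk _ (HochGroup.mk _ ((seg (fun i => (b i).2) 0 j • p) •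
      LC.ind k (seg (fun i => (b i).2) 0 n * g).fix • seg (fun i => (b i).2) 0 n • m,
        fun l => seg (fun i => (b i).2) 0 l • (b l).1), fun l => Gam.U (b l).2) := by
      rw [unit_mul_tmul]
      exact (unshearMulti_update (fun i => (b i).1) _ j p m g).trans (unshear_coeff _ _ _ _ _ _)
    refine Eq.trans ?_ hr.symm
    cases n with
    | zero => exact j.elim0
    | succ n =>
      cases j using Fin.cases with
      | zero =>
        change unshearMulti k R M (n + 1) _ (MulOpposite.op (unit k R p) • tmul k m (Gam.U g)) = _
        rw [op_unit_smul_tmul]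
        refine (unshearMulti_tmul _ _ _ _).trans ?_
        rw [unshear_coeff_zero, ← mul_smul, ← mul_smul, mul_comm, LC.ind_fix_mul, Fin.val_zero,
          seg_self, one_smul, mul_comm (LC.ind k _) p, mul_smul]
      | succ j =>
        rw [← Fin.succ_castSucc, rmul_succ]
        change unshearMulti k R M (n + 1) (Function.update (pureTensor k ∘ b) j.castSucc
          (pureTensor k (b j.castSucc) * unit k R p)) (tmul k m (Gam.U g)) = _
        rw [tmul_mul_unit]
        refine (unshearMulti_update (fun i => (b i).1) (fun i => (b i).2) j.castSucc ((b j.castSucc).2 • p) m g).trans ?_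
        rw [unshear_coeff, Fin.val_succ, ← Fin.val_castSucc j, seg_zero_succ, mul_smul]
  · rintro p - _ ⟨⟨m, g⟩, rfl⟩ b
    have hl : unshearMulti k R M n (pureTensor k ∘ b) (unit k R p • tmul k m (Gam.U g)) =
        TensorGroup.mk _ (HochGroup.mk _ ((seg (fun i => (b i).2) 0 n • p) •
      LC.ind k (seg (fun i => (b i).2) 0 n * g).fix • seg (fun i => (b i).2) 0 n • m,
        fun l => seg (fun i => (b i).2) 0 l • (b l).1), fun l => Gam.U (b l).2) := by
      rw [unit_smul_tmul, ← unshear_coeff_zero]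
      exact unshearMulti_tmul _ _ _ _
    refine hl.trans ?_
    cases n with
    | zero =>
      rw [Fin.last_zero, rmul_zero, op_unit_smul_tmul]
      refine Eq.trans ?_ (unshearMulti_tmul _ _ _ _).symm
      rw [unshear_coeff_zero, ← mul_smul, ← mul_smul, mul_comm, mul_comm _ (LC.ind k _), seg_self]
      simp only [one_smul, one_mul, LC.ind_fix_mul]
    | succ n =>
      rw [← Fin.succ_last, rmul_succ]
      change _ = unshearMulti k R M (n + 1) (Function.update (pureTensor k ∘ b) (Fin.last n)
          (pureTensor k (b (Fin.last n)) * unit k R p)) (tmul k m (Gam.U g))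
      rw [tmul_mul_unit]
      refine Eq.trans ?_ (unshearMulti_update (fun i => (b i).1) (fun i => (b i).2) (Fin.last n)
        ((b (Fin.last n)).2 • p) m g).symm
      rw [unshear_coeff, ← mul_smul _ (b (Fin.last n)).2 p, ← seg_zero_succ (fun i => (b i).2) (Fin.last n), Fin.val_last]

variable (k R M n) in
/-- The inverse of `shearMap`. -/
noncomputable def unshearMap : HochGroup (unit k R) (Cross k M) n →+
    TensorGroup Gam.augmented.incl (HochGroup (algebraMap (LC k) R) M n) n :=
  HochGroup.lift (cycBalanced_unshearMulti k R M n)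

theorem unshearMap_mk (m : M) (g : Emb) (b : Fin n → R) (f : Fin n → Emb) :
    unshearMap k R M n (HochGroup.mk _ (tmul k m (Gam.U g), fun i => tmul k (b i) (Gam.U (f i)))) =
      unshear k m g b f :=
  (HochGroup.lift_mk _ _).trans (unshearMulti_tmul b f m g)

/-! ### The two composites -/

variable (k R M n) in
theorem unshearMap_comp_shearMap : (unshearMap k R M n).comp (shearMap k R M n) = AddMonoidHom.id _ := by
  have hR := EmbBundle.embModule k (R := R)
  have hM := CovariantBimodule.embModule k R (M := M)
  apply diag_hom_ext
  rintro ⟨m, a⟩ f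
  rw [AddMonoidHom.comp_apply, AddMonoidHom.id_apply, shearMap_mk, shearHom_mk]
  refine (unshearMap_mk _ _ _ _).trans ?_
  unfold unshear
  obtain ⟨p, hp⟩ : ∃ p, p = LC.ind k ((seg f 0 n).image Set.univ) := ⟨_, rfl⟩
  have hpp : p * p = p := by rw [hp, ind_mul_self]
  have h0 : LC.ind k (seg f 0 n * (seg f 0 n).dag).fix • seg f 0 n • (seg f 0 n).dag • m = p • m := by
    have h : (seg f 0 n * (seg f 0 n).dag).fix = (seg f 0 n).image Set.univ := by
      have := Emb.fix_idem_mul 1 ((seg f 0 n).image Set.univ)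
      rw [mul_one] at this
      rw [Emb.mul_dag, this]
      exact Set.inter_eq_left.2 fun x _ => Emb.mem_fix.2 (Emb.one_app x)
    rw [h, ← mul_smul (seg f 0 n), Emb.mul_dag, hM.idem_smul, ← mul_smul, ← hp, hpp]
  have h1 : ∀ l : Fin n, p • seg f 0 l • (seg f 0 l).dag • a l = p • a l := fun l => by
    have h : (seg f 0 n).image Set.univ ⊆ (seg f 0 l).image Set.univ := by
      rw [← seg_mul_seg f (Nat.zero_le (l : ℕ)) l.2.le, Emb.image_mul]
      exact Emb.image_mono _ (Set.subset_univ _)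
    rw [← mul_smul (seg f 0 l), Emb.mul_dag, hR.idem_smul, ← mul_smul, hp, LC.ind_mul_ind, Set.inter_eq_left.2 h]
  have h2 : HochGroup.mk (algebraMap (LC k) R) (p • m, fun l : Fin n => seg f 0 l • (seg f 0 l).dag • a l) =
      HochGroup.mk _ (p • m, a) := by
    refine (HochGroup.mk_idem p hpp (m, _)).symm.trans (Eq.trans ?_ (HochGroup.mk_idem p hpp (m, a)))
    exact congrArg (fun b => HochGroup.mk (algebraMap (LC k) R) (p • m, b)) (funext h1)
  rw [h0, h2, ← TensorGroup.mk_range (HochGroup.mk _ (m, a)), op_U_smul, Emb.dag_idem, embHoch_idem, hp]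

section

variable (m : M) (g : Emb) (b : Fin n → R) (f : Fin n → Emb)

theorem op_unit_ind_smul_tmul (A : Set ℕ) :
    MulOpposite.op (unit k R (LC.ind k A)) • tmul k m (Gam.U g) = tmul k m (Gam.U (g * Emb.idem A)) := by
  rw [op_unit_smul_tmul, LC.emb_smul_ind, ← tmul_idem_mul, Emb.mul_idem]

variable (k) in
/-- The class of `m # g ⊗ b_1 # f_1 ⊗ ⋯ ⊗ b_n # f_n`. -/
noncomputable def pureClass : HochGroup (unit k R) (Cross k M) n :=
  HochGroup.mk _ (tmul k m (Gam.U g), fun i => tmul k (b i) (Gam.U (f i)))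

theorem pureClass_idem_empty : pureClass k m (Emb.idem ∅) b f = 0 := by
  have hc : CycBalanced (unit k R) (HochGroup.mk (unit k R) : Tup (Cross k M) (Cross k R) n → _) :=
    HochGroup.cycBalanced_mk
  let u : Cross k M →+ HochGroup (unit k R) (Cross k M) n :=
    AddMonoidHom.mk' (fun x => HochGroup.mk _ (x, fun i => tmul k (b i) (Gam.U (f i)))) fun x y => hc.add_zero _ _ _
  have h : tmul k m (Gam.U (Emb.idem ∅)) = 0 := by
    have h0 : LC.ind k ∅ = 0 := LC.ext' fun n => by simp
    rw [← mul_one (Emb.idem ∅), tmul_idem_mul, h0]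
    exact (unit_smul_tmul (R := R) 0 m 1).symm.trans (by rw [map_zero, zero_smul])
  exact (congrArg u h).trans (map_zero u)

theorem pureClass_union {A B : Set ℕ} (h : Disjoint A B) :
    pureClass k m (g * Emb.idem (A ∪ B)) b f =
      pureClass k m (g * Emb.idem A) b f + pureClass k m (g * Emb.idem B) b f := by
  have hc : CycBalanced (unit k R) (HochGroup.mk (unit k R) : Tup (Cross k M) (Cross k R) n → _) :=
    HochGroup.cycBalanced_mk
  unfold pureClass
  rw [← op_unit_ind_smul_tmul (R := R), LC.ind_union h, map_add, MulOpposite.op_add, add_smul, op_unit_ind_smul_tmul,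
    op_unit_ind_smul_tmul, hc.add_zero]

/-- A set that is disjoint from its image under `(f_1 ⋯ f_n g)†` does not contribute: its characteristic function can
be moved once around the cycle. -/
theorem pureClass_eq_zero {A : Set ℕ} (h : Disjoint ((seg f 0 n * g).dag.image A) A) :
    pureClass k m (g * Emb.idem A) b f = 0 := by
  have hc : CycBalanced (unit k R) (HochGroup.mk (unit k R) : Tup (Cross k M) (Cross k R) n → _) :=
    HochGroup.cycBalanced_mk
  have h1 := hc.toBalanced.rmul_shift (tmul k m (Gam.U (g * Emb.idem A)), fun i => tmul k (b i) (Gam.U (f i)))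
    (fun l : Fin (n + 1) => LC.ind k ((seg f 0 l).dag.image A)) (Fin.last n) fun i _ => unit_ind_mul f A i (b i)
  rw [← hc.cyc, rmul_zero] at h1
  unfold lmulZero at h1
  rw [unit_smul_tmul, ← tmul_idem_mul, op_unit_ind_smul_tmul, Fin.val_last, Fin.val_zero, seg_self, Emb.dag_one,
    Emb.image_one, mul_assoc, Emb.idem_mul_idem, Set.inter_self, ← mul_assoc, Emb.idem_mul, ← Emb.image_mul,
    ← Emb.dag_mul, mul_assoc, Emb.idem_mul_idem, h.inter_eq, Emb.mul_idem_empty] at h1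
  exact h1.trans (pureClass_idem_empty m b f)

/-- Only the fixed points of `f_1 ⋯ f_n g` contribute: the complement is the union of three sets to which
`pureClass_eq_zero` applies. -/
theorem pureClass_fix : pureClass k m (g * Emb.idem (seg f 0 n * g).fix) b f = pureClass k m g b f := by
  obtain ⟨col, hcol⟩ := Emb.exists_coloring (seg f 0 n * g)
  obtain ⟨D, hD⟩ : ∃ D, D = (seg f 0 n * g).fix := ⟨_, rfl⟩
  have hA : ∀ c, pureClass k m (g * Emb.idem (Dᶜ ∩ col ⁻¹' {c})) b f = 0 := fun c => by
    refine pureClass_eq_zero m g b f (Set.disjoint_left.2 ?_)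
    rintro x ⟨y, ⟨-, hy⟩, hyx⟩ ⟨hx, hxc⟩
    rw [Emb.dag_app_eq] at hyx
    refine hcol x y hyx (fun hxy => hx ?_) (hxc.trans hy.symm)
    rw [hD]
    exact hxy ▸ hyx
  have hdisj : ∀ c d, c ≠ d → Disjoint (Dᶜ ∩ col ⁻¹' {c}) (Dᶜ ∩ col ⁻¹' {d}) := fun c d hcd =>
    Set.disjoint_left.2 fun x hx hx' => hcd (hx.2.symm.trans hx'.2)
  have huniv : (Set.univ : Set ℕ) = D ∪ (Dᶜ ∩ col ⁻¹' {0} ∪ (Dᶜ ∩ col ⁻¹' {1} ∪ Dᶜ ∩ col ⁻¹' {2})) := by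
    refine (Set.eq_univ_of_forall fun x => ?_).symm
    by_cases hx : x ∈ D
    · exact Or.inl hx
    · have : ∀ c : Fin 3, c = 0 ∨ c = 1 ∨ c = 2 := by decide
      rcases this (col x) with h | h | h
      · exact Or.inr (Or.inl ⟨hx, h⟩)
      · exact Or.inr (Or.inr (Or.inl ⟨hx, h⟩))
      · exact Or.inr (Or.inr (Or.inr ⟨hx, h⟩))
  have h : pureClass k m (g * Emb.idem Set.univ) b f = pureClass k m (g * Emb.idem D) b f := by
    rw [huniv, pureClass_union, pureClass_union, pureClass_union, hA, hA, hA, add_zero, add_zero, add_zero]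
    · exact hdisj 1 2 (by decide)
    · exact Set.disjoint_union_right.2 ⟨hdisj 0 1 (by decide), hdisj 0 2 (by decide)⟩
    · refine Set.disjoint_left.2 fun x hx hx' => ?_
      rcases hx' with h | h | h <;> exact h.1 hx
  rw [← hD, ← h, Emb.idem_univ, mul_one]

/-- The factors `b_l # f_l` are recovered up to the characteristic function of the domain of `F_{l-1}`, which is harmless
as `F_n g` and so the zeroth factor have been restricted to the fixed points. -/
theorem shearMap_unshear : shearMap k R M n (unshear k m g b f) = pureClass k m g b f := by
  have hR := EmbBundle.embModule k (R := R)
  have hM := CovariantBimodule.embModule k R (M := M)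
  have hc : CycBalanced (unit k R) (HochGroup.mk (unit k R) : Tup (Cross k M) (Cross k R) n → _) :=
    HochGroup.cycBalanced_mk
  obtain ⟨D, hD⟩ : ∃ D, D = (seg f 0 n * g).fix := ⟨_, rfl⟩
  -- over the fixed points of `F_n g`, the maps `F_n†` and `g` agree
  have hcan : Emb.idem ((seg f 0 n).dag.image D) * (seg f 0 n).dag = g * Emb.idem D := by
    rw [← Emb.mul_idem]
    apply Emb.ext_iff_some
    intro x y
    simp only [Emb.mul_app_eq, Emb.idem_app_eq, Emb.dag_app_eq, hD, Emb.mem_fix]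
    constructor
    · rintro ⟨_, ⟨rfl, z, h, h'⟩, h''⟩
      exact ⟨x, ⟨rfl, z, h, h'⟩, (Emb.app_inj h'' h').symm ▸ h⟩
    · rintro ⟨_, ⟨rfl, z, h, h'⟩, h''⟩
      obtain rfl : z = y := by simpa [h] using h''
      exact ⟨x, ⟨rfl, z, h, h'⟩, h'⟩
  have h0 : (seg f 0 n).dag • LC.ind k D • seg f 0 n • m =
      LC.ind k ((seg f 0 n).dag.image D) • m := by
    have h := Emb.mul_dag (seg f 0 n).dag
    rw [Emb.dag_dag] at h
    rw [hM.smul_smul, ← mul_smul (seg f 0 n).dag, h, hM.idem_smul, LC.emb_smul_ind, ← mul_smul,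
      LC.ind_mul_ind, Set.inter_eq_left.2 (Emb.image_mono _ (Set.subset_univ _))]
  have h1 : shear k f (LC.ind k D • seg f 0 n • m, fun l : Fin n => seg f 0 l • b l) =
      rmul 0 (unit k R (LC.ind k ((seg f 0 ((0 : Fin (n + 1)) : ℕ)).dag.image D)))
        (tmul k m (Gam.U g), fun i => tmul k (LC.ind k ((seg f 0 i).dag.image Set.univ) • b i) (Gam.U (f i))) := by
    refine Prod.ext ?_ (funext fun i => ?_)
    · rw [rmul_zero, Fin.val_zero, seg_self, Emb.dag_one, Emb.image_one]
      refine Eq.trans ?_ (op_unit_ind_smul_tmul m g D).symm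
      change tmul k ((seg f 0 n).dag • LC.ind k D • seg f 0 n • m) (Gam.U (seg f 0 n).dag) = _
      rw [h0, ← tmul_idem_mul, hcan]
    · change tmul k ((seg f 0 i).dag • seg f 0 i • b i) (Gam.U (f i)) = tmul k _ (Gam.U (f i))
      have h := Emb.mul_dag (seg f 0 i).dag
      rw [Emb.dag_dag] at h
      rw [← mul_smul, h, hR.idem_smul]
  rw [← pureClass_fix]
  unfold unshear pureClass
  rw [shearMap_mk, shearHom_mk, ← hD, h1, ← op_unit_ind_smul_tmul (R := R)]
  have h2 := hc.toBalanced.congr_of_rmul (tmul k m (Gam.U g)) (fun i => tmul k (b i) (Gam.U (f i)))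
    (fun i => tmul k (LC.ind k ((seg f 0 i).dag.image Set.univ) • b i) (Gam.U (f i)))
    (fun l => LC.ind k ((seg f 0 l).dag.image D)) (fun i => unit_ind_mul f D i (b i)) fun i => by
      rw [unit_mul_tmul, unit_mul_tmul, ← mul_smul, LC.ind_mul_ind, Fin.val_castSucc,
        Set.inter_eq_left.2 (Emb.image_mono _ (Set.subset_univ _))]
  refine h2.symm.trans ?_
  rw [rmul_zero, Fin.val_zero, seg_self, Emb.dag_one, Emb.image_one]

end

variable (k R M n) in
theorem shearMap_comp_unshearMap : (shearMap k R M n).comp (unshearMap k R M n) = AddMonoidHom.id _ := by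
  refine HochGroup.hom_ext_of_closure closure_range_tmul (s := pureTensor k (R := R)) closure_range_tmul ?_
  rintro _ ⟨⟨m, g⟩, rfl⟩ b
  exact (congrArg (shearMap k R M n) (unshearMap_mk m g (fun i => (b i).1) fun i => (b i).2)).trans
    (shearMap_unshear m g _ _)

end Cross

/-! ### The isomorphism of simplicial abelian groups -/

section

universe v u w

variable (k : Type v) (R : Type u) (M : Type w) [CommRing k] [Ring R] [Algebra (LC k) R]
  [DistribMulAction Emb R] [EmbBundle k R] [AddCommGroup M] [Module R M] [Module Rᵐᵒᵖ M]
  [SMulCommClass R Rᵐᵒᵖ M] [Module (LC k) M] [IsScalarTower (LC k) R M]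
  [IsScalarTower (LC k) Rᵐᵒᵖ M] [DistribMulAction Emb M] [CovariantBimodule k R M]

/-- The map `φ` in degree `n`, as an isomorphism. -/
noncomputable def shearEquiv (n : ℕ) : TensorGroup Gam.augmented.incl (HochGroup (algebraMap (LC k) R) M n) n ≃+
    HochGroup (Cross.unit k R) (Cross k M) n where
  __ := Cross.shearMap k R M n
  invFun := Cross.unshearMap k R M n
  left_inv := DFunLike.congr_fun (Cross.unshearMap_comp_shearMap k R M n)
  right_inv := DFunLike.congr_fun (Cross.shearMap_comp_unshearMap k R M n)

/-- The isomorphism `φ`. -/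
noncomputable def crossIso : diagPerpHochschild k R M ≅ crossHochschild k R M :=
  NatIso.ofComponents (fun Δ => AddEquiv.toAddCommGrpIso (shearEquiv k R M Δ.unop.len)) fun θ => by
    apply AddCommGrpCat.hom_ext
    exact Cross.shearMap_comp k R M θ.unop.toOrderHom

theorem isCrossMap_crossIso : IsCrossMap k (crossIso k R M).hom := by
  intro n m a f
  simp only [Emb.partialProd_eq_seg]
  exact (Cross.shearMap_mk _ _).trans (Cross.shearHom_mk _ _)

variable {k R M} in
theorem IsCrossMap.unique {φ ψ : diagPerpHochschild k R M ⟶ crossHochschild k R M} (hφ : IsCrossMap k φ)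
    (hψ : IsCrossMap k ψ) : φ = ψ := by
  apply NatTrans.ext
  funext Δ
  apply AddCommGrpCat.hom_ext
  apply Cross.diag_hom_ext
  rintro ⟨m, a⟩ f
  exact (hφ Δ.unop.len m a f).trans (hψ Δ.unop.len m a f).symm

end

theorem mainTheorem4 {k : Type*} {R : Type*} {M : Type*} [Field k] [Ring R] [Algebra (LC k) R]
    [DistribMulAction Emb R] [EmbBundle k R] [AddCommGroup M] [Module R M] [Module Rᵐᵒᵖ M]
    [SMulCommClass R Rᵐᵒᵖ M] [Module (LC k) M] [IsScalarTower (LC k) R M]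
    [IsScalarTower (LC k) Rᵐᵒᵖ M] [DistribMulAction Emb M] [CovariantBimodule k R M] :
    ∃ φ : diagPerpHochschild k R M ⟶ crossHochschild k R M,
      IsCrossMap k φ ∧
      (∀ ψ : diagPerpHochschild k R M ⟶ crossHochschild k R M, IsCrossMap k ψ → ψ = φ) ∧
      IsIso φ ∧
      ∃ e : Gam.augmented.hyperhomology (hochschildGamComplex k R M) ⟶
          (AlgebraicTopology.alternatingFaceMapComplex _).obj (diagPerpHochschild k R M),
        QuasiIso e ∧
        QuasiIso (e ≫ (AlgebraicTopology.alternatingFaceMapComplex _).map φ :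
          Gam.augmented.hyperhomology (hochschildGamComplex k R M) ⟶
            crossHochschildComplex k R M) := by
  obtain ⟨e, he⟩ := AugmentedAlgebra.exists_quasiIso_diag Gam.augmented (hochschildGam k R M)
  refine ⟨(crossIso k R M).hom, isCrossMap_crossIso k R M, fun ψ hψ => hψ.unique (isCrossMap_crossIso k R M),
    inferInstance, e, he, ?_⟩
  have hφ : IsIso ((AlgebraicTopology.alternatingFaceMapComplex _).map (crossIso k R M).hom) := inferInstance
  have hφ' : QuasiIso ((AlgebraicTopology.alternatingFaceMapComplex _).map (crossIso k R M).hom) := inferInstance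
  exact @quasiIso_comp _ _ _ _ _ _ _ _ e _ _ _ _ he hφ'
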